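/- Let $K$ be a global function field, that is, a finite extension of the rational function field $\mathbb{F}_q(T)$ over a finite field $\mathbb{F}_q$, and let $L/K$ be a finite cyclic Galois extension of degree $n$ with Galois group $G=G(L/K)$ and a generator $\sigma$ of $G$. For such a field $M$ (here $M=K$ or $M=L$), let $I_M=\prod_P' M_P^\times$ be its idele group: the restricted product, with respect to the unit groups $U_P$, of the multiplicative groups of the completions $M_P$ at all places $P$ of $M$ (the places being the normalised discrete valuations of $M$). Let $C_M=I_M/M^\times$ be the idele class group. The group $G$ acts on $I_L$ by $(\tau\alpha)_{\mathfrak P}=\tau(\alpha_{\mathfrak P\circ\tau})$, where $\tau:L_{\mathfrak P\circ\tau}\to L_{\mathfrak P}$ is the continuous extension of $\tau:L\to L$, and hence on $C_L$. Let $N_{L/K}C_L\subseteq C_K$ be the image of the idele norm $N_{L/K}:I_L\to I_K$, $N_{L/K}(\alpha)_P=\prod_{\mathfrak P\mid P}N_{L_{\mathfrak P}/K_P}(\alpha_{\mathfrak P})$. For a $G$-module $A$ (written multiplicatively) let $N_G a=\prod_{\tau\in G}\tau a$, $H^0(G,A)=A^G/N_GA$ and $H^{-1}(G,A)=\{a\in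 A: N_Ga=1\}/\{\sigma a/a: a\in A\}$, and let $h(G,A)=\#H^0(G,A)/\#H^{-1}(G,A)$ when both groups are finite. Then $H^0(G,C_L)$ and $H^{-1}(G,C_L)$ are finite, and $$h(G,C_L)=n.$$ In particular, $$\#H^0(G,C_L)=(C_K:N_{L/K}C_L)\geq n.$$ -/

import Mathlib

open scoped WithZero RestrictedProduct

noncomputable section

namespace GlobalClassField

/-! ## Cohomology in degrees `0` and `-1` of a finite group, in multiplicative notation -/

section Cohomology

variable (G A : Type*) [Group G] [Finite G] [CommGroup A] [MulDistribMulAction G A]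

/-- The norm map `N_G : A → A`, `a ↦ ∏_{σ ∈ G} σ a`. -/
def groupNorm : A →* A where
  toFun a := ∏ᶠ σ : G, σ • a
  map_one' := by simp
  map_mul' a b := by
    simp only [smul_mul']
    exact finprod_mul_distrib (Set.toFinite _) (Set.toFinite _)

/-- `H⁰(G, A) = A^G / N_G A`. -/
abbrev HZero : Type _ :=
  FixedPoints.subgroup G A ⧸ (groupNorm G A).range.subgroupOf (FixedPoints.subgroup G A)

variable {G}

/-- The homomorphism `a ↦ σ a / a`. -/
def augmentation (σ : G) : A →* A where
  toFun a := σ • a / a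
  map_one' := by simp
  map_mul' a b := by rw [smul_mul', mul_div_mul_comm]

/-- `H⁻¹(G, A) = {a | N_G a = 1} / {σ a / a | a ∈ A}` for a finite cyclic group `G` with
generator `σ`. -/
abbrev HNegOne (σ : G) : Type _ :=
  (groupNorm G A).ker ⧸ (augmentation A σ).range.subgroupOf (groupNorm G A).ker

/-- The Herbrand quotient `#H⁰(G, A) / #H⁻¹(G, A)` for a finite cyclic group `G` with
generator `σ`; it is meaningful when both groups are finite. -/
def herbrandQuotient (σ : G) : ℚ :=
  (Nat.card (HZero G A) : ℚ) / (Nat.card (HNegOne A σ) : ℚ)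

end Cohomology

/-! ## Places and local fields -/

section Places

/-- A place of a field, given as a normalised discrete valuation (written multiplicatively,
so that the value group is all of `ℤᵐ⁰`). In a field of algebraic functions over a finite field
every such valuation is trivial on the constants, because nonzero constants have finite order. -/
@[ext]
structure Place (K : Type*) [Field K] where
  valuation : Valuation K ℤᵐ⁰
  normalised : Function.Surjective valuation

variable {K : Type*} [Field K]

/-- The completion `K_P`. -/
abbrev Place.Completion (P : Place K) : Type _ := P.valuation.Completion

/-- The embedding `K → K_P`. -/
def Place.embedding (P : Place K) : K →+* P.Completion :=
  (UniformSpace.Completion.coeRingHom : WithVal P.valuation →+* P.Completion).comp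
    (WithVal.equiv P.valuation).symm.toRingHom

/-- The unit group `U_P` of the ring of integers of `K_P`. -/
def Place.unitGroup (P : Place K) : Subgroup P.Completionˣ where
  carrier := {x | Valued.v (x : P.Completion) = (1 : ℤᵐ⁰)}
  one_mem' := by simp
  mul_mem' {a b} ha hb := by
    simp only [Set.mem_ofPred_eq, Units.val_mul, map_mul] at *
    rw [ha, hb, mul_one]
  inv_mem' {a} ha := by
    simp only [Set.mem_ofPred_eq, Units.val_inv_eq_inv_val, map_inv₀] at *
    rw [ha, inv_one]

variable {L : Type*} [Field L]

/-- A place `Q` of `L` lies over a place `P` of `K` along `f : K → L` if the restriction of `Q`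
to `K` is equivalent to `P`. -/
def Place.Over (f : K →+* L) (P : Place K) (Q : Place L) : Prop :=
  P.valuation.IsEquiv (Q.valuation.comap f)

theorem Place.Over.continuous {f : K →+* L} {P : Place K} {Q : Place L} (h : P.Over f Q) :
    Continuous (WithVal.map P.valuation Q.valuation f) := by
  refine continuous_of_continuousAt_zero _ ?_
  rw [ContinuousAt, map_zero, (Valued.hasBasis_nhds_zero _ _).tendsto_right_iff]
  intro γ _
  obtain ⟨x, hx⟩ := P.normalised (WithZero.exp (-1))
  have hx1 : P.valuation x < 1 := by rw [hx, ← WithZero.exp_zero, WithZero.exp_lt_exp]; norm_num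
  have hx0 : P.valuation x ≠ 0 := by rw [hx]; exact WithZero.exp_ne_zero
  have hy1 : Q.valuation (f x) < 1 := h.lt_one_iff_lt_one.1 hx1
  have hγ : MonoidWithZeroHom.ValueGroup₀.embedding
      (γ : MonoidWithZeroHom.ValueGroup₀ (.ofClass (Valued.v (R := WithVal Q.valuation)))) ≠ 0 := by
    simp
  obtain ⟨n, hn⟩ := exists_pow_lt₀ hy1 (Units.mk0 _ hγ)
  have hxn : (Valued.v.restrict (WithVal.toVal P.valuation (x ^ n))) ≠ 0 := by
    rw [Ne, Valuation.restrict_eq_zero_iff, WithVal.valued_toVal, map_pow]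
    exact pow_ne_zero n hx0
  filter_upwards [Valued.mem_nhds_zero.2 ⟨Units.mk0 _ hxn, subset_rfl⟩] with z hz
  have hz1 : P.valuation z.ofVal < P.valuation (x ^ n) := Valued.v.restrict_lt_iff.1 hz
  have hz2 : Q.valuation (f z.ofVal) < Q.valuation (f (x ^ n)) := h.lt_iff_lt.1 hz1
  rw [map_pow, map_pow] at hz2
  rw [Valuation.restrict_lt_iff_lt_embedding]
  exact hz2.trans hn

/-- The continuous extension `K_P → L_Q` of `f : K → L`, for `Q` over `P`. -/
def Place.Over.map {f : K →+* L} {P : Place K} {Q : Place L} (h : P.Over f Q) :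
    P.Completion →+* Q.Completion :=
  UniformSpace.Completion.mapRingHom (WithVal.map P.valuation Q.valuation f) h.continuous

theorem Place.Over.map_embedding {f : K →+* L} {P : Place K} {Q : Place L} (h : P.Over f Q)
    (x : K) : h.map (P.embedding x) = Q.embedding (f x) :=
  UniformSpace.Completion.mapRingHom_coe h.continuous _

theorem Place.Over.map_id {f : K →+* K} (hf : f = RingHom.id K) {P : Place K} (h : P.Over f P)
    (x : P.Completion) : h.map x = x := by
  subst hf
  exact congrArg (fun g : P.Completion →+* P.Completion => g x)
    UniformSpace.Completion.mapRingHom_id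

theorem Place.Over.map_map {M : Type*} [Field M] {f : K →+* L} {g : L →+* M} {k : K →+* M}
    (hk : k = g.comp f) {P : Place K} {Q : Place L} {R : Place M}
    (h : P.Over f Q) (h' : Q.Over g R) (h'' : P.Over k R) (x : P.Completion) :
    h'.map (h.map x) = h''.map x := by
  subst hk
  exact congrArg (fun t : P.Completion →+* R.Completion => t x)
    (UniformSpace.Completion.mapRingHom_comp h'.continuous h.continuous)

/-- The place `Q ∘ σ`. -/
def Place.comap (σ : K ≃+* L) (Q : Place L) : Place K :=
  ⟨Q.valuation.comap (σ : K →+* L), Q.normalised.comp σ.surjective⟩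

theorem Place.comap_injective (σ : K ≃+* L) : Function.Injective (Place.comap σ) := by
  intro Q Q' h
  refine Place.ext (Valuation.ext fun y => ?_)
  have := congrArg (fun R : Place K => R.valuation (σ.symm y)) h
  simpa [Place.comap] using this

theorem Place.comap_over (σ : K ≃+* L) (Q : Place L) :
    (Q.comap σ).Over (σ : K →+* L) Q :=
  Valuation.IsEquiv.refl

theorem Place.valued_map_comap (σ : K ≃+* L) (Q : Place L) (x : (Q.comap σ).Completion) :
    (Valued.v ((Q.comap_over σ).map x) : ℤᵐ⁰) = Valued.v x := by
  rcases eq_or_ne x 0 with rfl | hx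
  · simp
  have hx' : (Q.comap_over σ).map x ≠ 0 := by simpa using hx
  have hc : Continuous (Q.comap_over σ).map := UniformSpace.Completion.continuous_map
  have h1 := Valued.locally_const (Valued.v.ne_zero_iff.2 hx)
  have h2 := hc.continuousAt.preimage_mem_nhds
    (Valued.locally_const (Valued.v.ne_zero_iff.2 hx'))
  obtain ⟨_, ⟨y, rfl⟩, hy1, hy2⟩ :=
    (UniformSpace.Completion.denseRange_coe (α := WithVal (Q.comap σ).valuation)).inter_nhds_nonempty (Filter.inter_mem h1 h2)
  rw [← hy1.out, ← (show _ = _ from hy2)]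
  have : (Q.comap_over σ).map (y : (Q.comap σ).Completion) =
      (WithVal.map (Q.comap σ).valuation Q.valuation (σ : K →+* L) y : Q.Completion) :=
    UniformSpace.Completion.mapRingHom_coe (Q.comap_over σ).continuous y
  rw [this, Valued.valuedCompletion_apply, Valued.valuedCompletion_apply]
  rfl

end Places

/-! ## Ideles and idele classes -/

section Ideles

variable (K : Type*) [Field K]

/-- The idele group `I_K`: the restricted product of the groups `K_Pˣ` with respect to the unit
groups `U_P`, over all places `P` of `K`. -/
def Ideles : Type _ := Πʳ P : Place K, [P.Completionˣ, P.unitGroup]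

instance : CommGroup (Ideles K) :=
  inferInstanceAs (CommGroup (Πʳ P : Place K, [P.Completionˣ, P.unitGroup]))

instance : DFunLike (Ideles K) (Place K) fun P => P.Completionˣ :=
  inferInstanceAs (DFunLike (Πʳ P : Place K, [P.Completionˣ, P.unitGroup]) _ _)

/-- The inclusion of `I_K` in the full product of the groups `K_Pˣ`. -/
def Ideles.components : Ideles K →* ((P : Place K) → P.Completionˣ) where
  toFun α P := α P
  map_one' := rfl
  map_mul' _ _ := rfl

/-- The group of principal ideles: those `α ∈ I_K` whose components are all equal to one element
of `Kˣ`, that is, the image of the diagonal embedding of `Kˣ`. -/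
def principalIdeles : Subgroup (Ideles K) :=
  (MonoidHom.pi fun P : Place K => Units.map (P.embedding : K →* P.Completion)).range.comap
    (Ideles.components K)

/-- The idele class group `C_K = I_K / Kˣ`. -/
abbrev IdeleClassGroup : Type _ := Ideles K ⧸ principalIdeles K

end Ideles

/-! ## The Galois action -/

section Action

variable {K L : Type*} [Field K] [Field L] [Algebra K L]

/-- The action of an automorphism on ideles: `(σ α)_Q = σ (α_{Q ∘ σ})`, where
`σ : L_{Q ∘ σ} → L_Q` is the extension of `σ : L → L` by continuity. -/
instance : SMul (L ≃ₐ[K] L) (Ideles L) where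
  smul σ α := RestrictedProduct.mk
    (fun Q => Units.map ((Q.comap_over (σ : L ≃+* L)).map : _ →* Q.Completion)
      (α (Q.comap (σ : L ≃+* L))))
    (by
      filter_upwards [(Place.comap_injective (σ : L ≃+* L)).tendsto_cofinite.eventually α.2]
        with Q hQ
      exact (Q.valued_map_comap (σ : L ≃+* L) _).trans hQ)

theorem smul_ideles_apply (σ : L ≃ₐ[K] L) (α : Ideles L) (Q : Place L) :
    (((σ • α) Q : Q.Completionˣ) : Q.Completion) =
      (Q.comap_over (σ : L ≃+* L)).map (α (Q.comap (σ : L ≃+* L)) : _) :=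
  rfl

instance : MulDistribMulAction (L ≃ₐ[K] L) (Ideles L) where
  one_smul α := by
    refine DFunLike.ext _ _ fun Q => Units.ext ?_
    exact Place.Over.map_id (f := (((1 : L ≃ₐ[K] L) : L ≃+* L) : L →+* L)) rfl
      (Q.comap_over ((1 : L ≃ₐ[K] L) : L ≃+* L)) _
  mul_smul σ τ α := by
    refine DFunLike.ext _ _ fun Q => Units.ext ?_
    exact (Place.Over.map_map rfl ((Q.comap (σ : L ≃+* L)).comap_over (τ : L ≃+* L))
      (Q.comap_over (σ : L ≃+* L)) (Q.comap_over ((σ * τ : L ≃ₐ[K] L) : L ≃+* L)) _).symm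
  smul_one σ := by
    refine DFunLike.ext _ _ fun Q => Units.ext ?_
    exact map_one (Q.comap_over (σ : L ≃+* L)).map
  smul_mul σ α β := by
    refine DFunLike.ext _ _ fun Q => Units.ext ?_
    exact map_mul (Q.comap_over (σ : L ≃+* L)).map _ _

theorem smul_principalIdeles_le (σ : L ≃ₐ[K] L) :
    principalIdeles L ≤
      (principalIdeles L).comap (MulDistribMulAction.toMonoidHom (Ideles L) σ) := by
  rintro α ⟨x, hx⟩
  refine ⟨Units.map (σ : L →* L) x, funext fun Q => Units.ext ?_⟩
  have h : (Q.comap (σ : L ≃+* L)).embedding (x : L) = (α (Q.comap (σ : L ≃+* L)) : _) :=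
    congrArg Units.val (congrFun hx (Q.comap (σ : L ≃+* L)))
  refine Eq.trans ?_ (congrArg (Q.comap_over (σ : L ≃+* L)).map h)
  exact ((Q.comap_over (σ : L ≃+* L)).map_embedding (x : L)).symm

/-- The induced action on idele classes. -/
instance : MulDistribMulAction (L ≃ₐ[K] L) (IdeleClassGroup L) where
  smul σ := QuotientGroup.map _ _ (MulDistribMulAction.toMonoidHom (Ideles L) σ)
    (smul_principalIdeles_le σ)
  one_smul c := by
    induction c using QuotientGroup.induction_on with
    | H α => exact congrArg _ (one_smul _ α)
  mul_smul σ τ c := by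
    induction c using QuotientGroup.induction_on with
    | H α => exact congrArg _ (mul_smul σ τ α)
  smul_one σ := map_one (QuotientGroup.map _ _ (MulDistribMulAction.toMonoidHom (Ideles L) σ)
    (smul_principalIdeles_le σ))
  smul_mul σ := map_mul (QuotientGroup.map _ _ (MulDistribMulAction.toMonoidHom (Ideles L) σ)
    (smul_principalIdeles_le σ))

theorem smul_mk_ideleClass (σ : L ≃ₐ[K] L) (α : Ideles L) :
    σ • (QuotientGroup.mk α : IdeleClassGroup L) = QuotientGroup.mk (σ • α) :=
  rfl

end Action

/-! ## The norm -/

section Norm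

variable {K : Type*} (L : Type*) [Field K] [Field L] [Algebra K L]

/-- The ring `∏_{Q ∣ P} L_Q`, the product over the places `Q` of `L` over `P`. -/
def Semilocal (P : Place K) : Type _ :=
  (Q : {Q : Place L // P.Over (algebraMap K L) Q}) → Q.1.Completion

instance (P : Place K) : CommRing (Semilocal L P) :=
  inferInstanceAs
    (CommRing ((Q : {Q : Place L // P.Over (algebraMap K L) Q}) → Q.1.Completion))

/-- `∏_{Q ∣ P} L_Q` is a `K_P`-algebra through the continuous extensions `K_P → L_Q` of
`K → L`. -/
instance (P : Place K) : Algebra P.Completion (Semilocal L P) :=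
  (RingHom.pi fun Q : {Q : Place L // P.Over (algebraMap K L) Q} => Q.2.map).toAlgebra

/-- The components `(α_Q)_{Q ∣ P}` of an idele `α` of `L`. -/
def semilocalComponent (P : Place K) : Ideles L →* Semilocal L P where
  toFun α Q := (α Q.1 : Q.1.Completion)
  map_one' := rfl
  map_mul' _ _ := rfl

/-- The norm of ideles, in components: `N(α)_P` is the norm (determinant of multiplication) of
`(α_Q)_{Q ∣ P}` in the `K_P`-algebra `∏_{Q ∣ P} L_Q`, in other words
`∏_{Q ∣ P} N_{L_Q / K_P}(α_Q)`. -/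
def ideleNorm : Ideles L →* ((P : Place K) → P.Completionˣ) :=
  MonoidHom.pi fun P =>
    ((Algebra.norm P.Completion : Semilocal L P →* P.Completion).comp
      (semilocalComponent L P)).toHomUnits

variable (K)

/-- The norm group `N_{L/K} C_L ⊆ C_K`: the image in `C_K` of the group
`N_{L/K} I_L = {β ∈ I_K | β = N(α) for some α ∈ I_L}`. -/
def normClassGroup : Subgroup (IdeleClassGroup K) :=
  ((ideleNorm (K := K) L).range.comap (Ideles.components K)).map
    (QuotientGroup.mk' (principalIdeles K))

end Norm

end GlobalClassField

end

open scoped WithZero RestrictedProduct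

noncomputable section

namespace GlobalClassField

/-! ### Herbrand quotients of pairs of endomorphisms, and successive approximation -/

section Herbrand

variable {B C : Type*} [CommGroup B] [CommGroup C]

/-! The Herbrand quotient is multiplicative in short exact sequences and equals 1 on finite modules,
so finite kernels and finite cokernels may be ignored (`HasHerbrand.extension`, `HasHerbrand.map`,
`HasHerbrand.of_finite`, `HasHerbrand.of_relIndex_ne_zero`). The degree maps the idele class group
of L onto a nontrivial subgroup of ℤ with trivial Galois action, whose Herbrand quotient is n. It
remains to see that the classes of degree zero have Herbrand quotient 1.

These classes contain the classes of unit ideles with finite index, because the group of divisor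
classes of degree zero is finite. The unit classes are the unit ideles modulo a finite group,
because a function without zeros and poles is a constant. So everything comes down to the unit
ideles (`hasHerbrand_unitIdeles`), which can be treated one place P of K at a time, in the ring ∏
L_Q over the places Q above P. A normal basis of L/K, scaled by a power of a uniformiser π, spans a
multiplicative lattice M that is an induced Galois module. Filtering 1 + πM by powers of π shows
that this group has trivial Tate cohomology, and it has finite index in the units. At the places
having a uniformiser in K, which are almost all, Hilbert's Theorem 90 and this Herbrand quotient 1
make the full unit group acyclic. The product over all P is then an acyclic subgroup of finite index
in the unit ideles.

The global input is the degree-zero product formula and finiteness of the class group. Both come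
from counting functions with bounded poles: independence over k(y) bounds the number of zeros of y,
monomials y^i b_j in a basis b_j give many functions, and comparing the two yields the degree of the
pole divisor and Riemann's inequality.

Finally H⁰ is identified with the norm residue group by Galois descent: invariant ideles of L are
ideles of K, Theorem 90 for L transfers this to classes, and the algebra norm of ∏ L_Q over K_P is
the product of the conjugates (`card_HZero_eq_index`). The inequality follows because #H⁰ = n ·
#H⁻¹. -/

theorem relIndex_map_eq (f : B →* C) {H K : Subgroup B} (h : H ≤ K) :
    (H.map f).relIndex (K.map f) = (H ⊔ (f.ker ⊓ K)).relIndex K := by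
  rw [Subgroup.relIndex_map_map, ← sup_inf_assoc_of_le _ h, Subgroup.inf_relIndex_right]
  have : K ⊔ f.ker = K ⊔ (H ⊔ f.ker) := by rw [← sup_assoc, sup_eq_left.2 h]
  rw [this, Subgroup.relIndex_sup_right]

/-- The order of the Tate group `(A ∩ ker d) / e(A)`, and `0` if it is infinite. -/
def tateCard (d e : B →* B) (A : Subgroup B) : ℕ :=
  (A.map e).relIndex (A ⊓ d.ker)

/-- Both Tate groups of `A` for the pair `(d, e)` are finite, of orders with quotient `r`. -/
structure HasHerbrand (d e : B →* B) (A : Subgroup B) (r : ℚ) : Prop where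
  left : tateCard d e A ≠ 0
  right : tateCard e d A ≠ 0
  eq : (tateCard d e A : ℚ) / tateCard e d A = r

/-- This is the connecting homomorphism, without quotient groups. The elements of X whose image
under `d` lies in X ∩ ker g form a group W that `g` and `d` map onto the two larger groups. Both
indices are that of (X ∩ ker d)(X ∩ ker g) in W. -/
theorem relIndex_connecting (g : B →* C) {d : B →* B} {d' : C →* C}
    (hd : ∀ x, g (d x) = d' (g x)) {X : Subgroup B} (hX : X.map d ≤ X) :
    ((X ⊓ d.ker).map g).relIndex (X.map g ⊓ d'.ker) =
      ((X ⊓ g.ker).map d).relIndex (X ⊓ g.ker ⊓ X.map d) := by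
  set W : Subgroup B := X ⊓ (X ⊓ g.ker).comap d with hW
  have h1 : W.map g = X.map g ⊓ d'.ker := by
    ext y
    constructor
    · rintro ⟨x, ⟨hx, hx'⟩, rfl⟩
      refine ⟨⟨x, hx, rfl⟩, ?_⟩
      exact (hd x).symm.trans hx'.2
    · rintro ⟨⟨x, hx, rfl⟩, hx'⟩
      refine ⟨x, ⟨hx, hX ⟨x, hx, rfl⟩, ?_⟩, rfl⟩
      exact (hd x).trans hx'
  have h2 : W.map d = X ⊓ g.ker ⊓ X.map d := by
    ext y
    constructor
    · rintro ⟨x, ⟨hx, hx'⟩, rfl⟩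
      exact ⟨hx', x, hx, rfl⟩
    · rintro ⟨hy, x, hx, rfl⟩
      exact ⟨x, ⟨hx, hy⟩, rfl⟩
  have hZ : X ⊓ d.ker ≤ W := fun x hx => ⟨hx.1, by
    have : d x = 1 := hx.2
    change d x ∈ X ⊓ g.ker
    rw [this]
    exact one_mem _⟩
  have hA : X ⊓ g.ker ≤ W := fun x hx => ⟨hx.1, hX ⟨x, hx.1, rfl⟩, by
    have : g x = 1 := hx.2
    change g (d x) = 1
    rw [hd, this, map_one]⟩
  have h3 : g.ker ⊓ W = X ⊓ g.ker :=
    le_antisymm (fun x hx => ⟨hx.2.1, hx.1⟩) (fun x hx => ⟨hx.2, hA hx⟩)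
  have h4 : d.ker ⊓ W = X ⊓ d.ker :=
    le_antisymm (fun x hx => ⟨hx.2.1, hx.1⟩) (fun x hx => ⟨hx.2, hZ hx⟩)
  rw [← h1, ← h2, relIndex_map_eq g hZ, relIndex_map_eq d hA, h3, h4, sup_comm]

/-- The exact hexagon, cut at its two connecting maps, whose images have the orders in the second
factor on the left. That factor is symmetric in `d` and `e`, so it cancels when this identity is
divided by the one with `d` and `e` exchanged. With index 0 standing for infinity the identity needs
no finiteness assumption. -/
theorem tateCard_mul (g : B →* C) {d e : B →* B} {d' e' : C →* C}
    (hd : ∀ x, g (d x) = d' (g x)) (he : ∀ x, g (e x) = e' (g x))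
    (hde : ∀ x, d (e x) = 1) {X : Subgroup B} (hXd : X.map d ≤ X) (hXe : X.map e ≤ X) :
    tateCard d e X * (((X ⊓ g.ker).map d).relIndex (X ⊓ g.ker ⊓ X.map d) *
      ((X ⊓ g.ker).map e).relIndex (X ⊓ g.ker ⊓ X.map e)) =
      tateCard d' e' (X.map g) * tateCard d e (X ⊓ g.ker) := by
  set A := X ⊓ g.ker with hA
  have hE : X.map e ≤ X ⊓ d.ker := le_inf hXe (by rintro _ ⟨x, -, rfl⟩; exact hde x)
  have hEA : A.map e ≤ A ⊓ X.map e := by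
    rintro _ ⟨x, hx, rfl⟩
    refine ⟨⟨hXe ⟨x, hx.1, rfl⟩, ?_⟩, x, hx.1, rfl⟩
    have : g x = 1 := hx.2
    change g (e x) = 1
    rw [he, this, map_one]
  have hmap : (X.map g).map e' = (X.map e).map g := by
    rw [Subgroup.map_map, Subgroup.map_map]
    exact congrArg (fun t => X.map t) (MonoidHom.ext fun x => (he x).symm)
  have hZ' : (X ⊓ d.ker).map g ≤ X.map g ⊓ d'.ker := by
    rintro _ ⟨x, hx, rfl⟩
    refine ⟨⟨x, hx.1, rfl⟩, ?_⟩
    have : d x = 1 := hx.2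
    change d' (g x) = 1
    rw [← hd, this, map_one]
  have hAZ : g.ker ⊓ (X ⊓ d.ker) = A ⊓ d.ker := by
    rw [hA]; ext; simp only [Subgroup.mem_inf]; tauto
  -- The Tate order of X is the order of its image downstairs times the order of the image of the
  -- Tate group of A. The next two equations split the orders for A and for g(X) at the same places,
  -- each with one connecting index.
  have e1 : tateCard d e X = ((X.map e).map g).relIndex ((X ⊓ d.ker).map g) *
      (A ⊓ X.map e).relIndex (A ⊓ d.ker) := by
    rw [relIndex_map_eq g hE, tateCard, ← Subgroup.relIndex_mul_relIndex (X.map e)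
      (X.map e ⊔ (g.ker ⊓ (X ⊓ d.ker))) _ le_sup_left (sup_le hE inf_le_right), mul_comm, hAZ]
    congr 1
    rw [sup_comm, Subgroup.relIndex_sup_right, ← Subgroup.inf_relIndex_right]
    congr 1
    refine le_antisymm (fun x hx => ⟨hx.2.1, hx.1⟩) fun x hx => ⟨hx.2, hx.1, (hE hx.2).2⟩
  have e2 : tateCard d e A = (A.map e).relIndex (A ⊓ X.map e) *
      (A ⊓ X.map e).relIndex (A ⊓ d.ker) :=
    (Subgroup.relIndex_mul_relIndex _ _ _ hEA (inf_le_inf_left _ (hE.trans inf_le_right))).symm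
  have e3 : tateCard d' e' (X.map g) = ((X.map e).map g).relIndex ((X ⊓ d.ker).map g) *
      (A.map d).relIndex (A ⊓ X.map d) := by
    rw [← relIndex_connecting g hd hXd, Subgroup.relIndex_mul_relIndex _ _ _
      (Subgroup.map_mono hE) hZ', tateCard, hmap]
  rw [e1, e2, e3]
  ring

variable {g : B →* C} {d e : B →* B} {d' e' : C →* C}

theorem HasHerbrand.extension
    (hd : ∀ x, g (d x) = d' (g x)) (he : ∀ x, g (e x) = e' (g x))
    (hde : ∀ x, d (e x) = 1) (hed : ∀ x, e (d x) = 1)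
    {X : Subgroup B} (hXd : X.map d ≤ X) (hXe : X.map e ≤ X) {a c : ℚ}
    (hA : HasHerbrand d e (X ⊓ g.ker) a) (hC : HasHerbrand d' e' (X.map g) c) :
    HasHerbrand d e X (a * c) := by
  have h1 := tateCard_mul g hd he hde hXd hXe
  have h2 := tateCard_mul g he hd hed hXe hXd
  set δ₁ := ((X ⊓ g.ker).map d).relIndex (X ⊓ g.ker ⊓ X.map d)
  set δ₂ := ((X ⊓ g.ker).map e).relIndex (X ⊓ g.ker ⊓ X.map e)
  have n1 := h1.trans_ne (mul_ne_zero hC.left hA.left)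
  have n2 := h2.trans_ne (mul_ne_zero hC.right hA.right)
  refine ⟨left_ne_zero_of_mul n1, left_ne_zero_of_mul n2, ?_⟩
  rw [← hA.eq, ← hC.eq]
  have q1 : (δ₁ : ℚ) ≠ 0 := by exact_mod_cast left_ne_zero_of_mul (right_ne_zero_of_mul n1)
  have q2 : (δ₂ : ℚ) ≠ 0 := by exact_mod_cast left_ne_zero_of_mul (right_ne_zero_of_mul n2)
  have q3 : (tateCard e d X : ℚ) ≠ 0 := by exact_mod_cast left_ne_zero_of_mul n2
  have q4 : (tateCard e d (X ⊓ g.ker) : ℚ) ≠ 0 := by exact_mod_cast hA.right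
  have q5 : (tateCard e' d' (X.map g) : ℚ) ≠ 0 := by exact_mod_cast hC.right
  have r1 : (tateCard d e X : ℚ) * (δ₁ * δ₂) =
    tateCard d' e' (X.map g) * tateCard d e (X ⊓ g.ker) := by exact_mod_cast h1
  have r2 : (tateCard e d X : ℚ) * (δ₂ * δ₁) =
    tateCard e' d' (X.map g) * tateCard e d (X ⊓ g.ker) := by exact_mod_cast h2
  rw [div_mul_div_comm, div_eq_div_iff q3 (mul_ne_zero q4 q5)]
  refine mul_right_cancel₀ (mul_ne_zero q1 q2) ?_
  linear_combination (tateCard e d (X ⊓ g.ker) * tateCard e' d' (X.map g) : ℚ) * r1 -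
    (tateCard d e (X ⊓ g.ker) * tateCard d' e' (X.map g) : ℚ) * r2

theorem HasHerbrand.map
    (hd : ∀ x, g (d x) = d' (g x)) (he : ∀ x, g (e x) = e' (g x))
    (hde : ∀ x, d (e x) = 1) (hed : ∀ x, e (d x) = 1)
    {X : Subgroup B} (hXd : X.map d ≤ X) (hXe : X.map e ≤ X) {a b : ℚ}
    (hA : HasHerbrand d e (X ⊓ g.ker) a) (hB : HasHerbrand d e X b) :
    HasHerbrand d' e' (X.map g) (b / a) := by
  have h1 := tateCard_mul g hd he hde hXd hXe
  have h2 := tateCard_mul g he hd hed hXe hXd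
  -- Each connecting index divides a Tate order of X ∩ ker g, hence is finite. This gives finiteness
  -- for the image of X, after which the value follows from the case of an extension.
  have dvd : ∀ {d e : B →* B}, (∀ x, d (e x) = 1) → (X ⊓ g.ker).map e ≤ X ⊓ g.ker →
      tateCard d e (X ⊓ g.ker) ≠ 0 →
      ((X ⊓ g.ker).map e).relIndex (X ⊓ g.ker ⊓ X.map e) ≠ 0 := by
    intro d e hde hs h0
    have := Subgroup.relIndex_mul_relIndex ((X ⊓ g.ker).map e) (X ⊓ g.ker ⊓ X.map e)
      (X ⊓ g.ker ⊓ d.ker) (le_inf hs (Subgroup.map_mono inf_le_left))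
      (inf_le_inf_left _ (by rintro _ ⟨x, -, rfl⟩; exact hde x))
    exact left_ne_zero_of_mul (this.trans_ne h0)
  have stab : ∀ {d : B →* B} {d' : C →* C}, (∀ x, g (d x) = d' (g x)) → X.map d ≤ X →
      (X ⊓ g.ker).map d ≤ X ⊓ g.ker := by
    rintro d d' hd hX _ ⟨x, hx, rfl⟩
    refine ⟨hX ⟨x, hx.1, rfl⟩, ?_⟩
    have : g x = 1 := hx.2
    change g (d x) = 1
    rw [hd, this, map_one]
  have d1 := dvd hed (stab hd hXd) hA.right
  have d2 := dvd hde (stab he hXe) hA.left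
  have n1 := h1.symm.trans_ne (mul_ne_zero hB.left (mul_ne_zero d1 d2))
  have n2 := h2.symm.trans_ne (mul_ne_zero hB.right (mul_ne_zero d2 d1))
  have hC : HasHerbrand d' e' (X.map g) _ :=
    ⟨left_ne_zero_of_mul n1, left_ne_zero_of_mul n2, rfl⟩
  refine ⟨hC.left, hC.right, ?_⟩
  have := (hA.extension hd he hde hed hXd hXe hC).eq
  rw [hB.eq] at this
  rw [this, mul_div_cancel_left₀]
  rw [← hA.eq]
  exact div_ne_zero (by exact_mod_cast hA.left) (by exact_mod_cast hA.right)

/-- Both Tate orders are #X / (#d(X) · #e(X)). -/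
theorem HasHerbrand.of_finite (hde : ∀ x, d (e x) = 1) (hed : ∀ x, e (d x) = 1)
    {X : Subgroup B} [Finite X] (hXd : X.map d ≤ X) (hXe : X.map e ≤ X) :
    HasHerbrand d e X 1 := by
  have key : ∀ {d e : B →* B}, (∀ x, d (e x) = 1) → X.map e ≤ X →
      tateCard d e X * Nat.card (X.map e) = Nat.card ↥(X ⊓ d.ker) ∧
      Nat.card (X.map d) * Nat.card ↥(X ⊓ d.ker) = Nat.card X := by
    intro d e hde hXe
    have hle : X.map e ≤ X ⊓ d.ker := le_inf hXe (by rintro _ ⟨x, -, rfl⟩; exact hde x)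
    refine ⟨?_, ?_⟩
    · rw [mul_comm, ← Subgroup.relIndex_bot_left, ← Subgroup.relIndex_bot_left]
      exact Subgroup.relIndex_mul_relIndex _ _ _ bot_le hle
    · have h := relIndex_map_eq d (bot_le : ⊥ ≤ X)
      rw [Subgroup.map_bot, Subgroup.relIndex_bot_left, bot_sup_eq] at h
      rw [h, mul_comm, inf_comm, ← Subgroup.relIndex_bot_left, ← Subgroup.relIndex_bot_left]
      exact Subgroup.relIndex_mul_relIndex _ _ _ bot_le inf_le_right
  obtain ⟨a1, a2⟩ := key hde hXe
  obtain ⟨b1, b2⟩ := key hed hXd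
  have hX : Nat.card X ≠ 0 := Nat.card_pos.ne'
  have z1 := a2.trans_ne hX
  have z2 := b2.trans_ne hX
  have y1 := right_ne_zero_of_mul z1
  have y2 := right_ne_zero_of_mul z2
  refine ⟨left_ne_zero_of_mul (a1.trans_ne y1), left_ne_zero_of_mul (b1.trans_ne y2), ?_⟩
  rw [div_eq_one_iff_eq (by exact_mod_cast left_ne_zero_of_mul (b1.trans_ne y2)), Nat.cast_inj]
  refine mul_right_cancel₀ (mul_ne_zero (left_ne_zero_of_mul z1) (left_ne_zero_of_mul z2)) ?_
  calc _ = tateCard d e X * Nat.card (X.map e) * Nat.card (X.map d) := by ring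
    _ = tateCard e d X * Nat.card (X.map d) * Nat.card (X.map e) := by rw [a1, b1, mul_comm, a2, mul_comm, b2]
    _ = _ := by ring

/-- The Herbrand quotient does not change on passing to a stable subgroup of finite index. -/
theorem HasHerbrand.of_relIndex_ne_zero (hde : ∀ x, d (e x) = 1) (hed : ∀ x, e (d x) = 1)
    {X A : Subgroup B} (hXd : X.map d ≤ X) (hXe : X.map e ≤ X) (hAd : A.map d ≤ A)
    (hAe : A.map e ≤ A) (hAX : A ≤ X) (hfin : A.relIndex X ≠ 0) {r : ℚ}
    (hA : HasHerbrand d e A r) : HasHerbrand d e X r := by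
  -- Apply the extension result to the quotient map by A: the image X/A is finite, so it contributes
  -- the factor 1.
  have hXA : X ⊓ (QuotientGroup.mk' A).ker = A := by
    rw [QuotientGroup.ker_mk']; exact inf_eq_right.2 hAX
  have hf : Finite (X.map (QuotientGroup.mk' A)) := by
    have h := relIndex_map_eq (QuotientGroup.mk' A) (bot_le : ⊥ ≤ X)
    rw [Subgroup.map_bot, Subgroup.relIndex_bot_left, bot_sup_eq, inf_comm, hXA] at h
    exact Nat.finite_of_card_ne_zero (h.trans_ne hfin)
  have hd : ∀ x, QuotientGroup.mk' A (d x) = QuotientGroup.map A A d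
    (Subgroup.map_le_iff_le_comap.1 hAd) (QuotientGroup.mk' A x) := fun x => rfl
  have he : ∀ x, QuotientGroup.mk' A (e x) = QuotientGroup.map A A e
    (Subgroup.map_le_iff_le_comap.1 hAe) (QuotientGroup.mk' A x) := fun x => rfl
  have := HasHerbrand.extension (a := r) (c := 1) hd he hde hed hXd hXe (by rwa [hXA])
    (HasHerbrand.of_finite ?_ ?_ ?_ ?_)
  · rwa [mul_one] at this
  · intro x
    induction x using QuotientGroup.induction_on with
    | H x => exact congrArg _ (hde x)
  · intro x
    induction x using QuotientGroup.induction_on with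
    | H x => exact congrArg _ (hed x)
  · rintro _ ⟨_, ⟨x, hx, rfl⟩, rfl⟩
    exact ⟨d x, hXd ⟨x, hx, rfl⟩, rfl⟩
  · rintro _ ⟨_, ⟨x, hx, rfl⟩, rfl⟩
    exact ⟨e x, hXe ⟨x, hx, rfl⟩, rfl⟩

theorem hasHerbrand_one_of_trivial {X : Subgroup B}
    (h1 : X ⊓ d.ker ≤ X.map e) (h2 : X ⊓ e.ker ≤ X.map d) : HasHerbrand d e X 1 := by
  have c1 : tateCard d e X = 1 := Subgroup.relIndex_eq_one.2 h1
  have c2 : tateCard e d X = 1 := Subgroup.relIndex_eq_one.2 h2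
  exact ⟨by simp [c1], by simp [c2], by simp [c1, c2]⟩

/-- For trivial action of a group of order n the augmentation is trivial and the norm is
multiplication by n, so the two Tate groups are ℤ/n and the n-torsion of ℤ. -/
theorem hasHerbrand_int (n : ℕ) (hn : n ≠ 0) :
    HasHerbrand (1 : Multiplicative ℤ →* Multiplicative ℤ) (powMonoidHom n) ⊤ n := by
  have h1 : tateCard (1 : Multiplicative ℤ →* Multiplicative ℤ) (powMonoidHom n) ⊤ = n := by
    have : (1 : Multiplicative ℤ →* Multiplicative ℤ).ker = ⊤ := by ext; simp
    rw [tateCard, this, top_inf_eq, Subgroup.relIndex_top_right, ← MonoidHom.range_eq_map]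
    have : (powMonoidHom n : Multiplicative ℤ →* Multiplicative ℤ).range =
        AddSubgroup.toSubgroup (AddSubgroup.zmultiples (n : ℤ)) := by
      ext x
      constructor
      · rintro ⟨y, rfl⟩
        exact Int.mem_zmultiples_iff.2 ⟨y.toAdd, (toAdd_pow y n).trans (nsmul_eq_mul _ _)⟩
      · intro h
        obtain ⟨y, hy⟩ := Int.mem_zmultiples_iff.1 h
        exact ⟨Multiplicative.ofAdd y, ((toAdd_pow _ n).trans (nsmul_eq_mul _ _)).trans hy.symm⟩
    rw [this]
    have := AddSubgroup.index_toSubgroup (AddSubgroup.zmultiples (n : ℤ))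
    rw [this, Int.index_zmultiples]
    simp
  have h2 : tateCard (powMonoidHom n) (1 : Multiplicative ℤ →* Multiplicative ℤ) ⊤ = 1 := by
    rw [tateCard, Subgroup.relIndex_eq_one]
    rintro x ⟨-, hx⟩
    have : x ^ n = 1 := hx
    have h0 : n • x.toAdd = 0 := by
      rw [← toAdd_pow, this, toAdd_one]
    have : x = 1 := Multiplicative.toAdd.injective ((smul_eq_zero.1 h0).resolve_left hn)
    rw [this]
    exact one_mem _
  exact ⟨by rwa [h1], by simp [h2], by simp [h1, h2]⟩

/-- Successive approximation in a complete filtered group. -/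
theorem exists_eq_of_filtration {W W' : Type*} [CommGroup W] [CommGroup W'] (f : W →* W')
    (V : ℕ → Subgroup W) (V' : ℕ → Subgroup W') (T : Subgroup W') (hT : ∀ w, f w ∈ T)
    (hV : ∀ k, (V k).map f ≤ V' k) (hsep : ∀ x, (∀ k, x ∈ V' k) → x = 1)
    (hcomp : ∀ w : ℕ → W, (∀ k, w k ∈ V k) →
      ∃ x ∈ V 0, ∀ k, x / ∏ i ∈ Finset.range k, w i ∈ V k)
    (hstep : ∀ k, ∀ v ∈ V' k, v ∈ T → ∃ w ∈ V k, v / f w ∈ V' (k + 1))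
    {v : W'} (hv : v ∈ V' 0) (hvT : v ∈ T) : ∃ w ∈ V 0, f w = v := by
  choose! s hs hs' using hstep
  -- `r k` is what remains of `v` after dividing out the first k corrections. It stays in T since
  -- `f` takes its values there, so the approximation step can be repeated.
  let r : ℕ → W' := fun k => Nat.rec v (fun k x => x / f (s k x)) k
  have hr : ∀ k, r k ∈ V' k ∧ r k ∈ T := by
    intro k
    induction k with
    | zero => exact ⟨hv, hvT⟩
    | succ k ih => exact ⟨hs' k _ ih.1 ih.2, div_mem ih.2 (hT _)⟩
  have hp : ∀ k, r k * f (∏ i ∈ Finset.range k, s i (r i)) = v := by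
    intro k
    induction k with
    | zero => simp [r]
    | succ k ih =>
      rw [Finset.prod_range_succ, map_mul, mul_comm (f _), ← mul_assoc]
      have : r (k + 1) = r k / f (s k (r k)) := rfl
      rw [this, div_mul_cancel, ih]
  obtain ⟨x, hx, hx'⟩ := hcomp (fun k => s k (r k)) fun k => hs k _ (hr k).1 (hr k).2
  refine ⟨x, hx, ?_⟩
  rw [← div_eq_one]
  refine hsep _ fun k => ?_
  have : f x / v = f (x / ∏ i ∈ Finset.range k, s i (r i)) / r k := by
    rw [← hp k, map_div, div_div, mul_comm]
  rw [this]
  exact div_mem (hV k ⟨_, hx' k, rfl⟩) (hr k).1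

end Herbrand

/-! ### Discrete places: independence and weak approximation -/

section Places

open WithZero

variable {K : Type*} [Field K]

theorem Place.exists_valuation_eq_exp (P : Place K) (m : ℤ) :
    ∃ x : K, x ≠ 0 ∧ P.valuation x = exp m := by
  obtain ⟨x, hx⟩ := P.normalised (exp m)
  refine ⟨x, ?_, hx⟩
  rintro rfl
  rw [map_zero] at hx
  exact exp_ne_zero hx.symm

theorem Place.valuation_eq_exp_log (P : Place K) {x : K} (hx : x ≠ 0) :
    P.valuation x = exp (log (P.valuation x)) :=
  (exp_log ((Valuation.ne_zero_iff _).2 hx)).symm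

theorem Place.log_mul (P : Place K) {x y : K} (hx : x ≠ 0) (hy : y ≠ 0) :
    log (P.valuation (x * y)) = log (P.valuation x) + log (P.valuation y) := by
  rw [map_mul, WithZero.log_mul ((Valuation.ne_zero_iff _).2 hx) ((Valuation.ne_zero_iff _).2 hy)]

theorem Place.le_exp_iff (P : Place K) {x : K} (hx : x ≠ 0) {m : ℤ} :
    P.valuation x ≤ exp m ↔ log (P.valuation x) ≤ m :=
  (log_le_iff_le_exp ((Valuation.ne_zero_iff _).2 hx)).symm

theorem exp_neg_one_lt_one : (exp (-1 : ℤ)) < 1 := by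
  rw [← exp_zero, exp_lt_exp]; norm_num

theorem lt_one_iff_le_exp {x : ℤᵐ⁰} : x < 1 ↔ x ≤ exp (-1) := by
  rcases eq_or_ne x 0 with rfl | hx
  · simp
  · rw [← exp_zero, ← log_lt_iff_lt_exp hx, ← log_le_iff_le_exp hx]
    omega

theorem exists_pow_mul_lt_one {a : ℤᵐ⁰} (ha : a < 1) (b : ℤᵐ⁰) :
    ∃ m : ℕ, ∀ k ≥ m, a ^ k * b < 1 := by
  rcases eq_or_ne a 0 with rfl | h0
  · refine ⟨1, fun k hk => ?_⟩
    rw [zero_pow (by omega), zero_mul]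
    exact zero_lt_one
  rcases eq_or_ne b 0 with rfl | hb
  · exact ⟨0, fun k hk => by simp⟩
  refine ⟨(log b).toNat + 1, fun k hk => ?_⟩
  have h1 : log a < 0 := by rwa [← exp_zero, ← log_lt_iff_lt_exp h0] at ha
  rw [← exp_zero, ← log_lt_iff_lt_exp (mul_ne_zero (pow_ne_zero _ h0) hb),
    WithZero.log_mul (pow_ne_zero _ h0) hb, log_pow, nsmul_eq_mul]
  have : (log b).toNat + 1 ≤ (k : ℤ) := by exact_mod_cast hk
  have h2 := Int.self_le_toNat (log b)
  nlinarith

/-- A place is determined by its maximal ideal. -/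
theorem Place.eq_of_lt_one {P P' : Place K}
    (h : ∀ x, P.valuation x < 1 → P'.valuation x < 1) : P = P' := by
  -- If x were integral at P but not at P', then x^m t with t a uniformiser at P would be small at P
  -- and, for large m, not small at P'.
  have h1 : ∀ x, P.valuation x ≤ 1 → P'.valuation x ≤ 1 := by
    intro x hx
    by_contra! hx'
    obtain ⟨t, ht0, ht⟩ := P.exists_valuation_eq_exp (-1)
    have hx0 : x ≠ 0 := by rintro rfl; simp at hx'
    have hinv : P'.valuation x⁻¹ < 1 := by rwa [← Valuation.one_lt_val_iff _ hx0]
    obtain ⟨m, hm⟩ := exists_pow_mul_lt_one hinv (P'.valuation t)⁻¹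
    have h2 : P.valuation (x ^ m * t) < 1 := by
      rw [map_mul, map_pow, ht]
      exact mul_lt_one_of_nonneg_of_lt_one_right (pow_le_one' hx m) zero_le exp_neg_one_lt_one
    have h3 := mul_lt_one_of_nonneg_of_lt_one_left zero_le (h _ h2) (hm m le_rfl).le
    rw [← map_inv₀, ← map_pow, ← map_mul, ← map_mul] at h3
    have : x ^ m * t * (x⁻¹ ^ m * t⁻¹) = 1 := by rw [inv_pow]; field_simp
    rw [this, map_one] at h3
    exact lt_irrefl _ h3
  have h2 : P.valuation.IsEquiv P'.valuation := by
    rw [Valuation.isEquiv_iff_val_lt_one]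
    refine fun {x} => ⟨h x, fun hx => ?_⟩
    by_contra! hx'
    rcases eq_or_ne x 0 with rfl | h0
    · simp at hx'
    rw [Valuation.one_le_val_iff _ h0] at hx'
    have := h1 _ hx'
    rw [← Valuation.one_le_val_iff _ h0] at this
    exact absurd hx (not_lt.2 this)
  obtain ⟨t, ht0, ht⟩ := P.exists_valuation_eq_exp (-1)
  obtain ⟨s, hs0, hs⟩ := P'.exists_valuation_eq_exp (-1)
  have key : ∀ x ≠ 0, P'.valuation x = P'.valuation t ^ (-log (P.valuation x)) := by
    intro x hx
    rw [← map_zpow₀, ← h2.eq_iff, map_zpow₀, ht, ← exp_zsmul]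
    simp only [smul_eq_mul, mul_neg, mul_one, neg_neg]
    exact P.valuation_eq_exp_log hx
  have hlt : P'.valuation t < 1 := h t (by rw [ht]; exact exp_neg_one_lt_one)
  have hslt : P.valuation s < 1 := h2.lt_one_iff_lt_one.2 (by rw [hs]; exact exp_neg_one_lt_one)
  rw [P'.valuation_eq_exp_log ht0, ← exp_zero, exp_lt_exp] at hlt
  rw [P.valuation_eq_exp_log hs0, ← exp_zero, exp_lt_exp] at hslt
  have h3 := key s hs0
  rw [hs, P'.valuation_eq_exp_log ht0, ← exp_zsmul, exp_inj] at h3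
  -- The equivalence is the identity because both valuations are normalised: the exponent -1 of `s`
  -- at P' is a multiple of the negative exponent of `t`.
  have h4 : log (P'.valuation t) = -1 := by
    rw [smul_eq_mul] at h3
    nlinarith
  refine Place.ext (Valuation.ext fun x => ?_)
  rcases eq_or_ne x 0 with rfl | h0
  · simp
  rw [key x h0, P'.valuation_eq_exp_log ht0, ← exp_zsmul, h4, P.valuation_eq_exp_log h0]
  simp

theorem Place.eq_of_isEquiv {P P' : Place K} (h : P.valuation.IsEquiv P'.valuation) : P = P' :=
  Place.eq_of_lt_one fun _ => h.lt_one_iff_lt_one.1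

theorem Place.exists_lt_one_of_ne {P P' : Place K} (h : P ≠ P') :
    ∃ x, P.valuation x < 1 ∧ 1 ≤ P'.valuation x := by
  by_contra! hc
  exact h (Place.eq_of_lt_one hc)

/-- The function x^m/(1 + x^m) approaches 1 where x is large and 0 where x is small; it is the
switch used for weak approximation. -/
theorem valuation_pow_div_one_add (v : Valuation K ℤᵐ⁰) {x : K} {m : ℕ} (hm : m ≠ 0) :
    (1 < v x → v (x ^ m / (1 + x ^ m)) = 1 ∧ v (x ^ m / (1 + x ^ m) - 1) = (v x ^ m)⁻¹) ∧
    (v x < 1 → v (x ^ m / (1 + x ^ m)) = v x ^ m) := by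
  constructor
  · intro h
    have h1 : v (1 + x ^ m) = v x ^ m := by
      rw [Valuation.map_add_eq_of_lt_right, map_pow]
      rw [map_one, map_pow]
      exact one_lt_pow₀ h hm
    have h0 : v x ^ m ≠ 0 := pow_ne_zero _ (ne_of_gt (lt_trans zero_lt_one h))
    have h2 : 1 + x ^ m ≠ 0 := by
      intro h2
      rw [h2, map_zero] at h1
      exact h0 h1.symm
    refine ⟨by rw [map_div₀, h1, map_pow, div_self h0], ?_⟩
    have : x ^ m / (1 + x ^ m) - 1 = -(1 + x ^ m)⁻¹ := by field_simp; ring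
    rw [this, Valuation.map_neg, map_inv₀, h1]
  · intro h
    have h1 : v (1 + x ^ m) = 1 := by
      rw [Valuation.map_one_add_of_lt]
      rw [map_pow]
      exact pow_lt_one' h hm
    rw [map_div₀, h1, div_one, map_pow]

/-- Induction on S. Let x serve for S, and let b/a be large at Q and small at the new place R. If x
is integral at R, take x^m · b/a; otherwise replace x^m by the switch x^(m+1)/(1 + x^(m+1)), which
has value 1 at Q and R. -/
theorem Place.exists_one_lt_and_lt_one (Q : Place K) (S : Finset (Place K)) (hS : Q ∉ S) :
    ∃ x, 1 < Q.valuation x ∧ ∀ R ∈ S, R.valuation x < 1 := by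
  classical
  induction S using Finset.induction_on with
  | empty =>
    obtain ⟨x, -, hx⟩ := Q.exists_valuation_eq_exp 1
    exact ⟨x, by rw [hx, ← exp_zero, exp_lt_exp]; norm_num, by simp⟩
  | insert R S hR ih =>
    rw [Finset.mem_insert, not_or] at hS
    obtain ⟨x, hx, hxS⟩ := ih hS.2
    obtain ⟨a, ha, ha'⟩ := Place.exists_lt_one_of_ne hS.1
    obtain ⟨b, hb, hb'⟩ := Place.exists_lt_one_of_ne (Ne.symm hS.1)
    have ha0 : a ≠ 0 := by
      rintro rfl
      simp at ha'
    have hb0 : b ≠ 0 := by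
      rintro rfl
      simp at hb'
    have hy : 1 < Q.valuation (b / a) := by
      rw [map_div₀, one_lt_div₀ (Valuation.pos_iff _ |>.2 ha0)]
      exact lt_of_lt_of_le ha hb'
    have hy' : R.valuation (b / a) < 1 := by
      rw [map_div₀, div_lt_one₀ (Valuation.pos_iff _ |>.2 ha0)]
      exact lt_of_lt_of_le hb ha'
    have hpow : ∃ m : ℕ, ∀ T ∈ S, ∀ k ≥ m, T.valuation x ^ k * T.valuation (b / a) < 1 := by
      choose! m hm using fun (T : Place K) (hT : T ∈ S) =>
        exists_pow_mul_lt_one (hxS T hT) (T.valuation (b / a))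
      exact ⟨S.sup m, fun T hT k hk => hm T hT k ((Finset.le_sup hT).trans hk)⟩
    obtain ⟨m, hm⟩ := hpow
    rcases le_or_gt (R.valuation x) 1 with hle | hgt
    · refine ⟨x ^ m * (b / a), ?_, ?_⟩
      · rw [map_mul, map_pow]
        exact one_lt_mul_of_le_of_lt (one_le_pow₀ hx.le) hy
      · intro T hT
        rw [map_mul, map_pow]
        rcases Finset.mem_insert.1 hT with rfl | hT
        · exact mul_lt_one_of_nonneg_of_lt_one_right (pow_le_one' hle m) zero_le hy'
        · exact hm T hT m le_rfl
    · have h1 := fun v : Valuation K ℤᵐ⁰ => valuation_pow_div_one_add v (x := x) (Nat.succ_ne_zero m)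
      refine ⟨x ^ (m + 1) / (1 + x ^ (m + 1)) * (b / a), ?_, ?_⟩
      · rwa [map_mul, ((h1 _).1 hx).1, one_mul]
      · intro T hT
        rw [map_mul]
        rcases Finset.mem_insert.1 hT with rfl | hT
        · rwa [((h1 _).1 hgt).1, one_mul]
        · rw [(h1 _).2 (hxS T hT)]
          exact hm T hT _ (Nat.le_succ m)

theorem pow_le_exp_of_lt_one {a : ℤᵐ⁰} (ha : a < 1) (k : ℕ) : a ^ k ≤ exp (-k : ℤ) := by
  have := pow_le_pow_left' (lt_one_iff_le_exp.1 ha) k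
  rw [← exp_nsmul] at this
  simpa using this

/-- Weak approximation. -/
theorem Place.exists_approx (S : Finset (Place K)) (a : Place K → K) (m : ℤ) :
    ∃ x, ∀ Q ∈ S, Q.valuation (x - a Q) ≤ exp m := by
  classical
  -- With a common bound c for all the targets, switches that are accurate to order m - c give an
  -- approximation ∑ a_Q e_Q accurate to order m.
  obtain ⟨c, hc⟩ : ∃ c : ℤ, ∀ Q ∈ S, ∀ R ∈ S, Q.valuation (a R) ≤ exp c := by
    refine ⟨(S.sup fun Q => S.sup fun R => (log (Q.valuation (a R))).toNat : ℕ), fun Q hQ R hR => ?_⟩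
    refine le_trans (le_exp_log) (exp_le_exp.2 ((Int.self_le_toNat _).trans ?_))
    exact_mod_cast le_trans (Finset.le_sup (f := fun R => (log (Q.valuation (a R))).toNat) hR)
      (Finset.le_sup (f := fun Q => S.sup fun R => (log (Q.valuation (a R))).toNat) hQ)
  have he : ∀ Q ∈ S, ∃ e, Q.valuation (e - 1) ≤ exp (m - c) ∧
      ∀ R ∈ S.erase Q, R.valuation e ≤ exp (m - c) := by
    intro Q hQ
    obtain ⟨x, hx, hxS⟩ := Q.exists_one_lt_and_lt_one (S.erase Q) (by simp)
    -- Large enough for exp(-k) ≤ exp(m - c); the added 1 keeps the exponent nonzero.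
    set k := (c - m).toNat + 1 with hk
    have hkm : exp (-k : ℤ) ≤ exp (m - c) := exp_le_exp.2 (by omega)
    have h1 := fun v : Valuation K ℤᵐ⁰ => valuation_pow_div_one_add v (x := x) (m := k) (by omega)
    refine ⟨x ^ k / (1 + x ^ k), ?_, fun R hR => ?_⟩
    · rw [((h1 _).1 hx).2, ← inv_pow]
      exact (pow_le_exp_of_lt_one (inv_lt_one_of_one_lt₀ hx) k).trans hkm
    · rw [(h1 _).2 (hxS R hR)]
      exact (pow_le_exp_of_lt_one (hxS R hR) k).trans hkm
  choose! e he he' using he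
  refine ⟨∑ Q ∈ S, a Q * e Q, fun Q hQ => ?_⟩
  have : ∑ R ∈ S, a R * e R - a Q = a Q * (e Q - 1) + ∑ R ∈ S.erase Q, a R * e R := by
    rw [← Finset.add_sum_erase _ _ hQ]; ring
  have hmc : exp m = exp c * exp (m - c) := by rw [← exp_add]; congr 1; ring
  rw [this]
  refine Valuation.map_add_le _ ?_ (Valuation.map_sum_le _ fun R hR => ?_)
  · rw [map_mul, hmc]
    exact mul_le_mul' (hc Q hQ Q hQ) (he Q hQ)
  · rw [map_mul, hmc]
    exact mul_le_mul' (hc Q hQ R (Finset.mem_of_mem_erase hR))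
      (he' R (Finset.mem_of_mem_erase hR) Q (Finset.mem_erase.2 ⟨(Finset.ne_of_mem_erase hR).symm, hQ⟩))

/-- A valuation some power of which takes values in the powers of a single value `v t < 1` is
equivalent to a normalised discrete one. -/
theorem exists_place_isEquiv {Γ : Type*} [LinearOrderedCommGroupWithZero Γ] (v : Valuation K Γ)
    {t : K} (ht0 : t ≠ 0) (ht : v t < 1) {N : ℕ} (hN : N ≠ 0)
    (h : ∀ x ≠ 0, ∃ m : ℤ, v x ^ N = v t ^ m) : ∃ P : Place K, P.valuation.IsEquiv v := by
  have hpos : 0 < v t := (Valuation.pos_iff _).2 ht0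
  choose! m hm using h
  have minj : Function.Injective fun n : ℤ => v t ^ n := zpow_right_injective₀ hpos ht.ne
  have hm1 : ∀ x ≠ 0, ∀ y ≠ 0, m (x * y) = m x + m y := fun x hx y hy => minj <| by
    simp only
    rw [zpow_add₀ hpos.ne', ← hm _ hx, ← hm _ hy, ← hm _ (mul_ne_zero hx hy), map_mul, mul_pow]
  have hmt : m t = N := minj <| by
    simp only
    rw [← hm t ht0, zpow_natCast]
  -- The exponent m(x) in v(x)^N = v(t)^m(x) is a homomorphism. Its image is dℤ with d ≠ 0, as m(t)
  -- = N, and division by |d| normalises it.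
  let φ : Additive Kˣ →+ ℤ :=
    { toFun := fun x => m (x.toMul : Kˣ)
      map_zero' := by
        have := hm1 1 one_ne_zero 1 one_ne_zero
        rw [mul_one] at this
        simpa using this
      map_add' := fun x y => hm1 _ x.toMul.ne_zero _ y.toMul.ne_zero }
  obtain ⟨d, hd⟩ := Int.subgroup_cyclic φ.range
  have hdiv : ∀ x ≠ 0, ∃ e : ℤ, m x = d * e := by
    intro x hx
    have : m x ∈ φ.range := ⟨Additive.ofMul (Units.mk0 x hx), rfl⟩
    rw [hd, AddSubgroup.mem_closure_singleton] at this
    obtain ⟨e, he⟩ := this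
    exact ⟨e, by rw [← he, smul_eq_mul, mul_comm]⟩
  have hd0 : d ≠ 0 := by
    rintro rfl
    obtain ⟨e, he⟩ := hdiv t ht0
    rw [hmt, zero_mul] at he
    exact hN (by exact_mod_cast he)
  obtain ⟨z, hz⟩ : ∃ z : K, z ≠ 0 ∧ m z = |d| := by
    have : |d| ∈ φ.range := by
      rw [hd, AddSubgroup.mem_closure_singleton]
      rcases abs_choice d with h | h
      · exact ⟨1, by simp [h]⟩
      · exact ⟨-1, by simp [h]⟩
    obtain ⟨u, hu⟩ := this
    exact ⟨(u.toMul : Kˣ), Units.ne_zero _, hu⟩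
  have hdiv' : ∀ x ≠ 0, ∃ e : ℤ, m x = |d| * e := by
    intro x hx
    obtain ⟨e, he⟩ := hdiv x hx
    rcases abs_choice d with h | h
    · exact ⟨e, by rw [h, he]⟩
    · exact ⟨-e, by rw [h, he]; ring⟩
  choose! e he using hdiv'
  have hdpos : 0 < |d| := abs_pos.2 hd0
  have he1 : ∀ x ≠ 0, ∀ y ≠ 0, e (x * y) = e x + e y := fun x hx y hy => by
    have := hm1 x hx y hy
    rw [he _ (mul_ne_zero hx hy), he x hx, he y hy, ← mul_add] at this
    exact mul_left_cancel₀ hdpos.ne' this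
  have hez : e z = 1 := by
    have := he z hz.1
    rw [hz.2] at this
    exact mul_left_cancel₀ hdpos.ne' (by rw [← this, mul_one])
  have hle : ∀ x ≠ 0, ∀ y ≠ 0, (v x ≤ v y ↔ -e x ≤ -e y) := by
    intro x hx y hy
    rw [← pow_le_pow_iff_left₀ zero_le zero_le hN, hm x hx, hm y hy,
      zpow_le_zpow_iff_right_of_lt_one₀ hpos ht, he x hx, he y hy, neg_le_neg_iff]
    exact ⟨fun h => le_of_mul_le_mul_left h hdpos, fun h => mul_le_mul_of_nonneg_left h hdpos.le⟩
  classical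
  -- The sign is reversed because v(t) < 1: a larger exponent is a smaller value.
  let f : K → ℤᵐ⁰ := fun x => if x = 0 then 0 else exp (-e x)
  have hf : ∀ x y, f x ≤ f y ↔ v x ≤ v y := by
    intro x y
    rcases eq_or_ne x 0 with rfl | hx
    · simp [f]
    rcases eq_or_ne y 0 with rfl | hy
    · simp [f, hx]
    · simp only [f, if_neg hx, if_neg hy]
      rw [exp_le_exp, hle x hx y hy]
  have he10 : e 1 = 0 := by
    have := he1 1 one_ne_zero 1 one_ne_zero
    rw [mul_one] at this
    omega
  let w : Valuation K ℤᵐ⁰ :=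
    { toFun := f
      map_zero' := by simp [f]
      map_one' := by simp [f, he10]
      map_mul' := by
        intro x y
        rcases eq_or_ne x 0 with rfl | hx
        · simp [f]
        rcases eq_or_ne y 0 with rfl | hy
        · simp [f]
        simp only [f, if_neg hx, if_neg hy, if_neg (mul_ne_zero hx hy)]
        rw [← exp_add, he1 x hx y hy, neg_add]
      map_add_le_max' := by
        intro x y
        rcases le_total (v x) (v y) with hxy | hxy
        · exact le_max_of_le_right ((hf _ _).2 ((v.map_add x y).trans (max_le hxy le_rfl)))
        · exact le_max_of_le_left ((hf _ _).2 ((v.map_add x y).trans (max_le le_rfl hxy))) }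
  have hez' : ∀ k : ℤ, e (z ^ k) = k := by
    have hnat : ∀ k : ℕ, e (z ^ k) = k := by
      intro k
      induction k with
      | zero => simpa using he10
      | succ k ih =>
        rw [pow_succ, he1 _ (pow_ne_zero _ hz.1) _ hz.1, ih, hez]; push_cast; ring
    intro k
    have h1 := he1 (z ^ k) (zpow_ne_zero _ hz.1) (z ^ (-k).toNat) (pow_ne_zero _ hz.1)
    rw [← zpow_natCast, ← zpow_add₀ hz.1] at h1
    have h2 : k + ((-k).toNat : ℤ) = (k.toNat : ℤ) := by omega
    rw [h2, zpow_natCast, zpow_natCast, hnat, hnat] at h1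
    omega
  refine ⟨⟨w, fun γ => ?_⟩, fun x y => hf x y⟩
  rcases eq_or_ne γ 0 with rfl | hγ
  · exact ⟨0, map_zero _⟩
  · refine ⟨z ^ (-log γ), ?_⟩
    change (if _ then _ else _) = _
    rw [if_neg (zpow_ne_zero _ hz.1), hez', neg_neg, exp_log hγ]

end Places

/-! ### Places below and above in algebraic extensions -/

section Extension

open WithZero

variable {K L : Type*} [Field K] [Field L] [Algebra K L]

/-- For `x` algebraic over `K`, some power of `x` has the value of an element of `K`. -/
theorem exists_valuation_pow_eq {Γ : Type*} [LinearOrderedCommGroupWithZero Γ] (v : Valuation L Γ)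
    {x : L} (hx : x ≠ 0) (hK : IsIntegral K x) :
    ∃ k : ℕ, k ≠ 0 ∧ k ≤ (minpoly K x).natDegree ∧ ∃ c : K, c ≠ 0 ∧
      v x ^ k = v (algebraMap K L c) := by
  classical
  set p := minpoly K x with hp
  set T : ℕ → L := fun i => algebraMap K L (p.coeff i) * x ^ i with hT
  have hsum : ∑ i ∈ p.support, T i = 0 := by
    have := minpoly.aeval K x
    rwa [Polynomial.aeval_def, Polynomial.eval₂_eq_sum, Polynomial.sum_def] at this
  have hne : p.support.Nonempty := Polynomial.support_nonempty.2 (minpoly.ne_zero hK)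
  obtain ⟨i, hi, hmax⟩ := Finset.exists_max_image p.support (fun i => v (T i)) hne
  have hT0 : ∀ i ∈ p.support, T i ≠ 0 := fun i hi => mul_ne_zero
    ((map_ne_zero _).2 (Polynomial.mem_support_iff.1 hi)) (pow_ne_zero _ hx)
  -- In the relation p(x) = 0 the maximal value must occur at least twice, since a single dominant
  -- term cannot cancel. Comparing two dominant terms gives the power of x.
  obtain ⟨j, hj, hji, hij⟩ : ∃ j ∈ p.support, j ≠ i ∧ v (T j) = v (T i) := by
    by_contra! hc
    have h1 : v (∑ j ∈ p.support.erase i, T j) < v (T i) :=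
      Valuation.map_sum_lt _ ((Valuation.ne_zero_iff _).2 (hT0 i hi)) fun j hj =>
        lt_of_le_of_ne (hmax j (Finset.mem_of_mem_erase hj))
          (hc j (Finset.mem_of_mem_erase hj) (Finset.ne_of_mem_erase hj))
    have h2 := Valuation.map_add_eq_of_lt_left v h1
    rw [Finset.add_sum_erase _ _ hi, hsum, map_zero] at h2
    exact (Valuation.ne_zero_iff _).2 (hT0 i hi) h2.symm
  have main : ∀ i ∈ p.support, ∀ j ∈ p.support, i < j → v (T i) = v (T j) →
      ∃ k : ℕ, k ≠ 0 ∧ k ≤ p.natDegree ∧ ∃ c : K, c ≠ 0 ∧ v x ^ k = v (algebraMap K L c) := by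
    intro i hi j hj hlt h
    refine ⟨j - i, by omega, (Nat.sub_le _ _).trans (Polynomial.le_natDegree_of_mem_supp j hj),
      p.coeff i / p.coeff j, div_ne_zero (Polynomial.mem_support_iff.1 hi)
        (Polynomial.mem_support_iff.1 hj), ?_⟩
    have hx0 : v x ^ i ≠ 0 := pow_ne_zero _ ((Valuation.ne_zero_iff _).2 hx)
    have hc0 : v (algebraMap K L (p.coeff j)) ≠ 0 := (Valuation.ne_zero_iff _).2
      ((map_ne_zero _).2 (Polynomial.mem_support_iff.1 hj))
    simp only [hT, map_mul, map_pow] at h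
    rw [map_div₀, map_div₀, eq_div_iff hc0]
    refine mul_right_cancel₀ hx0 ?_
    rw [h, mul_right_comm, ← pow_add, Nat.sub_add_cancel hlt.le, mul_comm]
  rcases lt_or_gt_of_ne hji with h | h
  · exact main j hj i hi h hij
  · exact main i hi j hj h hij.symm

/-- The restriction of Q to K is not trivial, because some power of a uniformiser of Q has the value
of an element t of K. The k-th power of any value on K is then a power of the value of t. -/
theorem Place.exists_over [Algebra.IsAlgebraic K L] (Q : Place L) :
    ∃ P : Place K, P.Over (algebraMap K L) Q := by
  obtain ⟨s, hs0, hs⟩ := Q.exists_valuation_eq_exp (-1)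
  obtain ⟨k, hk, -, t, ht0, ht⟩ := exists_valuation_pow_eq Q.valuation hs0
    (Algebra.IsIntegral.isIntegral (R := K) s)
  rw [hs, ← exp_nsmul] at ht
  refine exists_place_isEquiv (Q.valuation.comap (algebraMap K L)) ht0 ?_ (N := k) hk fun x hx => ?_
  · rw [Valuation.comap_apply, ← ht, ← exp_zero, exp_lt_exp, smul_neg, nsmul_eq_mul]
    simp only [mul_one]
    omega
  · refine ⟨-log (Q.valuation (algebraMap K L x)), ?_⟩
    rw [Valuation.comap_apply, Valuation.comap_apply, ← ht, ← exp_zsmul,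
      Q.valuation_eq_exp_log ((map_ne_zero (algebraMap K L)).2 hx), ← exp_nsmul, log_exp]
    congr 1
    simp only [nsmul_eq_mul, smul_eq_mul]
    ring

theorem Place.Over.unique {E F : Type*} [Field E] [Field F] {f : E →+* F} {P P' : Place E}
    {Q : Place F} (h : P.Over f Q)
    (h' : P'.Over f Q) : P = P' :=
  Place.eq_of_isEquiv (Valuation.IsEquiv.trans h h'.symm)

/-- The place of `K` below a place of an algebraic extension. -/
def Place.below (K : Type*) [Field K] [Algebra K L] [Algebra.IsAlgebraic K L] (Q : Place L) :
    Place K :=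
  (Q.exists_over (K := K)).choose

theorem Place.below_over [Algebra.IsAlgebraic K L] (Q : Place L) :
    (Q.below K).Over (algebraMap K L) Q :=
  (Q.exists_over (K := K)).choose_spec

theorem Place.Over.below_eq [Algebra.IsAlgebraic K L] {P : Place K} {Q : Place L}
    (h : P.Over (algebraMap K L) Q) : Q.below K = P :=
  Q.below_over.unique h

variable (L) in
/-- Every place extends to a finite extension. -/
theorem Place.exists_above [FiniteDimensional K L] (P : Place K) :
    ∃ Q : Place L, P.Over (algebraMap K L) Q := by
  let f : P.valuation.valuationSubring →+* L :=
    (algebraMap K L).comp P.valuation.valuationSubring.subtype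
  -- Chevalley's theorem: a valuation ring of L dominating the valuation ring of P. Discreteness is
  -- recovered at the end from algebraicity.
  obtain ⟨V, hV, hloc⟩ := IsLocalRing.exists_factor_valuationRing f
  have h1 : ∀ x : K, P.valuation x ≤ 1 → V.valuation (algebraMap K L x) ≤ 1 := fun x hx =>
    (V.valuation_le_one_iff _).2 (hV ⟨x, hx⟩)
  have h2 : ∀ x : K, P.valuation x < 1 → V.valuation (algebraMap K L x) < 1 := by
    intro x hx
    refine lt_of_le_of_ne (h1 x hx.le) fun heq => ?_
    have hx0 : x ≠ 0 := by
      rintro rfl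
      simp at heq
    have hu : IsUnit (f.codRestrict V.toSubring hV ⟨x, hx.le⟩) := by
      have hinv : V.valuation (algebraMap K L x)⁻¹ ≤ 1 := by rw [map_inv₀, heq, inv_one]
      refine IsUnit.of_mul_eq_one ⟨_, (V.valuation_le_one_iff _).1 hinv⟩ (Subtype.ext ?_)
      exact mul_inv_cancel₀ ((map_ne_zero (algebraMap K L)).2 hx0)
    obtain ⟨⟨y, hy⟩, hxy⟩ := (hloc.map_nonunit _ hu).exists_right_inv
    have hxy' : x * y = 1 := congrArg Subtype.val hxy
    have : P.valuation (x * y) < 1 := by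
      rw [map_mul]
      exact mul_lt_one_of_nonneg_of_lt_one_left zero_le hx hy
    rw [hxy', map_one] at this
    exact lt_irrefl _ this
  have hequiv : P.valuation.IsEquiv (V.valuation.comap (algebraMap K L)) := by
    rw [Valuation.isEquiv_iff_val_lt_one]
    refine fun {x} => ⟨h2 x, fun hx => ?_⟩
    by_contra! hx'
    rcases eq_or_ne x 0 with rfl | h0
    · simp at hx'
    rw [Valuation.one_le_val_iff _ h0] at hx'
    have := h1 _ hx'
    rw [map_inv₀, ← Valuation.one_le_val_iff _ ((map_ne_zero (algebraMap K L)).2 h0)] at this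
    exact absurd hx (not_lt.2 this)
  obtain ⟨t, ht0, ht⟩ := P.exists_valuation_eq_exp (-1)
  obtain ⟨Q, hQ⟩ := exists_place_isEquiv V.valuation ((map_ne_zero (algebraMap K L)).2 ht0)
    (h2 t (by rw [ht]; exact exp_neg_one_lt_one))
    -- The exponent k that brings the value of x into K depends on x but is at most the degree, so
    -- the factorial is a common multiple.
    (N := (Module.finrank K L).factorial) (Nat.factorial_ne_zero _) (fun x hx => by
      obtain ⟨k, hk, hk', c, hc0, hc⟩ := exists_valuation_pow_eq V.valuation hx
        (Algebra.IsIntegral.isIntegral (R := K) x)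
      obtain ⟨l, hl⟩ := Nat.dvd_factorial (Nat.pos_of_ne_zero hk)
        (hk'.trans (minpoly.natDegree_le x))
      have hct : P.valuation c = P.valuation (t ^ (-log (P.valuation c))) := by
        rw [map_zpow₀, ht, ← exp_zsmul]
        rw [smul_eq_mul, neg_mul_neg, mul_one]
        exact P.valuation_eq_exp_log hc0
      rw [hequiv.eq_iff, Valuation.comap_apply, Valuation.comap_apply, map_zpow₀, map_zpow₀] at hct
      refine ⟨-log (P.valuation c) * l, ?_⟩
      rw [hl, pow_mul, hc, hct, zpow_mul, zpow_natCast])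
  exact ⟨Q, hequiv.trans ((hQ.symm).comap _)⟩

end Extension

/-! ### Functions with bounded poles and independence over k(y) -/

section Ball

open WithZero IntermediateField algebraAdjoinAdjoin

variable (k : Type*) {F : Type*} [Field k] [Field F] [Algebra k F]

/-- `F` is a function field in one variable over `k`. -/
structure IsFunctionField (k F : Type*) [Field k] [Field F] [Algebra k F] : Prop where
  exists_transcendental : ∃ x : F, Transcendental k x
  finite : ∀ x : F, Transcendental k x → FiniteDimensional k⟮x⟯ F

section

variable {k}

/-- The index of one `k`-subspace in another. -/
def relCard (A B : Submodule k F) : ℕ := A.toAddSubgroup.relIndex B.toAddSubgroup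

theorem relCard_mul {A B C : Submodule k F} (h : A ≤ B) (h' : B ≤ C) :
    relCard A B * relCard B C = relCard A C :=
  AddSubgroup.relIndex_mul_relIndex _ _ _ h h'

theorem relCard_eq_natCard (A B : Submodule k F) : relCard A B = Nat.card (B ⧸ A.submoduleOf B) :=
  rfl

theorem relCard_map_of_mul {A B A' B' : Submodule k F} {t : F} (ht : t ≠ 0)
    (hA : ∀ x, x ∈ A ↔ t * x ∈ A') (hB : ∀ x, x ∈ B ↔ t * x ∈ B') :
    relCard A B = relCard A' B' := by
  have key : ∀ {A A' : Submodule k F}, (∀ x, x ∈ A ↔ t * x ∈ A') →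
      A'.toAddSubgroup = A.toAddSubgroup.map (AddMonoidHom.mulLeft t) := by
    intro A A' hA
    ext y
    constructor
    · intro hy
      refine ⟨t⁻¹ * y, (hA _).2 ?_, mul_inv_cancel_left₀ ht y⟩
      rwa [mul_inv_cancel_left₀ ht]
    · rintro ⟨x, hx, rfl⟩
      exact (hA x).1 hx
  rw [relCard, relCard, key hA, key hB, AddSubgroup.relIndex_map_map_of_injective]
  exact mul_right_injective₀ ht

end

variable [Finite k]

/-- Since k is finite, x lies in a finite field and is a root of unity; the value group has no
torsion. -/
theorem Place.valuation_eq_one_of_isAlgebraic (Q : Place F) {x : F} (hx : IsAlgebraic k x)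
    (hx0 : x ≠ 0) : Q.valuation x = 1 := by
  have : FiniteDimensional k k⟮x⟯ := adjoin.finiteDimensional hx.isIntegral
  have : Finite k⟮x⟯ := Module.finite_of_finite k
  have hu : (⟨x, mem_adjoin_simple_self k x⟩ : k⟮x⟯) ≠ 0 := fun h => hx0 (congrArg Subtype.val h)
  obtain ⟨n, hn, h⟩ := isOfFinOrder_iff_pow_eq_one.1 (isOfFinOrder_of_finite (Units.mk0 _ hu))
  have hxn : x ^ n = 1 := congrArg (fun u : k⟮x⟯ˣ => ((u : k⟮x⟯) : F)) h
  have h1 : log (Q.valuation (x ^ n)) = 0 := by rw [hxn, map_one, log_one]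
  rw [map_pow, log_pow, smul_eq_zero] at h1
  rw [Q.valuation_eq_exp_log hx0, h1.resolve_left (by omega), exp_zero]

theorem Place.valuation_algebraMap_le_one (Q : Place F) (c : k) :
    Q.valuation (algebraMap k F c) ≤ 1 := by
  rcases eq_or_ne c 0 with rfl | hc
  · simp
  · exact (Q.valuation_eq_one_of_isAlgebraic k (isAlgebraic_algebraMap c)
      ((map_ne_zero _).2 hc)).le

theorem transcendental_of_valuation_ne_one {Q : Place F} {x : F} (hx0 : x ≠ 0)
    (hx : Q.valuation x ≠ 1) : Transcendental k x :=
  fun h => hx (Q.valuation_eq_one_of_isAlgebraic k h hx0)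

/-- The elements with poles at the places of `S` bounded by `D`. -/
def ball (S : Set (Place F)) (D : Place F → ℤ) : Submodule k F where
  carrier := {x | ∀ Q ∈ S, Q.valuation x ≤ exp (D Q)}
  zero_mem' Q _ := by simp
  add_mem' hx hy Q hQ := Q.valuation.map_add_le (hx Q hQ) (hy Q hQ)
  smul_mem' c x hx Q hQ := by
    rw [Algebra.smul_def, map_mul]
    exact mul_le_of_le_one_of_le (Q.valuation_algebraMap_le_one k c) (hx Q hQ)

variable {k}

theorem mem_ball {S : Set (Place F)} {D : Place F → ℤ} {x : F} :
    x ∈ ball k S D ↔ ∀ Q ∈ S, Q.valuation x ≤ exp (D Q) := Iff.rfl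

theorem ball_mono {S : Set (Place F)} {D D' : Place F → ℤ} (h : ∀ Q ∈ S, D Q ≤ D' Q) :
    ball k S D ≤ ball k S D' :=
  fun _ hx Q hQ => (hx Q hQ).trans (exp_le_exp.2 (h Q hQ))

theorem mul_mem_ball {S : Set (Place F)} {D D' : Place F → ℤ} {x y : F} (hx : x ∈ ball k S D)
    (hy : y ∈ ball k S D') : x * y ∈ ball k S (D + D') := fun Q hQ => by
  rw [map_mul, Pi.add_apply, exp_add]
  exact mul_le_mul' (hx Q hQ) (hy Q hQ)

theorem aeval_mem_ball {S : Set (Place F)} {y : F} (hy : y ∈ ball k S 0) (p : Polynomial k) :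
    Polynomial.aeval y p ∈ ball k S 0 := by
  have h1 : (1 : F) ∈ ball k S 0 := fun Q _ => by simp
  induction p using Polynomial.induction_on' with
  | add p q hp hq => rw [map_add]; exact add_mem hp hq
  | monomial n a =>
    rw [Polynomial.aeval_monomial, ← Algebra.smul_def]
    refine Submodule.smul_mem _ _ ?_
    induction n with
    | zero => simpa using h1
    | succ n ih => rw [pow_succ]; simpa using mul_mem_ball ih hy

/-- The ball bounded by the values of y is y times the ring of S-integral functions. In a relation
with coefficients in k[y] the constant terms give a relation modulo y, so they vanish; dividing by y
lowers the degrees. -/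
theorem linearIndependent_of_quotient {S : Set (Place F)} {y : F} (hy : Transcendental k y)
    (hyS : y ∈ ball k S 0) {ι : Type*} [Finite ι] (x : ι → ball k S 0)
    (hx : LinearIndependent k fun i =>
      (Submodule.Quotient.mk (x i) :
        ball k S 0 ⧸ (ball k S fun Q => log (Q.valuation y)).submoduleOf (ball k S 0))) :
    LinearIndependent k⟮y⟯ fun i => (x i : F) := by
  classical
  have := Fintype.ofFinite ι
  have hy0 : y ≠ 0 := by
    rintro rfl
    exact hy isAlgebraic_zero
  have key : ∀ d : ℕ, ∀ p : ι → Polynomial k, (∀ i, (p i).natDegree < d) →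
      ∑ i, Polynomial.aeval y (p i) * (x i : F) = 0 → ∀ i, p i = 0 := by
    intro d
    induction d with
    | zero => exact fun p hp _ i => absurd (hp i) (Nat.not_lt_zero _)
    | succ d ih =>
      intro p hp hsum
      have hdec : ∀ i, Polynomial.aeval y (p i) =
          y * Polynomial.aeval y (p i).divX + algebraMap k F ((p i).coeff 0) := fun i => by
        conv_lhs => rw [← Polynomial.divX_mul_X_add (p i)]
        rw [map_add, map_mul, Polynomial.aeval_X, Polynomial.aeval_C, mul_comm]
      have hsum' : ∑ i, (p i).coeff 0 • (x i : F) =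
          - (y * ∑ i, Polynomial.aeval y (p i).divX * (x i : F)) := by
        rw [eq_neg_iff_add_eq_zero, Finset.mul_sum, ← Finset.sum_add_distrib, ← hsum]
        refine Finset.sum_congr rfl fun i _ => ?_
        rw [hdec i, Algebra.smul_def]
        ring
      have hc : ∀ i, (p i).coeff 0 = 0 := by
        have h0 : ∑ i, (p i).coeff 0 • (Submodule.Quotient.mk (x i) :
            ball k S 0 ⧸ (ball k S fun Q => log (Q.valuation y)).submoduleOf (ball k S 0)) = 0 := by
          simp only [← Submodule.mkQ_apply, ← map_smul]
          rw [← map_sum, Submodule.mkQ_apply, Submodule.Quotient.mk_eq_zero]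
          change ((∑ i, (p i).coeff 0 • x i : ball k S 0) : F) ∈
            ball k S fun Q => log (Q.valuation y)
          simp only [Submodule.coe_sum, Submodule.coe_smul]
          rw [hsum']
          refine neg_mem fun Q hQ => ?_
          have hmem : ∑ i, Polynomial.aeval y (p i).divX * (x i : F) ∈ ball k S 0 :=
            sum_mem fun i _ => by simpa using mul_mem_ball (aeval_mem_ball hyS _) (x i).2
          rw [map_mul, ← Q.valuation_eq_exp_log hy0]
          exact mul_le_of_le_one_right' (by simpa using hmem Q hQ)
        exact fun i => Fintype.linearIndependent_iff.1 hx _ h0 i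
      have hdiv : ∀ i, p i = (p i).divX * Polynomial.X := fun i => by
        conv_lhs => rw [← Polynomial.divX_mul_X_add (p i), hc i, map_zero, add_zero]
      have hzero := ih (fun i => (p i).divX)
      rcases Nat.eq_zero_or_pos d with rfl | hd
      · intro i
        have := Polynomial.eq_C_of_natDegree_eq_zero (Nat.lt_one_iff.1 (hp i))
        rw [this, hc i, map_zero]
      · intro i
        rw [hdiv i, hzero (fun i => ?_) ?_ i, zero_mul]
        · simp only [hc, zero_smul, Finset.sum_const_zero] at hsum'
          exact (mul_eq_zero.1 (neg_eq_zero.1 hsum'.symm)).resolve_left hy0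
        · rw [Polynomial.natDegree_divX_eq_natDegree_tsub_one]
          have := hp i
          omega
  -- Clearing denominators: k(y) is the fraction field of k[y], so polynomial coefficients suffice.
  rw [← LinearIndependent.iff_fractionRing (Algebra.adjoin k {y}) k⟮y⟯,
    Fintype.linearIndependent_iff]
  intro g hg i
  have hp : ∀ i, ∃ p : Polynomial k, Polynomial.aeval y p = (g i : F) := fun i => by
    exact (Algebra.adjoin_singleton_eq_range_aeval k y).le (g i).2
  choose p hp using hp
  have := key (Finset.univ.sup (fun i => (p i).natDegree) + 1) p
    (fun i => Nat.lt_succ_of_le (Finset.le_sup (f := fun i => (p i).natDegree) (Finset.mem_univ i)))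
    (by simpa [hp, Algebra.smul_def] using hg) i
  exact Subtype.ext (by rw [← hp i, this, map_zero]; rfl)

/-- A basis of the S-integral functions modulo y lifts to elements independent over k(y), so its
size is at most [F : k(y)]. This is the upper bound for the number of zeros of y. -/
theorem relCard_le_pow (hF : IsFunctionField k F) {S : Set (Place F)} {y : F}
    (hy : Transcendental k y) (hyS : y ∈ ball k S 0) :
    relCard (ball k S fun Q => log (Q.valuation y)) (ball k S 0) ≠ 0 ∧
    relCard (ball k S fun Q => log (Q.valuation y)) (ball k S 0) ≤
      Nat.card k ^ Module.finrank k⟮y⟯ F := by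
  have := hF.finite y hy
  set M := ball k S 0 ⧸ (ball k S fun Q => log (Q.valuation y)).submoduleOf (ball k S 0) with hM
  have hrank : Module.rank k M ≤ Module.finrank k⟮y⟯ F := by
    refine rank_le fun s hs => ?_
    choose x hx using fun i : s => Submodule.Quotient.mk_surjective _ (i : M)
    have h1 := linearIndependent_of_quotient hy hyS x (by simpa only [hx] using hs)
    simpa using h1.fintype_card_le_finrank
  have hfin : Module.Finite k M :=
    Module.rank_lt_aleph0_iff.1 (hrank.trans_lt (Cardinal.natCast_lt_aleph0))
  have : Finite M := Module.finite_of_finite k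
  rw [relCard_eq_natCard]
  refine ⟨Nat.card_pos.ne', ?_⟩
  rw [Module.natCard_eq_pow_finrank (K := k)]
  exact Nat.pow_le_pow_right Nat.card_pos (Module.finrank_le_of_rank_le hrank)

end Ball

/-! ### Degrees of places and divisors, and indices between balls -/

section Degree

open WithZero IntermediateField

variable (k : Type*) {F : Type*} [Field k] [Field F] [Algebra k F] [Finite k]

/-- The order of the residue field of `Q`. -/
def residueCard (Q : Place F) : ℕ :=
  relCard (ball k {Q} fun _ => -1) (ball k {Q} 0)

/-- The degree of `Q` over `k`. -/
def placeDeg (Q : Place F) : ℕ := Nat.log (Nat.card k) (residueCard k Q)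

variable {k}

theorem residueCard_ne_zero (hF : IsFunctionField k F) (Q : Place F) : residueCard k Q ≠ 0 := by
  obtain ⟨t, ht0, ht⟩ := Q.exists_valuation_eq_exp (-1)
  have hlt : Q.valuation t < 1 := by rw [ht]; exact exp_neg_one_lt_one
  have h := (relCard_le_pow (S := {Q}) hF (transcendental_of_valuation_ne_one k ht0 hlt.ne)
    (fun R hR => by rw [Set.mem_singleton_iff.1 hR]; simpa using hlt.le)).1
  have : ball k {Q} (fun R => log (R.valuation t)) = ball k {Q} fun _ => -1 := by
    ext x
    simp [mem_ball, ht]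
  rwa [this] at h

/-- The residue field is a finite vector space over k, so the logarithm defining the degree is
exact. -/
theorem residueCard_eq_pow (hF : IsFunctionField k F) (Q : Place F) :
    residueCard k Q = Nat.card k ^ placeDeg k Q := by
  have h := residueCard_ne_zero hF Q
  have hfin : Finite (ball k {Q} 0 ⧸ (ball k {Q} fun _ => -1).submoduleOf (ball k {Q} 0)) :=
    Nat.finite_of_card_ne_zero h
  have : residueCard k Q = Nat.card k ^ _ :=
    Module.natCard_eq_pow_finrank (K := k)
      (V := ball k {Q} 0 ⧸ (ball k {Q} fun _ => -1).submoduleOf (ball k {Q} 0))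
  rw [placeDeg, this, Nat.log_pow Finite.one_lt_card]

theorem placeDeg_pos (hF : IsFunctionField k F) (Q : Place F) : 0 < placeDeg k Q := by
  rw [Nat.pos_iff_ne_zero]
  intro h
  have h1 := residueCard_eq_pow hF Q
  rw [h, pow_zero, residueCard, relCard, AddSubgroup.relIndex_eq_one] at h1
  have : (1 : F) ∈ ball k {Q} fun _ => -1 := h1 (show (1 : F) ∈ ball k {Q} 0 from fun R _ => by simp)
  have := this Q rfl
  rw [map_one] at this
  exact absurd this (not_le.2 exp_neg_one_lt_one)

/-- Multiplication by an element of value exp(-(m+1)) carries this step of the filtration at Q to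
the residue field. -/
theorem relCard_ball_singleton (Q : Place F) (m : ℤ) :
    relCard (ball k {Q} fun _ => m) (ball k {Q} fun _ => m + 1) = residueCard k Q := by
  obtain ⟨t, ht0, ht⟩ := Q.exists_valuation_eq_exp (-(m + 1))
  have h1 : ∀ (n : ℤ) x, Q.valuation x ≤ exp n ↔ Q.valuation (t * x) ≤ exp (n - (m + 1)) := by
    intro n x
    rcases eq_or_ne x 0 with rfl | hx
    · simp
    · rw [Q.le_exp_iff hx, Q.le_exp_iff (mul_ne_zero ht0 hx), Q.log_mul ht0 hx, ht, log_exp]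
      constructor <;> intro h <;> omega
  refine relCard_map_of_mul ht0 (fun x => ?_) (fun x => ?_)
  · simp only [mem_ball, Set.mem_singleton_iff, forall_eq]
    rw [h1]
    simp
  · simp only [mem_ball, Set.mem_singleton_iff, forall_eq]
    rw [h1]
    simp

/-- Divisors. -/
abbrev Divisor (F : Type*) [Field F] := Place F →₀ ℤ

variable (k) in
/-- The degree of a divisor. -/
def Divisor.deg : Divisor F →ₗ[ℤ] ℤ := Finsupp.linearCombination ℤ fun Q => (placeDeg k Q : ℤ)

theorem Divisor.deg_single (Q : Place F) (m : ℤ) :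
    Divisor.deg k (Finsupp.single Q m) = m * placeDeg k Q := by
  rw [Divisor.deg, Finsupp.linearCombination_single, smul_eq_mul]

theorem Divisor.deg_nonneg {D : Divisor F} (h : 0 ≤ D) : 0 ≤ Divisor.deg k D := by
  rw [Divisor.deg, Finsupp.linearCombination_apply]
  exact Finset.sum_nonneg fun Q _ => smul_nonneg (h Q) (Nat.cast_nonneg _)

theorem Divisor.deg_mono {D D' : Divisor F} (h : D ≤ D') : Divisor.deg k D ≤ Divisor.deg k D' := by
  have := Divisor.deg_nonneg (k := k) (sub_nonneg.2 h)
  rwa [map_sub, sub_nonneg] at this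

/-- An effective difference of divisors is removed one point at a time; the induction runs on its
total multiplicity, not weighted by degrees. -/
theorem Divisor.induction_le {p : Divisor F → Divisor F → Prop} (refl : ∀ D, p D D)
    (step : ∀ D D' Q, D ≤ D' → p D D' → p D (D' + Finsupp.single Q 1)) {D D' : Divisor F}
    (h : D ≤ D') : p D D' := by
  classical
  obtain ⟨E, rfl⟩ : ∃ E, D' = D + E := ⟨D' - D, by abel⟩
  have hE : 0 ≤ E := by simpa using h
  clear h
  induction hn : E.sum fun _ m => m.toNat using Nat.strong_induction_on generalizing E with
  | _ n ih =>
    by_cases h0 : E = 0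
    · subst h0
      simpa using refl D
    obtain ⟨Q, hQ⟩ := Finsupp.ne_iff.1 h0
    have hQ1 : 1 ≤ E Q := by
      have h1 := hE Q
      have h2 : E Q ≠ 0 := hQ
      have h3 : (0 : ℤ) ≤ E Q := h1
      omega
    have hE' : 0 ≤ E - Finsupp.single Q 1 := by
      intro R
      rw [Finsupp.sub_apply, Finsupp.zero_apply]
      rcases eq_or_ne R Q with rfl | hR
      · rw [Finsupp.single_eq_same]; omega
      · rw [Finsupp.single_eq_of_ne hR, sub_zero]
        exact hE R
    have hs : (E - Finsupp.single Q 1).sum (fun _ m => m.toNat) < n := by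
      have hadd : ∀ A B : Divisor F, 0 ≤ A → 0 ≤ B → (A + B).sum (fun _ m => m.toNat) =
          A.sum (fun _ m => m.toNat) + B.sum (fun _ m => m.toNat) := by
        intro A B hA hB
        rw [Finsupp.sum_of_support_subset (s := A.support ∪ B.support) A Finset.subset_union_left,
          Finsupp.sum_of_support_subset (s := A.support ∪ B.support) B Finset.subset_union_right,
          Finsupp.sum_of_support_subset (s := A.support ∪ B.support) (A + B) Finsupp.support_add,
          ← Finset.sum_add_distrib]
        · refine Finset.sum_congr rfl fun R _ => ?_
          rw [Finsupp.add_apply, Int.toNat_add (hA R) (hB R)]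
        all_goals simp
      have h1 := hadd (E - Finsupp.single Q 1) (Finsupp.single Q 1) hE'
        (Finsupp.single_nonneg.2 zero_le_one)
      rw [sub_add_cancel, hn, Finsupp.sum_single_index (by simp)] at h1
      have : (1 : ℤ).toNat = 1 := rfl
      omega
    have h1 := ih _ hs _ hE' rfl
    have h2 := step D _ Q (by simpa using hE') h1
    rwa [add_assoc, sub_add_cancel] at h2

/-- Allowing one more pole at Q enlarges the space by a quotient that embeds in the residue field of
Q. For finite S weak approximation makes this embedding surjective; for S not containing Q nothing
changes. -/
theorem relCard_ball_step {S : Set (Place F)} (hF : IsFunctionField k F) (D : Divisor F)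
    (Q : Place F) :
    relCard (ball k S D) (ball k S (D + Finsupp.single Q 1 : Divisor F)) ≠ 0 ∧
    relCard (ball k S D) (ball k S (D + Finsupp.single Q 1 : Divisor F)) ≤ Nat.card k ^ placeDeg k Q ∧
    (S.Finite → Q ∈ S → relCard (ball k S D) (ball k S (D + Finsupp.single Q 1 : Divisor F)) =
      Nat.card k ^ placeDeg k Q) := by
  classical
  set D' : Divisor F := D + Finsupp.single Q 1 with hD'
  have hDQ : D' Q = D Q + 1 := by simp [hD']
  have hDR : ∀ R ≠ Q, D' R = D R := fun R hR => by simp [hD', Finsupp.single_eq_of_ne hR]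
  have hle : ∀ R, D R ≤ D' R := fun R => by
    rcases eq_or_ne R Q with rfl | hR
    · omega
    · exact (hDR R hR).ge
  have hpos : 0 < Nat.card k ^ placeDeg k Q := pow_pos Nat.card_pos _
  by_cases hQ : Q ∈ S
  swap
  · have : ball k S D = ball k S D' := by
      refine le_antisymm (ball_mono fun R _ => hle R) (ball_mono fun R hR => (hDR R ?_).le)
      rintro rfl
      exact hQ hR
    have h1 : relCard (ball k S D) (ball k S D') = 1 := by
      rw [this, relCard, AddSubgroup.relIndex_self]
    rw [h1]
    exact ⟨one_ne_zero, hpos, fun _ h => absurd h hQ⟩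
  have hinf : (ball k S D).toAddSubgroup =
      (ball k {Q} fun _ => D Q).toAddSubgroup ⊓ (ball k S D').toAddSubgroup := by
    ext x
    constructor
    · exact fun hx => ⟨fun R hR => by rw [Set.mem_singleton_iff.1 hR]; exact hx Q hQ,
        show x ∈ ball k S D' from ball_mono (fun R _ => hle R) hx⟩
    · rintro ⟨h1, h2⟩ R hR
      rcases eq_or_ne R Q with rfl | hRQ
      · exact h1 R rfl
      · rw [← hDR R hRQ]
        exact h2 R hR
  have hsub : (ball k S D').toAddSubgroup ≤ (ball k {Q} fun _ => D Q + 1).toAddSubgroup :=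
    fun x hx R hR => by
      rw [Set.mem_singleton_iff.1 hR, ← hDQ]
      exact hx Q hQ
  have hcard := (relCard_ball_singleton (k := k) Q (D Q)).trans (residueCard_eq_pow hF Q)
  have hrel : relCard (ball k S D) (ball k S D') =
      (ball k {Q} fun _ => D Q).toAddSubgroup.relIndex (ball k S D').toAddSubgroup := by
    rw [relCard, hinf, AddSubgroup.inf_relIndex_right]
  refine ⟨?_, ?_, fun hS _ => ?_⟩
  · rw [hrel]
    intro h0
    have := AddSubgroup.relIndex_eq_zero_of_le_right hsub h0
    rw [relCard, this] at hcard
    exact hpos.ne hcard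
  · rw [hrel, ← hcard]
    exact AddSubgroup.relIndex_le_of_le_right hsub (hcard.trans_ne hpos.ne')
  · have hsup : (ball k {Q} fun _ => D Q + 1).toAddSubgroup =
        (ball k S D').toAddSubgroup ⊔ (ball k {Q} fun _ => D Q).toAddSubgroup := by
      refine le_antisymm (fun x hx => ?_) (sup_le hsub fun x hx R hR => ?_)
      · obtain ⟨c, hc⟩ : ∃ c : ℤ, ∀ R ∈ S, c ≤ D R := by
          obtain ⟨c, hc⟩ := (hS.image D).bddBelow
          exact ⟨c, fun R hR => hc ⟨R, hR, rfl⟩⟩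
        -- z copies x at Q and is small at the rest of S, so x = z + (x - z) splits x into a part
        -- satisfying the bounds of D' and a part satisfying that of D at Q.
        obtain ⟨z, hz⟩ := Place.exists_approx hS.toFinset (fun R => if R = Q then x else 0) c
        have hzQ : Q.valuation (z - x) ≤ exp (D Q) := by
          have := hz Q (hS.mem_toFinset.2 hQ)
          rw [if_pos rfl] at this
          exact this.trans (exp_le_exp.2 (hc Q hQ))
        have hxQ : Q.valuation x ≤ exp (D Q + 1) := hx Q rfl
        refine AddSubgroup.mem_sup.2 ⟨z, fun R hR => ?_, x - z, fun R hR => ?_, by abel⟩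
        · rcases eq_or_ne R Q with rfl | hRQ
          · rw [hDQ]
            have : z = (z - x) + x := by ring
            rw [this]
            exact R.valuation.map_add_le (hzQ.trans (exp_le_exp.2 (by omega))) hxQ
          · have := hz R (hS.mem_toFinset.2 hR)
            rw [if_neg hRQ, sub_zero] at this
            rw [hDR R hRQ]
            exact this.trans (exp_le_exp.2 (hc R hR))
        · rw [Set.mem_singleton_iff.1 hR, Valuation.map_sub_swap]
          exact hzQ
      · exact (hx R hR).trans (exp_le_exp.2 (by simp))
    rw [relCard, hsup, AddSubgroup.relIndex_sup_right] at hcard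
    rw [hrel, hcard]

/-- Product of the one-point steps. Equality needs D = D' outside S, since the places there add to
the degree but impose no condition on the ball. -/
theorem relCard_ball_le {S : Set (Place F)} (hF : IsFunctionField k F) {D D' : Divisor F}
    (h : D ≤ D') :
    relCard (ball k S D) (ball k S D') ≠ 0 ∧
    relCard (ball k S D) (ball k S D') ≤ Nat.card k ^ (Divisor.deg k (D' - D)).toNat ∧
    (S.Finite → (∀ Q ∉ S, D Q = D' Q) → relCard (ball k S D) (ball k S D') =
      Nat.card k ^ (Divisor.deg k (D' - D)).toNat) := by
  refine Divisor.induction_le (p := fun D D' : Divisor F =>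
    relCard (ball k S D) (ball k S D') ≠ 0 ∧
    relCard (ball k S D) (ball k S D') ≤ Nat.card k ^ (Divisor.deg k (D' - D)).toNat ∧
    (S.Finite → (∀ Q ∉ S, D Q = D' Q) → relCard (ball k S D) (ball k S D') =
      Nat.card k ^ (Divisor.deg k (D' - D)).toNat)) (fun D => by simp [relCard]) ?_ h
  · intro D D' Q hD ih
    have h1 := relCard_ball_step (S := S) hF D' Q
    have hle : D' ≤ D' + Finsupp.single Q 1 :=
      le_add_of_nonneg_right (Finsupp.single_nonneg.2 zero_le_one)
    rw [← relCard_mul (ball_mono fun Q _ => hD Q) (ball_mono fun Q _ => hle Q)]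
    have hdeg : (Divisor.deg k (D' + Finsupp.single Q 1 - D)).toNat =
        (Divisor.deg k (D' - D)).toNat + placeDeg k Q := by
      rw [add_sub_right_comm, map_add, Divisor.deg_single, one_mul,
        Int.toNat_add (Divisor.deg_nonneg (sub_nonneg.2 hD)) (Nat.cast_nonneg _), Int.toNat_natCast]
    rw [hdeg, pow_add]
    refine ⟨mul_ne_zero ih.1 h1.1, Nat.mul_le_mul ih.2.1 h1.2.1, fun hS hout => ?_⟩
    have hQ : Q ∈ S := by
      by_contra hQ
      have h2 := hout Q hQ
      have h3 := hD Q
      rw [Finsupp.add_apply, Finsupp.single_eq_same] at h2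
      omega
    rw [ih.2.2 hS (fun R hR => ?_), h1.2.2 hS hQ]
    rw [hout R hR, Finsupp.add_apply, Finsupp.single_eq_of_ne, add_zero]
    rintro rfl
    exact hR hQ

end Degree

/-! ### Zeros, poles and Riemann–Roch spaces -/

section ProductFormula

open WithZero IntermediateField

variable {k : Type*} {F : Type*} [Field k] [Field F] [Algebra k F]

theorem transcendental_inv {x : F} (hx : Transcendental k x) : Transcendental k x⁻¹ :=
  fun h => hx (by simpa using h.inv)

theorem Transcendental.ne_zero' {x : F} (hx : Transcendental k x) : x ≠ 0 := by
  rintro rfl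
  exact hx isAlgebraic_zero

/-- A transcendental element has a zero. -/
theorem exists_valuation_lt_one (hF : IsFunctionField k F) {y : F} (hy : Transcendental k y) :
    ∃ Q : Place F, Q.valuation y < 1 := by
  have := hF.finite y hy
  -- y is a variable of k(y), so it vanishes at the X-adic place, and this place extends to F.
  let v := (Polynomial.idealX k).valuation (RatFunc k)
  let P₀ : Place (RatFunc k) :=
    ⟨v, IsDedekindDomain.HeightOneSpectrum.valuation_surjective _ _⟩
  let e : k⟮y⟯ ≃+* RatFunc k := (RatFunc.algEquivOfTranscendental y hy).symm.toRingEquiv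
  obtain ⟨Q, hQ⟩ := (P₀.comap e).exists_above F
  refine ⟨Q, ?_⟩
  have h1 : (P₀.comap e).valuation (AdjoinSimple.gen k y) < 1 := by
    have h2 : e (AdjoinSimple.gen k y) = algebraMap (Polynomial k) (RatFunc k) Polynomial.X := by
      have := RatFunc.algEquivOfTranscendental_symm_aeval y hy Polynomial.X
      rwa [Polynomial.aeval_X] at this
    change v (e (AdjoinSimple.gen k y)) < 1
    rw [h2]
    exact (IsDedekindDomain.HeightOneSpectrum.valuation_lt_one_iff_dvd _ _).2 dvd_rfl
  exact hQ.lt_one_iff_lt_one.1 h1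

theorem exists_place (hF : IsFunctionField k F) : Nonempty (Place F) := by
  obtain ⟨y, hy⟩ := hF.exists_transcendental
  exact ⟨(exists_valuation_lt_one hF hy).choose⟩

variable [Finite k]

/-- The divisor of zeros in a finite set of places has degree at most the degree of the function. -/
theorem deg_le_finrank (hF : IsFunctionField k F) {y : F} (hy : Transcendental k y)
    (D : Divisor F) (hD : ∀ Q ∈ D.support, Q.valuation y = exp (-D Q)) (hD0 : 0 ≤ D) :
    Divisor.deg k D ≤ Module.finrank k⟮y⟯ F := by
  have hyS : y ∈ ball k (D.support : Set (Place F)) 0 := fun Q hQ => by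
    rw [hD Q hQ]
    exact exp_le_exp.2 (by simpa using hD0 Q)
  have h1 := (relCard_le_pow hF hy hyS).2
  have h2 := (relCard_ball_le (S := (D.support : Set (Place F))) hF (D := -D) (D' := 0)
    (by simpa using hD0)).2.2 D.support.finite_toSet (fun Q hQ => by
      simpa using (Finsupp.notMem_support_iff.1 hQ))
  have h3 : ball k (D.support : Set (Place F)) (fun Q => log (Q.valuation y)) =
      ball k (D.support : Set (Place F)) (-D : Divisor F) := by
    refine le_antisymm (ball_mono fun Q hQ => ?_) (ball_mono fun Q hQ => ?_) <;>
    · rw [hD Q hQ]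
      simp
  rw [h3] at h1
  have h4 : ball k (D.support : Set (Place F)) ((0 : Divisor F) : Place F → ℤ) =
    ball k (D.support : Set (Place F)) 0 := rfl
  rw [h4] at h2
  rw [h2, zero_sub, neg_neg] at h1
  have := (Nat.pow_le_pow_iff_right Finite.one_lt_card).1 h1
  omega

/-- Among infinitely many zeros one could choose [F : k(y)] + 1 of them; each contributes at least 1
to the degree of the divisor of zeros, which contradicts `deg_le_finrank`. -/
theorem finite_setOf_valuation_lt_one (hF : IsFunctionField k F) {y : F}
    (hy : Transcendental k y) : {Q : Place F | Q.valuation y < 1}.Finite := by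
  classical
  by_contra hinf
  obtain ⟨s, hs, hcard⟩ := Set.Infinite.exists_subset_card_eq hinf (Module.finrank k⟮y⟯ F + 1)
  have hy0 := Transcendental.ne_zero' hy
  have hlog : ∀ Q ∈ s, 1 ≤ -log (Q.valuation y) := fun Q hQ => by
    have h1 : Q.valuation y < 1 := hs hQ
    rw [lt_one_iff_le_exp, Q.le_exp_iff hy0] at h1
    omega
  let D : Divisor F := Finsupp.onFinset s (fun Q => if Q ∈ s then -log (Q.valuation y) else 0)
    (fun Q h => by by_contra h'; simp [h'] at h)
  have hDs : ∀ Q ∈ s, D Q = -log (Q.valuation y) := fun Q hQ => by simp [D, hQ]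
  have hD : ∀ Q ∉ s, D Q = 0 := fun Q hQ => by simp [D, hQ]
  have hsupp : ∀ Q ∈ D.support, Q ∈ s := fun Q hQ => by
    by_contra h
    exact (Finsupp.mem_support_iff.1 hQ) (hD Q h)
  have h1 := deg_le_finrank hF hy D (fun Q hQ => by
    rw [hDs Q (hsupp Q hQ), neg_neg]; exact Q.valuation_eq_exp_log hy0) (fun Q => by
      by_cases hQ : Q ∈ s
      · have := hlog Q hQ
        rw [hDs Q hQ, Finsupp.zero_apply]
        omega
      · exact (hD Q hQ).ge)
  have h2 : (s.card : ℤ) ≤ Divisor.deg k D := by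
    rw [Divisor.deg, Finsupp.linearCombination_apply, Finsupp.sum_of_support_subset (s := s) _
      (fun Q hQ => hsupp Q hQ) _ (by simp), Finset.card_eq_sum_ones, Nat.cast_sum]
    refine Finset.sum_le_sum fun Q hQ => ?_
    have h3 := hlog Q hQ
    have h4 : (1 : ℤ) ≤ placeDeg k Q := by exact_mod_cast placeDeg_pos hF Q
    rw [hDs Q hQ, smul_eq_mul]
    push_cast
    nlinarith
  rw [hcard] at h2
  push_cast at h2
  omega

theorem finite_setOf_valuation_ne_one (hF : IsFunctionField k F) {y : F} (hy0 : y ≠ 0) :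
    {Q : Place F | Q.valuation y ≠ 1}.Finite := by
  by_cases hy : Transcendental k y
  · refine ((finite_setOf_valuation_lt_one hF hy).union
      (finite_setOf_valuation_lt_one hF (transcendental_inv hy))).subset fun Q hQ => ?_
    rcases lt_or_gt_of_ne hQ with h | h
    · exact Or.inl h
    · exact Or.inr ((Valuation.one_lt_val_iff _ hy0).1 h)
  · have h : IsAlgebraic k y := by rwa [Transcendental, not_not] at hy
    convert Set.finite_empty
    ext Q
    simp [Q.valuation_eq_one_of_isAlgebraic k h hy0]

/-- The divisor of poles minus zeros of a nonzero function. -/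
def principalDivisor (hF : IsFunctionField k F) (y : F) (hy0 : y ≠ 0) : Divisor F :=
  Finsupp.ofSupportFinite (fun Q => log (Q.valuation y))
    ((finite_setOf_valuation_ne_one hF hy0).subset fun Q hQ h => by
      rw [Function.mem_support, h, log_one] at hQ
      exact hQ rfl)

theorem principalDivisor_apply (hF : IsFunctionField k F) {y : F} (hy0 : y ≠ 0) (Q : Place F) :
    principalDivisor hF y hy0 Q = log (Q.valuation y) := rfl

/-- The Riemann-Roch space of a divisor. -/
abbrev rrSpace (k : Type*) {F : Type*} [Field k] [Field F] [Algebra k F] [Finite k]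
    (D : Divisor F) : Submodule k F := ball k Set.univ D

/-- A transcendental function has a pole, namely a zero of its inverse. -/
theorem isAlgebraic_of_mem_rrSpace_zero (hF : IsFunctionField k F) {x : F}
    (hx : x ∈ rrSpace k (0 : Divisor F)) : IsAlgebraic k x := by
  by_contra h
  obtain ⟨Q, hQ⟩ := exists_valuation_lt_one hF (transcendental_inv h)
  have h1 : Q.valuation x ≤ 1 := by simpa using hx Q trivial
  rw [← Valuation.one_lt_val_iff _ (Transcendental.ne_zero' h)] at hQ
  exact absurd h1 (not_le.2 hQ)

/-- A function without poles is algebraic over k, and if it also vanishes at Q it is zero. So the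
space of -Q is trivial, and it has finite index in the space of any larger divisor. -/
theorem finite_rrSpace (hF : IsFunctionField k F) (D : Divisor F) : Finite (rrSpace k D) := by
  obtain ⟨Q⟩ := exists_place hF
  set D₀ : Divisor F := -Finsupp.single Q 1 with hD₀
  have hbot : rrSpace k D₀ = ⊥ := by
    rw [eq_bot_iff]
    intro x hx
    have hx0 : x ∈ rrSpace k (0 : Divisor F) :=
      ball_mono (fun R _ => (neg_nonpos.2 (Finsupp.single_nonneg.2 zero_le_one) : D₀ ≤ 0) R) hx
    by_contra hne
    have h1 := Q.valuation_eq_one_of_isAlgebraic k (isAlgebraic_of_mem_rrSpace_zero hF hx0) hne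
    have h2 := hx Q trivial
    rw [h1, hD₀] at h2
    simp only [Finsupp.coe_neg, Pi.neg_apply, Finsupp.single_eq_same] at h2
    exact absurd h2 (not_le.2 exp_neg_one_lt_one)
  have h1 := (relCard_ball_le (S := Set.univ) hF (le_sup_left : D₀ ≤ D₀ ⊔ D)).1
  rw [show ball k Set.univ D₀ = ⊥ from hbot, relCard, Submodule.bot_toAddSubgroup,
    AddSubgroup.relIndex_bot_left] at h1
  have hfin : Finite (rrSpace k (D₀ ⊔ D)) := Nat.finite_of_card_ne_zero h1
  exact Finite.of_injective _ (Submodule.inclusion_injective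
    (ball_mono fun R _ => (le_sup_right : D ≤ D₀ ⊔ D) R : rrSpace k D ≤ rrSpace k (D₀ ⊔ D)))

theorem card_rrSpace_le (hF : IsFunctionField k F) {D D' : Divisor F} (h : D ≤ D') :
    Nat.card (rrSpace k D') ≤
      Nat.card (rrSpace k D) * Nat.card k ^ (Divisor.deg k (D' - D)).toNat := by
  have h1 := (relCard_ball_le (S := Set.univ) hF h).2.1
  have h2 : relCard (⊥ : Submodule k F) (rrSpace k D) * relCard (rrSpace k D) (rrSpace k D') =
    relCard ⊥ (rrSpace k D') := relCard_mul bot_le (ball_mono fun R _ => h R)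
  have hb : ∀ A : Submodule k F, relCard ⊥ A = Nat.card A := fun A => by
    rw [relCard, Submodule.bot_toAddSubgroup, AddSubgroup.relIndex_bot_left]
    rfl
  rw [hb, hb] at h2
  rw [← h2]
  exact Nat.mul_le_mul_left _ h1

theorem card_rrSpace_eq_pow (hF : IsFunctionField k F) (D : Divisor F) :
    Nat.card (rrSpace k D) = Nat.card k ^ Module.finrank k (rrSpace k D) := by
  have := finite_rrSpace hF D
  exact Module.natCard_eq_pow_finrank

/-- The dimension of the Riemann-Roch space. -/
abbrev rrDim (k : Type*) {F : Type*} [Field k] [Field F] [Algebra k F] [Finite k]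
    (D : Divisor F) : ℕ := Module.finrank k (rrSpace k D)

theorem rrDim_le (hF : IsFunctionField k F) {D D' : Divisor F} (h : D ≤ D') :
    (rrDim k D' : ℤ) ≤ rrDim k D + Divisor.deg k (D' - D) := by
  have h1 := card_rrSpace_le hF h
  rw [card_rrSpace_eq_pow hF, card_rrSpace_eq_pow hF, ← pow_add,
    Nat.pow_le_pow_iff_right Finite.one_lt_card] at h1
  have h2 := Divisor.deg_nonneg (k := k) (sub_nonneg.2 h)
  change Module.finrank k (rrSpace k D') ≤
    Module.finrank k (rrSpace k D) + (Divisor.deg k (D' - D)).toNat at h1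
  change (Module.finrank k (rrSpace k D') : ℤ) ≤ Module.finrank k (rrSpace k D) + _
  omega

theorem exists_ne_zero_of_rrDim_pos {D : Divisor F} (h : 0 < rrDim k D) :
    ∃ x ∈ rrSpace k D, x ≠ 0 := by
  have : Nontrivial (rrSpace k D) := Module.nontrivial_of_finrank_pos h
  obtain ⟨x, hx⟩ := exists_ne (0 : rrSpace k D)
  exact ⟨x, x.2, fun h => hx (Subtype.ext h)⟩

/-- Multiplication by z; it adds the divisor of z because poles are counted positively here. -/
theorem rrDim_add_principalDivisor (hF : IsFunctionField k F) (D : Divisor F) {z : F}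
    (hz : z ≠ 0) : rrDim k (D + principalDivisor hF z hz) = rrDim k D := by
  have key : ∀ x, x ∈ rrSpace k D ↔ z * x ∈ rrSpace k (D + principalDivisor hF z hz) := by
    intro x
    refine forall_congr' fun Q => forall_congr' fun _ => ?_
    rw [Finsupp.add_apply, principalDivisor_apply]
    rcases eq_or_ne x 0 with rfl | hx
    · simp
    rw [Q.le_exp_iff hx, Q.le_exp_iff (mul_ne_zero hz hx), Q.log_mul hz hx]
    constructor <;> intro h <;> omega
  have h1 := relCard_map_of_mul (A := ⊥) (A' := ⊥) hz (fun x => by simp [hz]) key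
  have hb : ∀ A : Submodule k F, relCard ⊥ A = Nat.card A := fun A => by
    rw [relCard, Submodule.bot_toAddSubgroup, AddSubgroup.relIndex_bot_left]
    rfl
  rw [hb, hb, card_rrSpace_eq_pow hF, card_rrSpace_eq_pow hF] at h1
  exact (Nat.pow_right_injective Finite.one_lt_card h1).symm

/-- The pole divisor. -/
def poleDivisor (hF : IsFunctionField k F) (y : F) (hy0 : y ≠ 0) : Divisor F :=
  principalDivisor hF y hy0 ⊔ 0

theorem principalDivisor_eq_sub (hF : IsFunctionField k F) {y : F} (hy0 : y ≠ 0) :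
    principalDivisor hF y hy0 = poleDivisor hF y hy0 - poleDivisor hF y⁻¹ (inv_ne_zero hy0) := by
  ext Q
  simp only [poleDivisor, Finsupp.sub_apply, Finsupp.sup_apply, principalDivisor_apply, map_inv₀,
    log_inv, Finsupp.zero_apply]
  omega

/-- Poles of y are zeros of 1/y, and 1/y generates the same field over k. -/
theorem deg_poleDivisor_le (hF : IsFunctionField k F) {y : F} (hy : Transcendental k y)
    (hy0 : y ≠ 0) : Divisor.deg k (poleDivisor hF y hy0) ≤ Module.finrank k⟮y⟯ F := by
  have h := deg_le_finrank hF (transcendental_inv hy) (poleDivisor hF y hy0) (fun Q hQ => ?_)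
    le_sup_right
  · have : k⟮y⁻¹⟯ = k⟮y⟯ := le_antisymm
      (adjoin_simple_le_iff.2 (inv_mem (mem_adjoin_simple_self k y)))
      (adjoin_simple_le_iff.2 (by simpa using inv_mem (mem_adjoin_simple_self k y⁻¹)))
    rwa [this] at h
  · have h1 : principalDivisor hF y hy0 Q ⊔ 0 ≠ 0 := Finsupp.mem_support_iff.1 hQ
    have h2 : poleDivisor hF y hy0 Q = log (Q.valuation y) := by
      change principalDivisor hF y hy0 Q ⊔ 0 = _
      rw [principalDivisor_apply] at h1 ⊢
      omega
    rw [h2, map_inv₀, Q.valuation_eq_exp_log hy0, log_exp, exp_neg]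

/-- There are many functions with poles bounded by multiples of the pole divisor of `y`. -/
theorem exists_le_rrDim (hF : IsFunctionField k F) {y : F} (hy : Transcendental k y)
    (hy0 : y ≠ 0) : ∃ E : Divisor F, 0 ≤ E ∧ ∀ m : ℕ,
      Module.finrank k⟮y⟯ F * (m + 1) ≤ rrDim k (m • poleDivisor hF y hy0 + E) := by
  have := hF.finite y hy
  let b := Module.finBasis k⟮y⟯ F
  -- E absorbs the poles of a basis b_j of F over k(y), so the products y^i b_j with i ≤ m all lie
  -- in the space. They are independent over k.
  let E : Divisor F := ∑ j, poleDivisor hF (b j) (b.ne_zero j)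
  have hE0 : ∀ j, (0 : Divisor F) ≤ poleDivisor hF (b j) (b.ne_zero j) := fun j => le_sup_right
  refine ⟨E, Finset.sum_nonneg fun j _ => hE0 j, fun m => ?_⟩
  have hmem : ∀ x : Fin (Module.finrank k⟮y⟯ F) × Fin (m + 1),
      y ^ (x.2 : ℕ) * b x.1 ∈ rrSpace k (m • poleDivisor hF y hy0 + E) := by
    rintro ⟨j, i⟩ Q -
    have h1 : log (Q.valuation (b j)) ≤ E Q :=
      (le_sup_left : _ ≤ poleDivisor hF (b j) (b.ne_zero j) Q).trans
        (Finset.single_le_sum (f := fun j => poleDivisor hF (b j) (b.ne_zero j))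
          (fun j _ => hE0 j) (Finset.mem_univ j) Q)
    have h2 : log (Q.valuation y) ≤ poleDivisor hF y hy0 Q := le_sup_left
    have h3 : 0 ≤ poleDivisor hF y hy0 Q := le_sup_right
    rw [Q.le_exp_iff (mul_ne_zero (pow_ne_zero _ hy0) (b.ne_zero j)),
      Q.log_mul (pow_ne_zero _ hy0) (b.ne_zero j), map_pow, log_pow, Finsupp.add_apply,
      Finsupp.smul_apply, nsmul_eq_mul, nsmul_eq_mul]
    have h4 : ((i : ℕ) : ℤ) ≤ m := by exact_mod_cast Nat.lt_succ_iff.1 i.2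
    have h5 : (0 : ℤ) ≤ ((i : ℕ) : ℤ) := by positivity
    nlinarith
  have hli : LinearIndependent k fun x : Fin (Module.finrank k⟮y⟯ F) × Fin (m + 1) =>
      (⟨_, hmem x⟩ : rrSpace k (m • poleDivisor hF y hy0 + E)) := by
    refine LinearIndependent.of_comp (rrSpace k (m • poleDivisor hF y hy0 + E)).subtype ?_
    have hpow : LinearIndependent k fun i : Fin (m + 1) => (AdjoinSimple.gen k y) ^ (i : ℕ) := by
      have h1 : LinearIndependent k fun i : ℕ => (AdjoinSimple.gen k y) ^ i := by
        have ht : Transcendental k (AdjoinSimple.gen k y) := fun h =>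
          hy (h.algebraMap (A := F))
        have := (Polynomial.basisMonomials k).linearIndependent.map'
          (Polynomial.aeval (AdjoinSimple.gen k y)).toLinearMap
          (LinearMap.ker_eq_bot.2 (transcendental_iff_injective.1 ht))
        simpa [Function.comp_def] using this
      exact h1.comp _ Fin.val_injective
    have h2 := linearIndependent_smul hpow b.linearIndependent
    have h3 := h2.comp (Prod.swap) Prod.swap_injective
    exact h3
  have := finite_rrSpace hF (m • poleDivisor hF y hy0 + E)
  have h := hli.fintype_card_le_finrank
  simpa using h

end ProductFormula

/-! ### The product formula, Riemann's inequality and finiteness of the class group -/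

section Riemann

open WithZero IntermediateField

variable {k : Type*} {F : Type*} [Field k] [Field F] [Algebra k F] [Finite k]

/-- Growth comparison: the space of mP + E has dimension at least [F : k(y)](m + 1) and at most a
constant plus m deg P. For large m this forces deg P ≥ [F : k(y)]. -/
theorem deg_poleDivisor (hF : IsFunctionField k F) {y : F} (hy : Transcendental k y)
    (hy0 : y ≠ 0) : Divisor.deg k (poleDivisor hF y hy0) = Module.finrank k⟮y⟯ F := by
  refine le_antisymm (deg_poleDivisor_le hF hy hy0) ?_
  obtain ⟨E, hE0, hE⟩ := exists_le_rrDim hF hy hy0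
  by_contra! hlt
  have hP : (0 : Divisor F) ≤ poleDivisor hF y hy0 := le_sup_right
  -- If deg P were at most N - 1, taking m = c would give N + c ≤ c with N positive.
  set c : ℕ := rrDim k (0 : Divisor F) + (Divisor.deg k E).toNat with hc
  have h1 := rrDim_le hF (D := 0) (D' := c • poleDivisor hF y hy0 + E)
    (add_nonneg (nsmul_nonneg hP c) hE0)
  have h2 : ((Module.finrank k⟮y⟯ F * (c + 1) : ℕ) : ℤ) ≤
      (rrDim k (c • poleDivisor hF y hy0 + E) : ℕ) := by exact_mod_cast hE c
  have h3 := Int.self_le_toNat (Divisor.deg k E)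
  rw [sub_zero, map_add, map_nsmul, nsmul_eq_mul] at h1
  push_cast at h2
  have h4 : ((rrDim k (0 : Divisor F) : ℕ) : ℤ) + (Divisor.deg k E).toNat = c := by
    rw [hc]; push_cast; rfl
  have h5 : (0 : ℤ) ≤ c := Nat.cast_nonneg c
  have h6 := Divisor.deg_nonneg (k := k) hP
  nlinarith

/-- The product formula: for transcendental y, zeros and poles both have total degree [F : k(y)]; an
algebraic y has neither. -/
theorem deg_principalDivisor (hF : IsFunctionField k F) {y : F} (hy0 : y ≠ 0) :
    Divisor.deg k (principalDivisor hF y hy0) = 0 := by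
  by_cases hy : Transcendental k y
  · have : k⟮y⁻¹⟯ = k⟮y⟯ := le_antisymm
      (adjoin_simple_le_iff.2 (inv_mem (mem_adjoin_simple_self k y)))
      (adjoin_simple_le_iff.2 (by simpa using inv_mem (mem_adjoin_simple_self k y⁻¹)))
    rw [principalDivisor_eq_sub, map_sub, deg_poleDivisor hF hy, deg_poleDivisor hF
      (transcendental_inv hy), this, sub_self]
  · have h : IsAlgebraic k y := by rwa [Transcendental, not_not] at hy
    have : principalDivisor hF y hy0 = 0 := by
      ext Q
      rw [principalDivisor_apply, Q.valuation_eq_one_of_isAlgebraic k h hy0, log_one]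
      rfl
    rw [this, map_zero]

/-- Riemann's inequality. -/
theorem exists_deg_sub_le_rrDim (hF : IsFunctionField k F) :
    ∃ C : ℤ, ∀ D : Divisor F, Divisor.deg k D - C ≤ rrDim k D := by
  obtain ⟨y, hy⟩ := hF.exists_transcendental
  have hy0 := Transcendental.ne_zero' hy
  have := hF.finite y hy
  obtain ⟨E, hE0, hE⟩ := exists_le_rrDim hF hy hy0
  set P := poleDivisor hF y hy0 with hP
  set N := Module.finrank k⟮y⟯ F with hN
  have hN1 : (1 : ℤ) ≤ N := by exact_mod_cast (Module.finrank_pos : 0 < Module.finrank k⟮y⟯ F)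
  have hdeg : ∀ m : ℕ, Divisor.deg k (m • P + E) = m * N + Divisor.deg k E := fun m => by
    rw [map_add, map_nsmul, deg_poleDivisor hF hy hy0, nsmul_eq_mul]
  have hE' : ∀ m : ℕ, (N : ℤ) * (m + 1) ≤ rrDim k (m • P + E) := fun m => by
    exact_mod_cast hE m
  refine ⟨Divisor.deg k E - N, fun D => ?_⟩
  have hD1 : (0 : Divisor F) ≤ D ⊔ 0 := le_sup_right
  suffices h : Divisor.deg k (D ⊔ 0) - (Divisor.deg k E - N) ≤ rrDim k (D ⊔ 0) by
    have h1 := rrDim_le hF (le_sup_left : D ≤ D ⊔ 0)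
    rw [map_sub] at h1
    linarith
  set D₁ := D ⊔ 0
  -- With m = deg D₁ the space of mP + E - D₁ has dimension at least N(m + 1) - m > 0. A nonzero z
  -- in it moves D₁ below mP + E, where the dimension is known to be large.
  set m := (Divisor.deg k D₁).toNat with hm
  have hm' : (m : ℤ) = Divisor.deg k D₁ := Int.toNat_of_nonneg (Divisor.deg_nonneg hD1)
  have h1 := rrDim_le hF (sub_le_self (m • P + E) hD1)
  rw [sub_sub_cancel] at h1
  have h2 := hE' m
  have hpos : 0 < rrDim k (m • P + E - D₁) := by
    have : (0 : ℤ) < rrDim k (m • P + E - D₁) := by nlinarith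
    exact_mod_cast this
  obtain ⟨z, hz, hz0⟩ := exists_ne_zero_of_rrDim_pos hpos
  have hle : D₁ + principalDivisor hF z hz0 ≤ m • P + E := by
    rw [add_comm, ← le_sub_iff_add_le]
    intro Q
    rw [principalDivisor_apply, ← Q.le_exp_iff hz0]
    exact hz Q trivial
  have h3 := rrDim_le hF hle
  rw [rrDim_add_principalDivisor, map_sub, map_add (Divisor.deg k) D₁, deg_principalDivisor,
    hdeg] at h3
  linarith

/-- Fix y transcendental. At a place of degree at most d that is not a pole of y, two of the first
q^d + 1 powers of y agree in the residue field, so the place is a zero of one of finitely many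
nonzero functions y^i - y^j. -/
theorem finite_setOf_placeDeg_le (hF : IsFunctionField k F) (d : ℕ) :
    {Q : Place F | placeDeg k Q ≤ d}.Finite := by
  obtain ⟨y, hy⟩ := hF.exists_transcendental
  have hy0 := Transcendental.ne_zero' hy
  have hne : ∀ i j : ℕ, i < j → y ^ i - y ^ j ≠ 0 := by
    intro i j hij h
    have h1 : y ^ (j - i) = 1 := by
      have : y ^ i * y ^ (j - i) = y ^ i * 1 := by
        rw [← pow_add, Nat.add_sub_cancel' hij.le, mul_one]
        exact (sub_eq_zero.1 h).symm
      exact mul_left_cancel₀ (pow_ne_zero _ hy0) this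
    have h2 : Transcendental k (y ^ (j - i)) := hy.pow (by omega)
    rw [h1] at h2
    exact h2 isAlgebraic_one
  refine ((finite_setOf_valuation_ne_one hF hy0).union
    (Set.Finite.biUnion (Set.finite_Iic (Nat.card k ^ d)) fun j _ =>
      Set.Finite.biUnion (Set.finite_Iio j) fun i (hi : i < j) =>
        finite_setOf_valuation_ne_one hF (hne i j hi))).subset fun Q hQ => ?_
  by_cases hyQ : Q.valuation y ≤ 1
  swap
  · exact Or.inl fun h => hyQ h.le
  refine Or.inr ?_
  let M := ball k {Q} 0 ⧸ (ball k {Q} fun _ => -1).submoduleOf (ball k {Q} 0)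
  have hcard : Nat.card M = Nat.card k ^ placeDeg k Q := residueCard_eq_pow hF Q
  have : Finite M := Nat.finite_of_card_ne_zero (by
    rw [hcard]; exact pow_ne_zero _ Nat.card_pos.ne')
  have hmem : ∀ i : ℕ, y ^ i ∈ ball k {Q} 0 := fun i R hR => by
    rw [Set.mem_singleton_iff.1 hR, map_pow]
    exact pow_le_one' (by simpa using hyQ) i
  let f : Fin (Nat.card k ^ d + 1) → M := fun i => Submodule.Quotient.mk ⟨_, hmem i⟩
  have hninj : ¬ Function.Injective f := fun hinj => by
    have h1 := Nat.card_le_card_of_injective f hinj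
    rw [hcard, Nat.card_fin] at h1
    have h2 := Nat.pow_le_pow_right (n := Nat.card k) Nat.card_pos hQ
    omega
  have key : ∀ i j : Fin (Nat.card k ^ d + 1), i < j → f i = f j →
      Q ∈ ⋃ j ∈ Set.Iic (Nat.card k ^ d), ⋃ i ∈ Set.Iio j, {Q | Q.valuation (y ^ i - y ^ j) ≠ 1} := by
    intro i j hij h
    refine Set.mem_biUnion (x := (j : ℕ)) (Nat.lt_succ_iff.1 j.2)
      (Set.mem_biUnion (x := (i : ℕ)) hij ?_)
    have h1 := (Submodule.Quotient.eq _).1 h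
    have h2 : Q.valuation (y ^ (i : ℕ) - y ^ (j : ℕ)) ≤ exp (-1) := h1 Q rfl
    exact (lt_one_iff_le_exp.2 h2).ne
  rw [Function.Injective] at hninj
  push Not at hninj
  obtain ⟨i, j, h, hij⟩ := hninj
  rcases lt_or_gt_of_ne hij with hij | hij
  · exact key i j hij h
  · exact key j i hij h.symm

/-- The support consists of places of degree at most d, of which there are finitely many, and each
multiplicity lies between 0 and d. -/
theorem finite_setOf_effective (hF : IsFunctionField k F) (d : ℤ) :
    {D : Divisor F | 0 ≤ D ∧ Divisor.deg k D = d}.Finite := by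
  classical
  have hfin := finite_setOf_placeDeg_le hF d.toNat
  refine (Finset.finite_toSet (hfin.toFinset.finsupp fun _ => Finset.Icc 0 d)).subset ?_
  rintro D ⟨hD, hd⟩
  have key : ∀ Q ∈ D.support, D Q ≤ d ∧ placeDeg k Q ≤ d.toNat := by
    intro Q hQ
    have h0 : D Q ≠ 0 := Finsupp.mem_support_iff.1 hQ
    have h1 : 0 ≤ D Q := hD Q
    have h2 : D Q * placeDeg k Q ≤ d := by
      rw [← Divisor.deg_single, ← hd]
      refine Divisor.deg_mono fun R => ?_
      rcases eq_or_ne R Q with rfl | hR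
      · simp
      · rw [Finsupp.single_eq_of_ne hR]
        exact hD R
    have h3 : (1 : ℤ) ≤ placeDeg k Q := by exact_mod_cast placeDeg_pos hF Q
    have h4 : 1 ≤ D Q := by omega
    refine ⟨by nlinarith, ?_⟩
    have : (placeDeg k Q : ℤ) ≤ d := by nlinarith
    omega
  refine Finset.mem_coe.2 (Finset.mem_finsupp_iff.2 ⟨fun Q hQ => ?_, fun Q _ => ?_⟩)
  · exact hfin.mem_toFinset.2 (key Q hQ).2
  · have hd0 : 0 ≤ d := hd ▸ Divisor.deg_nonneg hD
    refine Finset.mem_Icc.2 ⟨hD Q, ?_⟩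
    by_cases hQ : Q ∈ D.support
    · exact (key Q hQ).1
    · rwa [Finsupp.notMem_support_iff.1 hQ]

/-- The group of divisor classes of degree zero is finite. -/
theorem exists_finite_classes (hF : IsFunctionField k F) :
    ∃ R : Set (Divisor F), R.Finite ∧ ∀ D : Divisor F, Divisor.deg k D = 0 →
      ∃ r ∈ R, ∃ (z : F) (hz : z ≠ 0), D = r + principalDivisor hF z hz := by
  obtain ⟨C, hC⟩ := exists_deg_sub_le_rrDim hF
  obtain ⟨Q⟩ := exists_place hF
  -- By Riemann's inequality this m makes the space of D + mQ nonzero for every D of degree zero. So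
  -- D + mQ is equivalent to an effective divisor of the fixed degree m deg Q.
  set m : ℕ := C.toNat + 1 with hm
  have hdeg : Divisor.deg k (Finsupp.single Q (m : ℤ)) = m * placeDeg k Q := Divisor.deg_single Q m
  refine ⟨(fun D => D - Finsupp.single Q (m : ℤ)) ''
    {D : Divisor F | 0 ≤ D ∧ Divisor.deg k D = m * placeDeg k Q},
    (finite_setOf_effective hF _).image _, fun D hD => ?_⟩
  have hpos : 0 < rrDim k (D + Finsupp.single Q (m : ℤ)) := by
    have h1 := hC (D + Finsupp.single Q (m : ℤ))
    rw [map_add, hD, zero_add, hdeg] at h1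
    have h3 : (1 : ℤ) ≤ placeDeg k Q := by exact_mod_cast placeDeg_pos hF Q
    have h4 := Int.self_le_toNat C
    have h5 : (m : ℤ) = C.toNat + 1 := by rw [hm]; push_cast; rfl
    have : (0 : ℤ) < rrDim k (D + Finsupp.single Q (m : ℤ)) := by nlinarith
    exact_mod_cast this
  obtain ⟨z, hz, hz0⟩ := exists_ne_zero_of_rrDim_pos hpos
  refine ⟨_, ⟨D + Finsupp.single Q (m : ℤ) - principalDivisor hF z hz0, ⟨?_, ?_⟩, rfl⟩, z, hz0, ?_⟩
  · rw [sub_nonneg]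
    intro R
    rw [principalDivisor_apply, ← R.le_exp_iff hz0]
    exact hz R trivial
  · rw [map_sub, map_add, hD, hdeg, deg_principalDivisor]
    ring
  · simp only
    abel

end Riemann

/-! ### Finite extensions of the rational function field -/

section FunctionField

open Algebra IntermediateField algebraAdjoinAdjoin Cardinal

/-- The transcendence degree is 1, so any transcendental x is a transcendence basis. F is then
algebraic over k(x) and finitely generated as a field, hence finite. -/
theorem isFunctionField_of_ratFunc (k F : Type*) [Field k] [Field F] [Algebra k F]
    [Algebra (RatFunc k) F] [IsScalarTower k (RatFunc k) F] [FiniteDimensional (RatFunc k) F] :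
    IsFunctionField k F := by
  have h1 : Algebra.trdeg k (RatFunc k) = 1 := by
    have := trdeg_add_eq k (Polynomial k) (A := RatFunc k)
    have halg : Algebra.IsAlgebraic (Polynomial k) (RatFunc k) :=
      IsLocalization.isAlgebraic _ (nonZeroDivisors (Polynomial k))
    rwa [Polynomial.trdeg_of_isDomain, trdeg_eq_zero, add_zero, eq_comm] at this
  have h2 : Algebra.trdeg k F = 1 := by
    have := lift_trdeg_add_eq k (RatFunc k) F
    rw [h1, trdeg_eq_zero, Cardinal.lift_one, Cardinal.lift_zero, add_zero,
      eq_comm, Cardinal.lift_eq_one] at this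
    exact this
  refine ⟨?_, fun x hx => ?_⟩
  · by_contra! hc
    have halg : Algebra.IsAlgebraic k F := ⟨fun x => by
      have := hc x
      rwa [Transcendental, not_not] at this⟩
    rw [trdeg_eq_zero] at h2
    exact zero_ne_one h2
  · have hind : AlgebraicIndependent k (fun _ : Unit => x) := by
      rwa [algebraicIndependent_unique_type_iff]
    have hb := hind.isTranscendenceBasis_of_lift_trdeg_le_of_finite (by rw [h2]; simp)
    have halg := hb.isAlgebraic
    rw [Set.range_const] at halg
    have halg' : Algebra.IsAlgebraic k⟮x⟯ F :=
      Algebra.IsAlgebraic.extendScalars (R := Algebra.adjoin k {x}) (FaithfulSMul.algebraMap_injective _ _)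
    have e1 : Algebra.EssFiniteType k (RatFunc k) :=
      have := Algebra.EssFiniteType.of_isLocalization (R := Polynomial k) (S := RatFunc k)
        (nonZeroDivisors (Polynomial k))
      Algebra.EssFiniteType.comp k (Polynomial k) (RatFunc k)
    have e2 : Algebra.EssFiniteType k F := Algebra.EssFiniteType.comp k (RatFunc k) F
    have e3 : Algebra.EssFiniteType k⟮x⟯ F := Algebra.EssFiniteType.of_comp k k⟮x⟯ F
    exact Algebra.finite_of_essFiniteType_of_isAlgebraic

end FunctionField

/-! ### Completions at a place: density and convergent power series -/

section Completion

open WithZero Filter Topology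

variable {K L : Type*} [Field K] [Field L]

theorem Place.valued_embedding (P : Place K) (x : K) :
    (Valued.v (P.embedding x) : ℤᵐ⁰) = P.valuation x :=
  Valued.valuedCompletion_apply _

theorem Place.closedBall_mem_nhds (P : Place K) (x : P.Completion) (m : ℤ) :
    {y : P.Completion | (Valued.v (y - x) : ℤᵐ⁰) ≤ exp m} ∈ 𝓝 x := by
  obtain ⟨z, hz0, hz⟩ := P.exists_valuation_eq_exp m
  have hne : (Valued.v.restrict (P.embedding z)) ≠ 0 := by
    rw [Ne, Valuation.restrict_eq_zero_iff, P.valued_embedding, hz]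
    exact exp_ne_zero
  refine Valued.mem_nhds.2 ⟨Units.mk0 _ hne, fun y hy => ?_⟩
  have h1 : (Valued.v (y - x) : ℤᵐ⁰) < Valued.v (P.embedding z) := Valued.v.restrict_lt_iff.1 hy
  rw [P.valued_embedding, hz] at h1
  exact h1.le

theorem Place.exists_embedding_mem (P : Place K) {x : P.Completion} {s : Set P.Completion}
    (hs : s ∈ 𝓝 x) : ∃ y : K, P.embedding y ∈ s := by
  obtain ⟨_, ⟨y, rfl⟩, hs'⟩ :=
    (UniformSpace.Completion.denseRange_coe (α := WithVal P.valuation)).inter_nhds_nonempty hs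
  exact ⟨y.ofVal, hs'⟩

theorem Place.exists_embedding_sub_le (P : Place K) (x : P.Completion) (m : ℤ) :
    ∃ y : K, (Valued.v (P.embedding y - x) : ℤᵐ⁰) ≤ exp m :=
  P.exists_embedding_mem (P.closedBall_mem_nhds x m)

theorem Place.Over.continuous_map {f : K →+* L} {P : Place K} {Q : Place L} (h : P.Over f Q) :
    Continuous h.map :=
  UniformSpace.Completion.continuous_map

/-- K is dense in its completion and values are locally constant away from 0. So comparisons of
values in the completion reduce to those in K. -/
theorem Place.Over.exists_valued_eq {f : K →+* L} {P : Place K} {Q : Place L} (h : P.Over f Q)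
    (x : P.Completion) : ∃ y : K, (Valued.v x : ℤᵐ⁰) = P.valuation y ∧
      (Valued.v (h.map x) : ℤᵐ⁰) = Q.valuation (f y) := by
  rcases eq_or_ne x 0 with rfl | hx
  · exact ⟨0, by simp⟩
  have hx' : h.map x ≠ 0 := by simpa using hx
  have h1 := Valued.locally_const (Valued.v.ne_zero_iff.2 hx)
  have h2 := h.continuous_map.continuousAt.preimage_mem_nhds
    (Valued.locally_const (Valued.v.ne_zero_iff.2 hx'))
  obtain ⟨y, hy1, hy2⟩ := P.exists_embedding_mem (Filter.inter_mem h1 h2)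
  refine ⟨y, ?_, ?_⟩
  · rw [← hy1.out, P.valued_embedding]
  · rw [← (show _ = _ from hy2), h.map_embedding, Q.valued_embedding]

theorem Place.Over.valued_map_le_iff {f : K →+* L} {P : Place K} {Q : Place L} (h : P.Over f Q)
    {x y : P.Completion} : (Valued.v (h.map x) : ℤᵐ⁰) ≤ Valued.v (h.map y) ↔
      (Valued.v x : ℤᵐ⁰) ≤ Valued.v y := by
  obtain ⟨a, ha, ha'⟩ := h.exists_valued_eq x
  obtain ⟨b, hb, hb'⟩ := h.exists_valued_eq y
  rw [ha, ha', hb, hb']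
  exact (h a b).symm

theorem Place.Over.valued_map_le_one_iff {f : K →+* L} {P : Place K} {Q : Place L}
    (h : P.Over f Q) {x : P.Completion} : (Valued.v (h.map x) : ℤᵐ⁰) ≤ 1 ↔
      (Valued.v x : ℤᵐ⁰) ≤ 1 := by
  simpa using h.valued_map_le_iff (x := x) (y := 1)

theorem Place.Over.valued_map_eq_one_iff {f : K →+* L} {P : Place K} {Q : Place L}
    (h : P.Over f Q) {x : P.Completion} : (Valued.v (h.map x) : ℤᵐ⁰) = 1 ↔
      (Valued.v x : ℤᵐ⁰) = 1 := by
  have h1 := h.valued_map_le_iff (x := x) (y := 1)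
  have h2 := h.valued_map_le_iff (x := 1) (y := x)
  simp only [map_one] at h1 h2
  rw [le_antisymm_iff, le_antisymm_iff, h1, h2]

theorem Place.nonarchimedeanAddGroup (P : Place K) : NonarchimedeanAddGroup P.Completion where
  is_nonarchimedean U hU := by
    obtain ⟨γ, hγ⟩ := Valued.mem_nhds_zero.1 hU
    exact ⟨⟨Valued.v.restrict.ltAddSubgroup γ, Valued.isOpen_ball _ _⟩, hγ⟩

/-- Convergence of power series in an element of value less than one. -/
theorem Place.exists_sum_pow_mul (P : Place K) {π : P.Completion}
    (hπ : (Valued.v π : ℤᵐ⁰) < 1) (c : ℕ → P.Completion) (hc : ∀ i, (Valued.v (c i) : ℤᵐ⁰) ≤ 1) :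
    ∃ s : P.Completion, ∀ k, (Valued.v (s - ∑ i ∈ Finset.range k, π ^ i * c i) : ℤᵐ⁰) ≤
      (Valued.v π : ℤᵐ⁰) ^ k := by
  have hterm : ∀ i, (Valued.v (π ^ i * c i) : ℤᵐ⁰) ≤ (Valued.v π : ℤᵐ⁰) ^ i := fun i => by
    rw [map_mul, map_pow]
    exact mul_le_of_le_one_right' (hc i)
  have hdiff : ∀ j k, k ≤ j → (Valued.v (∑ i ∈ Finset.range j, π ^ i * c i -
      ∑ i ∈ Finset.range k, π ^ i * c i) : ℤᵐ⁰) ≤ (Valued.v π : ℤᵐ⁰) ^ k := by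
    intro j k hkj
    rw [← Finset.sum_Ico_eq_sub _ hkj]
    refine Valuation.map_sum_le _ fun i hi => (hterm i).trans ?_
    exact pow_le_pow_right_of_le_one' hπ.le (Finset.mem_Ico.1 hi).1
  have htend : Tendsto (fun i => π ^ i * c i) cofinite (𝓝 0) := by
    rw [Nat.cofinite_eq_atTop, tendsto_def]
    intro s hs
    obtain ⟨γ, hγ⟩ := Valued.mem_nhds_zero.1 hs
    have hγ0 : MonoidWithZeroHom.ValueGroup₀.embedding
      (γ : MonoidWithZeroHom.ValueGroup₀ (.ofClass (Valued.v (R := P.Completion)))) ≠ 0 := by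
      simp
    obtain ⟨n, hn⟩ := exists_pow_lt₀ hπ (Units.mk0 _ hγ0)
    filter_upwards [eventually_ge_atTop n] with i hi
    refine hγ ?_
    rw [Set.mem_ofPred_eq, Valuation.restrict_lt_iff_lt_embedding]
    exact ((hterm i).trans (pow_le_pow_right_of_le_one' hπ.le hi)).trans_lt hn
  have := P.nonarchimedeanAddGroup
  have hsum := NonarchimedeanAddGroup.summable_of_tendsto_cofinite_zero htend
  refine ⟨∑' i, π ^ i * c i, fun k => ?_⟩
  -- For π = 0 the closed ball of radius v(π)^k is not a neighbourhood once k > 0, so this case is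
  -- computed directly. Otherwise late partial sums lie both near the limit and within v(π)^k of the
  -- k-th one.
  rcases eq_or_ne π 0 with rfl | hπ0
  · rcases Nat.eq_zero_or_pos k with rfl | hk
    · rw [tsum_eq_single 0 fun i hi => by simp [zero_pow hi]]
      simpa using hc 0
    · rw [tsum_eq_single 0 fun i hi => by simp [zero_pow hi],
        Finset.sum_eq_single 0 (fun i _ hi => by simp [zero_pow hi]) fun h =>
          (h (Finset.mem_range.2 hk)).elim]
      simp
  have hv : (Valued.v π : ℤᵐ⁰) ^ k = exp (log ((Valued.v π : ℤᵐ⁰) ^ k)) :=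
    (exp_log (pow_ne_zero _ (Valued.v.ne_zero_iff.2 hπ0))).symm
  have h1 := hsum.hasSum.tendsto_sum_nat.eventually
    (P.closedBall_mem_nhds _ (log ((Valued.v π : ℤᵐ⁰) ^ k)))
  obtain ⟨j, hj1, hj2⟩ := (h1.and (eventually_ge_atTop k)).exists
  rw [← hv, Valuation.map_sub_swap] at hj1
  have := Valuation.map_add_le _ hj1 (hdiff j k hj2)
  rwa [sub_add_sub_cancel] at this

end Completion

/-! ### Norm and augmentation of a finite group -/

section GroupModules

variable {G B C : Type*} [Group G] [Finite G] [CommGroup B] [MulDistribMulAction G B]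
  [CommGroup C] [MulDistribMulAction G C]

theorem groupNorm_apply [Fintype G] (x : B) : groupNorm G B x = ∏ τ : G, τ • x :=
  finprod_eq_prod_of_fintype _

omit [Finite G] in
theorem augmentation_apply (σ : G) (x : B) : augmentation B σ x = σ • x / x := rfl

theorem smul_groupNorm (τ : G) (x : B) : τ • groupNorm G B x = groupNorm G B x := by
  have := Fintype.ofFinite G
  rw [groupNorm_apply, Finset.smul_prod']
  simp only [smul_smul]
  exact Equiv.prod_comp (Equiv.mulLeft τ) (fun ρ : G => ρ • x)

theorem groupNorm_smul (τ : G) (x : B) : groupNorm G B (τ • x) = groupNorm G B x := by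
  have := Fintype.ofFinite G
  rw [groupNorm_apply, groupNorm_apply]
  simp only [smul_smul]
  exact Equiv.prod_comp (Equiv.mulRight τ) (fun ρ : G => ρ • x)

theorem augmentation_groupNorm (σ : G) (x : B) : augmentation B σ (groupNorm G B x) = 1 := by
  rw [augmentation_apply, smul_groupNorm, div_self']

theorem groupNorm_augmentation (σ : G) (x : B) : groupNorm G B (augmentation B σ x) = 1 := by
  rw [augmentation_apply, map_div, groupNorm_smul, div_self']

omit [Finite G] in
theorem augmentation_eq_one_iff {σ : G} (hσ : ∀ τ : G, τ ∈ Subgroup.zpowers σ) {x : B} :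
    augmentation B σ x = 1 ↔ ∀ τ : G, τ • x = x := by
  rw [augmentation_apply, div_eq_one]
  refine ⟨fun h τ => ?_, fun h => h σ⟩
  have : Subgroup.zpowers σ ≤ MulAction.stabilizer G x :=
    (Subgroup.zpowers_le).2 (MulAction.mem_stabilizer_iff.2 h)
  exact MulAction.mem_stabilizer_iff.1 (this (hσ τ))

theorem map_groupNorm (g : B →* C) (hg : ∀ (τ : G) (x : B), g (τ • x) = τ • g x) (x : B) :
    g (groupNorm G B x) = groupNorm G C (g x) := by
  have := Fintype.ofFinite G
  rw [groupNorm_apply, groupNorm_apply, map_prod]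
  exact Finset.prod_congr rfl fun τ _ => hg τ x

omit [Finite G] in
theorem map_augmentation (g : B →* C) (hg : ∀ (τ : G) (x : B), g (τ • x) = τ • g x) (σ : G)
    (x : B) : g (augmentation B σ x) = augmentation C σ (g x) := by
  rw [augmentation_apply, augmentation_apply, map_div, hg]

theorem groupNorm_mem {X : Subgroup B} (hX : ∀ (τ : G), ∀ x ∈ X, τ • x ∈ X) {x : B} (hx : x ∈ X) :
    groupNorm G B x ∈ X := by
  have := Fintype.ofFinite G
  rw [groupNorm_apply]
  exact prod_mem fun τ _ => hX τ x hx

end GroupModules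

/-! ### Units congruent to 1 modulo an acyclic lattice -/

section LatticeUnits

attribute [local instance] Units.mulDistribMulActionRight

variable {A G : Type*} [CommRing A] [Group G] [Fintype G] [MulSemiringAction G A]

/-- The twisted trace of an element of norm `1` under a finite cyclic group. -/
theorem exists_twisted_trace {σ : G} (hσ : ∀ τ : G, τ ∈ Subgroup.zpowers σ) {u : A}
    (hu : ∏ τ : G, τ • u = 1) : ∃ f : ℕ → A, f 0 = 1 ∧ ∀ a,
      u * σ • ∑ i ∈ Finset.range (orderOf σ), f i * σ ^ i • a =
        ∑ i ∈ Finset.range (orderOf σ), f i * σ ^ i • a := by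
  -- The cocycle u · σu ⋯ σ^(i-1)u. Applying σ and multiplying by u shifts it by one, and norm 1
  -- closes the cycle at i = ord σ, so the sum is only permuted.
  let f : ℕ → A := fun i => ∏ j ∈ Finset.range i, σ ^ j • u
  have hf : ∀ i, u * σ • f i = f (i + 1) := fun i => by
    simp only [f, Finset.smul_prod', smul_smul, ← pow_succ']
    rw [Finset.prod_range_succ', pow_zero, one_smul, mul_comm]
  have hfn : f (orderOf σ) = 1 := by
    rw [← hu]
    refine Finset.prod_bij (fun i _ => σ ^ i) (fun _ _ => Finset.mem_univ _) ?_ ?_ fun _ _ => rfl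
    · intro i hi j hj hij
      exact pow_injOn_Iio_orderOf (Finset.mem_range.1 hi) (Finset.mem_range.1 hj) hij
    · intro τ _
      obtain ⟨i, hi⟩ := mem_powers_iff_mem_zpowers.2 (hσ τ)
      exact ⟨i % orderOf σ, Finset.mem_range.2 (Nat.mod_lt _ (orderOf_pos σ)),
        (pow_mod_orderOf σ i).trans hi⟩
  refine ⟨f, Finset.prod_range_zero _, fun a => ?_⟩
  rw [Finset.smul_sum, Finset.mul_sum]
  have h1 : ∀ i, u * σ • (f i * σ ^ i • a) = f (i + 1) * σ ^ (i + 1) • a := fun i => by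
    rw [smul_mul', ← hf, smul_smul, ← pow_succ', mul_assoc]
  simp only [h1]
  have h2 := Finset.sum_range_succ (fun i => f i * σ ^ i • a) (orderOf σ)
  rw [Finset.sum_range_succ', hfn, pow_orderOf_eq_one, pow_zero,
    show f 0 = 1 from Finset.prod_range_zero _] at h2
  exact add_right_cancel h2

/-- A multiplicatively closed, `π`-adically complete lattice `M` in a ring with an action of a
finite cyclic group, whose additive Tate cohomology vanishes. -/
structure TateAcyclicLattice (σ : G) (π : A) (M : AddSubgroup A) : Prop where
  mul_mem : ∀ x ∈ M, ∀ y ∈ M, x * y ∈ M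
  smul_mem : ∀ τ : G, ∀ x ∈ M, τ • x ∈ M
  mul_left_mem : ∀ x ∈ M, π * x ∈ M
  smul_eq : ∀ τ : G, τ • π = π
  cancel : ∀ x, π * x = 0 → x = 0
  exists_trace : ∀ x ∈ M, (∀ τ : G, τ • x = x) → ∃ y ∈ M, ∑ τ : G, τ • y = x
  exists_sub : ∀ x ∈ M, ∑ τ : G, τ • x = 0 → ∃ y ∈ M, σ • y - y = x
  exists_unit : ∀ x ∈ M, ∃ u : Aˣ, (u : A) = 1 + π * x ∧ ∀ y ∈ M, (↑u⁻¹ : A) * y ∈ M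
  complete : ∀ c : ℕ → A, (∀ i, c i ∈ M) →
    ∃ s ∈ M, ∀ k, ∃ y ∈ M, s - ∑ i ∈ Finset.range k, π ^ i * c i = π ^ k * y
  separated : ∀ x, (∀ k : ℕ, ∃ y ∈ M, x = π ^ k * y) → x = 0

namespace TateAcyclicLattice

variable {σ : G} {π : A} {M : AddSubgroup A}

theorem unit_mul_mem {u : Aˣ} {x y : A} (h : TateAcyclicLattice σ π M) (hx : x ∈ M)
    (hu : (u : A) = 1 + π * x) (hy : y ∈ M) : (u : A) * y ∈ M := by
  rw [hu, add_mul, one_mul, mul_assoc]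
  exact add_mem hy (h.mul_left_mem _ (h.mul_mem _ hx _ hy))

theorem inv_mul_mem {u : Aˣ} {x y : A} (h : TateAcyclicLattice σ π M) (hx : x ∈ M)
    (hu : (u : A) = 1 + π * x) (hy : y ∈ M) : (↑u⁻¹ : A) * y ∈ M := by
  obtain ⟨w, hw, hw'⟩ := h.exists_unit x hx
  obtain rfl : w = u := Units.ext (hw.trans hu.symm)
  exact hw' y hy

theorem pow_mul_mem (h : TateAcyclicLattice σ π M) (k : ℕ) {x : A} (hx : x ∈ M) :
    π ^ k * x ∈ M := by
  induction k with
  | zero => simpa using hx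
  | succ k ih => rw [pow_succ', mul_assoc]; exact h.mul_left_mem _ ih

theorem smul_pow (h : TateAcyclicLattice σ π M) (τ : G) (k : ℕ) : τ • π ^ k = π ^ k := by
  rw [smul_pow', h.smul_eq]

theorem pow_cancel (h : TateAcyclicLattice σ π M) (k : ℕ) {x y : A} (hx : π ^ k * x = π ^ k * y) :
    x = y := by
  induction k with
  | zero => simpa using hx
  | succ k ih =>
    refine ih (sub_eq_zero.1 (h.cancel _ ?_))
    rw [mul_sub, ← mul_assoc, ← mul_assoc, ← pow_succ', hx, sub_self]

/-- The group of units congruent to `1` modulo `π ^ (k + 1) M`. -/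
def units (h : TateAcyclicLattice σ π M) (k : ℕ) : Subgroup Aˣ where
  carrier := {u | ∃ x ∈ M, (u : A) = 1 + π ^ (k + 1) * x}
  one_mem' := ⟨0, zero_mem _, by simp⟩
  mul_mem' := by
    rintro u w ⟨x, hx, hu⟩ ⟨y, hy, hw⟩
    refine ⟨x + y + π ^ (k + 1) * (x * y),
      add_mem (add_mem hx hy) (h.pow_mul_mem _ (h.mul_mem _ hx _ hy)), ?_⟩
    rw [Units.val_mul, hu, hw]
    ring
  inv_mem' := by
    rintro u ⟨x, hx, hu⟩
    refine ⟨-((↑u⁻¹ : A) * x), neg_mem (h.inv_mul_mem (h.pow_mul_mem k hx)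
      (hu.trans (by rw [pow_succ', mul_assoc])) hx), ?_⟩
    have h1 : (↑u⁻¹ : A) * (1 + π ^ (k + 1) * x) = 1 := by rw [← hu, Units.inv_mul]
    linear_combination h1

theorem mem_units_zero {h : TateAcyclicLattice σ π M} {u : Aˣ} :
    u ∈ h.units 0 ↔ ∃ x ∈ M, (u : A) = 1 + π * x := by
  simp [units]

theorem units_le_zero (h : TateAcyclicLattice σ π M) (k : ℕ) : h.units k ≤ h.units 0 := by
  rintro u ⟨x, hx, hu⟩
  exact mem_units_zero.2 ⟨_, h.pow_mul_mem k hx, hu.trans (by rw [pow_succ', mul_assoc])⟩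

theorem units_mul_mem (h : TateAcyclicLattice σ π M) {u : Aˣ} {k : ℕ} (hu : u ∈ h.units k) {y : A}
    (hy : y ∈ M) : (u : A) * y ∈ M := by
  obtain ⟨x, hx, hu⟩ := mem_units_zero.1 (h.units_le_zero k hu)
  exact h.unit_mul_mem hx hu hy

theorem div_mem_units (h : TateAcyclicLattice σ π M) {u w : Aˣ} {j k : ℕ} (hw : w ∈ h.units j)
    {x : A} (hx : x ∈ M) (hu : (u : A) - w = π ^ (k + 1) * x) : u / w ∈ h.units k := by
  refine ⟨(↑w⁻¹ : A) * x, h.units_mul_mem (inv_mem hw) hx, ?_⟩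
  have h1 : (w : A) * (↑w⁻¹ : A) = 1 := w.mul_inv
  rw [div_eq_mul_inv, Units.val_mul]
  linear_combination (↑w⁻¹ : A) * hu + h1

theorem smul_mem_units (h : TateAcyclicLattice σ π M) {u : Aˣ} {k : ℕ} (hu : u ∈ h.units k)
    (τ : G) : τ • u ∈ h.units k := by
  obtain ⟨x, hx, hu⟩ := hu
  refine ⟨τ • x, h.smul_mem _ _ hx, ?_⟩
  rw [Units.coe_smul, hu, smul_add, smul_one, smul_mul', h.smul_pow]

/-- A partial product of factors 1 + π^(i+1) y_i equals 1 + π ∑ π^i p_i y_i, with p_i the product of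
the earlier factors. Convergence of the product is thus completeness of M for sums. -/
theorem complete_units (h : TateAcyclicLattice σ π M) (w : ℕ → Aˣ) (hw : ∀ k, w k ∈ h.units k) :
    ∃ x ∈ h.units 0, ∀ k, x / ∏ i ∈ Finset.range k, w i ∈ h.units k := by
  have hp : ∀ k, ∏ i ∈ Finset.range k, w i ∈ h.units 0 := fun k =>
    prod_mem fun i _ => h.units_le_zero i (hw i)
  choose y hy hwy using hw
  have hsum : ∀ k, ((∏ i ∈ Finset.range k, w i : Aˣ) : A) =
      1 + π * ∑ i ∈ Finset.range k, π ^ i * ((∏ j ∈ Finset.range i, w j : Aˣ) * y i) := by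
    intro k
    induction k with
    | zero => simp
    | succ k ih =>
      rw [Finset.prod_range_succ, Units.val_mul, hwy, mul_add, mul_one,
        Finset.sum_range_succ, mul_add, ← add_assoc, ← ih]
      ring
  obtain ⟨s, hs, hs'⟩ := h.complete (fun i => (∏ j ∈ Finset.range i, w j : Aˣ) * y i)
    fun i => h.units_mul_mem (hp i) (hy i)
  obtain ⟨u, hu, -⟩ := h.exists_unit s hs
  refine ⟨u, mem_units_zero.2 ⟨s, hs, hu⟩, fun k => ?_⟩
  obtain ⟨z, hz, hz'⟩ := hs' k
  refine h.div_mem_units (hp k) hz ?_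
  rw [hu, hsum]
  linear_combination π * hz'

theorem separated_units (h : TateAcyclicLattice σ π M) (u : Aˣ) (hu : ∀ k, u ∈ h.units k) :
    u = 1 := by
  refine Units.ext (sub_eq_zero.1 (h.separated _ fun k => ?_))
  obtain ⟨x, hx, hu⟩ := hu k
  exact ⟨π * x, h.mul_left_mem _ hx, by rw [hu, Units.val_one]; ring⟩

/-- Cross terms carry π^(2k+2), so modulo π^(k+2) products become sums. With x running over
conjugates, the norm acts on each graded piece as the trace. -/
theorem prod_one_add (h : TateAcyclicLattice σ π M) (k : ℕ) {ι : Type*} (s : Finset ι) (x : ι → A)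
    (hx : ∀ i ∈ s, x i ∈ M) : ∃ y ∈ M, ∏ i ∈ s, (1 + π ^ (k + 1) * x i) =
      1 + π ^ (k + 1) * ∑ i ∈ s, x i + π ^ (k + 2) * y := by
  classical
  induction s using Finset.induction_on with
  | empty => exact ⟨0, zero_mem _, by simp⟩
  | insert i s hi ih =>
    obtain ⟨y, hy, hy'⟩ := ih fun j hj => hx j (Finset.mem_insert_of_mem hj)
    have hxi := hx i (Finset.mem_insert_self _ _)
    refine ⟨y + π ^ (k + 1) * (x i * y) + π ^ k * (x i * ∑ j ∈ s, x j), ?_, ?_⟩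
    · exact add_mem (add_mem hy (h.pow_mul_mem _ (h.mul_mem _ hxi _ hy))) (h.pow_mul_mem _
        (h.mul_mem _ hxi _ (sum_mem fun j hj => hx j (Finset.mem_insert_of_mem hj))))
    · rw [Finset.prod_insert hi, Finset.sum_insert hi, hy']
      ring

theorem groupNorm_eq (u : Aˣ) :
    ((groupNorm G Aˣ u : Aˣ) : A) = ∏ τ : G, τ • (u : A) := by
  rw [groupNorm_apply, Units.coe_prod]
  rfl

theorem groupNorm_one_add (h : TateAcyclicLattice σ π M) (k : ℕ) {u : Aˣ} {x : A} (hx : x ∈ M)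
    (hu : (u : A) = 1 + π ^ (k + 1) * x) : ∃ y ∈ M, ((groupNorm G Aˣ u : Aˣ) : A) =
      1 + π ^ (k + 1) * ∑ τ : G, τ • x + π ^ (k + 2) * y := by
  obtain ⟨y, hy, hy'⟩ := h.prod_one_add k Finset.univ (fun τ : G => τ • x)
    fun τ _ => h.smul_mem τ x hx
  refine ⟨y, hy, ?_⟩
  rw [groupNorm_eq, ← hy']
  refine Finset.prod_congr rfl fun τ _ => ?_
  rw [hu, smul_add, smul_one, smul_mul', h.smul_pow]

theorem exists_unit_pow (h : TateAcyclicLattice σ π M) (k : ℕ) {x : A} (hx : x ∈ M) :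
    ∃ u ∈ h.units k, (u : A) = 1 + π ^ (k + 1) * x := by
  obtain ⟨u, hu, -⟩ := h.exists_unit _ (h.pow_mul_mem k hx)
  have hu' : (u : A) = 1 + π ^ (k + 1) * x := hu.trans (by rw [pow_succ', mul_assoc])
  exact ⟨u, ⟨x, hx, hu'⟩, hu'⟩

/-- Successive approximation inside the invariants: an invariant leading coefficient is a trace from
M, and the norm realises this trace up to the next layer. -/
theorem exists_groupNorm_eq (h : TateAcyclicLattice σ π M) {v : Aˣ} (hv : v ∈ h.units 0)
    (hfix : ∀ τ : G, τ • v = v) : ∃ w ∈ h.units 0, groupNorm G Aˣ w = v := by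
  refine exists_eq_of_filtration (groupNorm G Aˣ) h.units h.units (FixedPoints.subgroup G Aˣ)
    (fun w τ => smul_groupNorm τ w) ?_ h.separated_units h.complete_units ?_ hv hfix
  · rintro k _ ⟨u, hu, rfl⟩
    exact groupNorm_mem (fun τ x hx => h.smul_mem_units hx τ) hu
  · rintro k v ⟨x, hx, hv⟩ hfix
    have hxfix : ∀ τ : G, τ • x = x := fun τ => by
      have := congrArg Units.val (hfix τ)
      rw [Units.coe_smul, hv, smul_add, smul_one, smul_mul', h.smul_pow] at this
      exact h.pow_cancel (k + 1) (add_left_cancel this)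
    obtain ⟨z, hz, hzx⟩ := h.exists_trace x hx hxfix
    obtain ⟨w, hw, hw'⟩ := h.exists_unit_pow k hz
    obtain ⟨y, hy, hy'⟩ := h.groupNorm_one_add k hz hw'
    have hN : groupNorm G Aˣ w ∈ h.units k := by
      refine ⟨x + π * y, add_mem hx (h.mul_left_mem _ hy), ?_⟩
      rw [hy', hzx]
      ring
    refine ⟨w, hw, h.div_mem_units hN (neg_mem hy) ?_⟩
    rw [hv, hy', hzx]
    ring

/-- Successive approximation inside the kernel of the norm: the leading coefficient, after a
correction by a multiple of π, has trace zero and so has the form σy - y. -/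
theorem exists_augmentation_eq (h : TateAcyclicLattice σ π M) {v : Aˣ} (hv : v ∈ h.units 0)
    (hnorm : groupNorm G Aˣ v = 1) : ∃ w ∈ h.units 0, augmentation Aˣ σ w = v := by
  refine exists_eq_of_filtration (augmentation Aˣ σ) h.units h.units (groupNorm G Aˣ).ker
    (groupNorm_augmentation σ) ?_ h.separated_units h.complete_units ?_ hv hnorm
  · rintro k _ ⟨u, hu, rfl⟩
    exact div_mem (h.smul_mem_units hu σ) hu
  · rintro k v ⟨x, hx, hv⟩ hN
    obtain ⟨y, hy, hy'⟩ := h.groupNorm_one_add k hx hv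
    have hN1 : groupNorm G Aˣ v = 1 := hN
    rw [hN1, Units.val_one] at hy'
    -- Norm 1 only gives trace zero modulo π. The quotient -y is invariant, so it is the trace of
    -- some z in M; x - πz has trace exactly zero, and πz belongs to the next layer.
    have htr : ∑ τ : G, τ • x = π * -y := by
      refine h.pow_cancel (k + 1) ?_
      linear_combination -hy'
    have hyfix : ∀ τ : G, τ • (-y) = -y := fun τ => by
      refine h.pow_cancel 1 ?_
      have h1 : τ • (π * -y) = π * -y := by
        rw [← htr, Finset.smul_sum]
        simp only [smul_smul]
        exact Equiv.sum_comp (Equiv.mulLeft τ) (fun ρ : G => ρ • x)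
      rwa [smul_mul', h.smul_eq, ← pow_one π] at h1
    obtain ⟨z, hz, hzy⟩ := h.exists_trace _ (neg_mem hy) hyfix
    have htr' : ∑ τ : G, τ • (x - π * z) = 0 := by
      simp only [smul_sub, Finset.sum_sub_distrib, smul_mul', h.smul_eq]
      rw [← Finset.mul_sum, hzy, htr, sub_self]
    obtain ⟨y', hy'', hyx⟩ := h.exists_sub _ (sub_mem hx (h.mul_left_mem _ hz)) htr'
    obtain ⟨w, hw, hw'⟩ := h.exists_unit_pow k hy''
    refine ⟨w, hw, ?_⟩
    have hd : v / (augmentation Aˣ σ w) = (v * w) / (σ • w) := by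
      change v / (σ • w / w) = _
      rw [div_div_eq_mul_div]
    rw [hd]
    refine h.div_mem_units (h.smul_mem_units hw σ) (x := z + π ^ k * (x * y'))
      (add_mem hz (h.pow_mul_mem _ (h.mul_mem _ hx _ hy''))) ?_
    rw [Units.coe_smul, Units.val_mul, hv, hw', smul_add, smul_one, smul_mul', h.smul_pow]
    linear_combination -π ^ (k + 1) * hyx

end TateAcyclicLattice

end LatticeUnits

/-! ### Uniform bounds for finite families of values -/

section Bounds

open WithZero

theorem exists_exp_neg_le {ι : Type*} [Finite ι] (f : ι → ℤᵐ⁰) (hf : ∀ i, f i ≠ 0) :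
    ∃ N : ℤ, ∀ i, exp (-N) ≤ f i := by
  obtain ⟨N, hN⟩ := (Set.finite_range fun i => log (f i)).bddBelow
  refine ⟨-N, fun i => ?_⟩
  rw [neg_neg, ← exp_log (hf i), exp_le_exp]
  exact hN ⟨i, rfl⟩

theorem exists_le_exp {ι : Type*} [Finite ι] (f : ι → ℤᵐ⁰) : ∃ N : ℤ, ∀ i, f i ≤ exp N := by
  obtain ⟨N, hN⟩ := (Set.finite_range fun i => log (f i)).bddAbove
  refine ⟨N, fun i => ?_⟩
  rcases eq_or_ne (f i) 0 with h | h
  · rw [h]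
    exact zero_le
  · rw [← exp_log h, exp_le_exp]
    exact hN ⟨i, rfl⟩

theorem eq_zero_of_forall_le_pow {F : Type*} [Field F] (v : Valuation F ℤᵐ⁰) {a : ℤᵐ⁰}
    (ha : a < 1) {x : F} (hx : ∀ m : ℕ, v x ≤ a ^ m) : x = 0 := by
  by_contra h
  obtain ⟨n, hn⟩ := exists_pow_lt₀ ha (Units.mk0 _ ((Valuation.ne_zero_iff v).2 h))
  exact (hx n).not_gt hn

end Bounds

/-! ### The semilocal algebra ∏ L_Q over P: Galois action, values and invariants -/

namespace Semilocal

open WithZero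

variable {K L : Type*} [Field K] [Field L] [Algebra K L]

theorem _root_.GlobalClassField.Place.Over.comap_algEquiv {P : Place K} {Q : Place L}
    (h : P.Over (algebraMap K L) Q) (σ : L ≃ₐ[K] L) :
    P.Over (algebraMap K L) (Q.comap (σ : L ≃+* L)) := by
  have : (Q.comap (σ : L ≃+* L)).valuation.comap (algebraMap K L) =
      Q.valuation.comap (algebraMap K L) := by
    ext x
    exact congrArg Q.valuation (σ.commutes x)
  rw [Place.Over, this]
  exact h

variable {P : Place K}

/-- The formula is that of the action on ideles, so taking components over P is equivariant by
definition. -/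
instance : MulSemiringAction (L ≃ₐ[K] L) (Semilocal L P) where
  smul σ a Q := (Q.1.comap_over (σ : L ≃+* L)).map
    (a ⟨Q.1.comap (σ : L ≃+* L), Q.2.comap_algEquiv σ⟩)
  one_smul _ := funext fun Q =>
    Place.Over.map_id (f := (((1 : L ≃ₐ[K] L) : L ≃+* L) : L →+* L)) rfl
      (Q.1.comap_over ((1 : L ≃ₐ[K] L) : L ≃+* L)) _
  mul_smul σ τ _ := funext fun Q =>
    (Place.Over.map_map rfl ((Q.1.comap (σ : L ≃+* L)).comap_over (τ : L ≃+* L))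
      (Q.1.comap_over (σ : L ≃+* L)) (Q.1.comap_over ((σ * τ : L ≃ₐ[K] L) : L ≃+* L)) _).symm
  smul_zero σ := funext fun Q => map_zero (Q.1.comap_over (σ : L ≃+* L)).map
  smul_add σ _ _ := funext fun Q => map_add (Q.1.comap_over (σ : L ≃+* L)).map _ _
  smul_one σ := funext fun Q => map_one (Q.1.comap_over (σ : L ≃+* L)).map
  smul_mul σ _ _ := funext fun Q => map_mul (Q.1.comap_over (σ : L ≃+* L)).map _ _

/-- The value of the component of `a` at `Q`. -/
def value (a : Semilocal L P) (Q : {Q : Place L // P.Over (algebraMap K L) Q}) : ℤᵐ⁰ :=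
  Valued.v (a Q)

theorem value_smul (σ : L ≃ₐ[K] L) (a : Semilocal L P)
    (Q : {Q : Place L // P.Over (algebraMap K L) Q}) :
    (σ • a).value Q = a.value ⟨Q.1.comap (σ : L ≃+* L), Q.2.comap_algEquiv σ⟩ :=
  Q.1.valued_map_comap (σ : L ≃+* L) _

theorem value_mul (a b : Semilocal L P) (Q : {Q : Place L // P.Over (algebraMap K L) Q}) :
    (a * b).value Q = a.value Q * b.value Q :=
  map_mul (Valued.v (R := Q.1.Completion)) _ _

theorem value_pow (a : Semilocal L P) (k : ℕ) (Q : {Q : Place L // P.Over (algebraMap K L) Q}) :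
    (a ^ k).value Q = a.value Q ^ k :=
  map_pow (Valued.v (R := Q.1.Completion)) _ _

theorem value_one (Q : {Q : Place L // P.Over (algebraMap K L) Q}) :
    (1 : Semilocal L P).value Q = 1 :=
  map_one (Valued.v (R := Q.1.Completion))

theorem value_zero (Q : {Q : Place L // P.Over (algebraMap K L) Q}) :
    (0 : Semilocal L P).value Q = 0 :=
  map_zero (Valued.v (R := Q.1.Completion))

theorem value_add_le {a b : Semilocal L P} {Q : {Q : Place L // P.Over (algebraMap K L) Q}}
    {g : ℤᵐ⁰} (ha : a.value Q ≤ g) (hb : b.value Q ≤ g) : (a + b).value Q ≤ g :=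
  Valuation.map_add_le (Valued.v (R := Q.1.Completion)) ha hb

theorem value_sub_le {a b : Semilocal L P} {Q : {Q : Place L // P.Over (algebraMap K L) Q}}
    {g : ℤᵐ⁰} (ha : a.value Q ≤ g) (hb : b.value Q ≤ g) : (a - b).value Q ≤ g :=
  Valuation.map_sub_le (v := Valued.v (R := Q.1.Completion)) ha hb

theorem value_sum_le {ι : Type*} {s : Finset ι} {f : ι → Semilocal L P}
    {Q : {Q : Place L // P.Over (algebraMap K L) Q}}
    {g : ℤᵐ⁰} (hf : ∀ i ∈ s, (f i).value Q ≤ g) : (∑ i ∈ s, f i).value Q ≤ g := by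
  classical
  induction s using Finset.induction_on with
  | empty => rw [Finset.sum_empty, value_zero]; exact zero_le
  | insert i s hi ih =>
    rw [Finset.sum_insert hi]
    exact value_add_le (hf i (Finset.mem_insert_self _ _))
      (ih fun j hj => hf j (Finset.mem_insert_of_mem hj))

variable (P) in
/-- The diagonal embedding of `L`. -/
def diagonal : L →+* Semilocal L P :=
  RingHom.pi fun Q : {Q : Place L // P.Over (algebraMap K L) Q} => Q.1.embedding

theorem value_diagonal (x : L) (Q : {Q : Place L // P.Over (algebraMap K L) Q}) :
    (diagonal P x).value Q = Q.1.valuation x :=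
  Q.1.valued_embedding x

theorem smul_diagonal (σ : L ≃ₐ[K] L) (x : L) : σ • diagonal P x = diagonal P (σ x) :=
  funext fun Q => (Q.1.comap_over (σ : L ≃+* L)).map_embedding x

theorem smul_algebraMap (σ : L ≃ₐ[K] L) (c : P.Completion) :
    σ • algebraMap P.Completion (Semilocal L P) c = algebraMap P.Completion (Semilocal L P) c :=
  funext fun Q => Place.Over.map_map (RingHom.ext fun x => (σ.commutes x).symm)
    (Q.2.comap_algEquiv σ) (Q.1.comap_over (σ : L ≃+* L)) Q.2 c

theorem algebraMap_embedding (x : K) :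
    algebraMap P.Completion (Semilocal L P) (P.embedding x) = diagonal P (algebraMap K L x) :=
  funext fun Q => Q.2.map_embedding x

theorem value_algebraMap_le_one_iff (Q : {Q : Place L // P.Over (algebraMap K L) Q})
    {c : P.Completion} :
    (algebraMap P.Completion (Semilocal L P) c).value Q ≤ 1 ↔ (Valued.v c : ℤᵐ⁰) ≤ 1 :=
  Q.2.valued_map_le_one_iff

theorem value_algebraMap_le_iff (Q : {Q : Place L // P.Over (algebraMap K L) Q})
    {c c' : P.Completion} :
    (algebraMap P.Completion (Semilocal L P) c).value Q ≤
      (algebraMap P.Completion (Semilocal L P) c').value Q ↔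
      (Valued.v c : ℤᵐ⁰) ≤ Valued.v c' :=
  Q.2.valued_map_le_iff

theorem isUnit_of_value_ne_zero {a : Semilocal L P} (h : ∀ Q, a.value Q ≠ 0) : IsUnit a := by
  refine IsUnit.of_mul_eq_one (fun Q => (a Q)⁻¹ : Semilocal L P) (funext fun Q => ?_)
  exact mul_inv_cancel₀ ((Valuation.ne_zero_iff (Valued.v (R := Q.1.Completion))).1 (h Q))

theorem value_unit_ne_zero (u : (Semilocal L P)ˣ)
    (Q : {Q : Place L // P.Over (algebraMap K L) Q}) : (u : Semilocal L P).value Q ≠ 0 := by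
  intro h
  have := value_mul (u : Semilocal L P) (↑u⁻¹ : Semilocal L P) Q
  rw [Units.mul_inv, value_one, h, zero_mul] at this
  exact one_ne_zero this

theorem value_inv (u : (Semilocal L P)ˣ) (Q : {Q : Place L // P.Over (algebraMap K L) Q}) :
    (↑u⁻¹ : Semilocal L P).value Q = ((u : Semilocal L P).value Q)⁻¹ := by
  refine eq_inv_of_mul_eq_one_left ?_
  rw [← value_mul, Units.inv_mul, value_one]

theorem value_eq_one_of_sub_one_lt {a : Semilocal L P}
    {Q : {Q : Place L // P.Over (algebraMap K L) Q}} (h : (a - 1).value Q < 1) :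
    a.value Q = 1 := by
  have := Valuation.map_one_add_of_lt (v := Valued.v (R := Q.1.Completion)) h
  rwa [show (1 : Q.1.Completion) + (a - 1 : Semilocal L P) Q = a Q from
    add_sub_cancel (1 : Q.1.Completion) (a Q)] at this

section Finite

variable [Finite {Q : Place L // P.Over (algebraMap K L) Q}]

theorem exists_diagonal_sub_le (a : Semilocal L P) (m : ℤ) :
    ∃ x : L, ∀ Q, (diagonal P x - a).value Q ≤ exp m := by
  classical
  choose y hy using fun Q : {Q : Place L // P.Over (algebraMap K L) Q} =>
    Q.1.exists_embedding_sub_le (a Q) m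
  have hfin : {Q : Place L | P.Over (algebraMap K L) Q}.Finite :=
    ‹Finite {Q : Place L // P.Over (algebraMap K L) Q}›
  obtain ⟨x, hx⟩ := Place.exists_approx hfin.toFinset
    (fun Q => if h : P.Over (algebraMap K L) Q then y ⟨Q, h⟩ else 0) m
  refine ⟨x, fun Q => ?_⟩
  have h1 := hx Q.1 (hfin.mem_toFinset.2 Q.2)
  rw [dif_pos Q.2] at h1
  have h2 := value_add_le (a := diagonal P (x - y Q)) (b := diagonal P (y Q) - a) (Q := Q)
    (g := exp m) (by rwa [value_diagonal]) (hy Q)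
  rwa [map_sub, sub_add_sub_cancel] at h2

variable [FiniteDimensional K L] [IsGalois K L]

/-- The invariants of the Galois group are the elements of `K_P`. -/
theorem exists_algebraMap_eq (a : Semilocal L P) (ha : ∀ σ : L ≃ₐ[K] L, σ • a = a) :
    ∃ c : P.Completion, algebraMap P.Completion (Semilocal L P) c = a := by
  obtain ⟨π, hπ0, hπ⟩ := P.exists_valuation_eq_exp (-1)
  have hπ1 : (Valued.v (P.embedding π) : ℤᵐ⁰) < 1 := by
    rw [P.valued_embedding, hπ]
    exact exp_neg_one_lt_one
  set ϖ := algebraMap P.Completion (Semilocal L P) (P.embedding π) with hϖ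
  have hϖ0 : ∀ Q, ϖ.value Q ≠ 0 := fun Q => by
    rw [hϖ, algebraMap_embedding, value_diagonal, Valuation.ne_zero_iff]
    exact (map_ne_zero _).2 hπ0
  have hϖ1 : ∀ Q, ϖ.value Q < 1 := fun Q => by
    have h := (value_algebraMap_le_iff (L := L) Q (c := 1) (c' := P.embedding π)).not.2
      (by rw [map_one, not_le]; exact hπ1)
    rwa [map_one, value_one, not_le] at h
  -- With Tr t = 1 an invariant a is the sum of the conjugates of a·t. If l in L approximates a at
  -- all Q, then Tr(l t) is an element of K approximating a; the loss of precision is bounded by the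
  -- conjugates of t.
  obtain ⟨t, ht⟩ := Algebra.trace_surjective K L 1
  obtain ⟨B, hB⟩ := exists_le_exp fun p : (L ≃ₐ[K] L) ×
    {Q : Place L // P.Over (algebraMap K L) Q} => (p.1 • diagonal P t).value p.2
  have hT : ∀ z : L, diagonal P (algebraMap K L (Algebra.trace K L z)) =
      ∑ τ : L ≃ₐ[K] L, τ • diagonal P z := fun z => by
    rw [trace_eq_sum_automorphisms, map_sum]
    exact Finset.sum_congr rfl fun τ _ => (smul_diagonal τ z).symm
  have hk : ∀ m : ℕ, ∃ k : K, ∀ Q,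
      (diagonal P (algebraMap K L k) - a).value Q ≤ (ϖ ^ m).value Q := by
    intro m
    obtain ⟨N, hN⟩ := exists_exp_neg_le (fun Q => (ϖ ^ m).value Q) fun Q => by
      rw [value_pow]
      exact pow_ne_zero _ (hϖ0 Q)
    obtain ⟨l, hl⟩ := exists_diagonal_sub_le a (-N - B)
    refine ⟨Algebra.trace K L (l * t), fun Q => ?_⟩
    have h1 : a = ∑ τ : L ≃ₐ[K] L, τ • (a * diagonal P t) := by
      simp only [smul_mul', ha]
      rw [← Finset.mul_sum, ← hT, ht, map_one, map_one, mul_one]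
    rw [hT]
    nth_rewrite 1 [h1]
    rw [← Finset.sum_sub_distrib]
    refine value_sum_le fun τ _ => le_trans ?_ (hN Q)
    rw [← smul_sub, map_mul, ← sub_mul, smul_mul', value_mul, value_smul]
    refine (mul_le_mul' (hl _) (hB (τ, Q))).trans ?_
    rw [← exp_add, sub_add_cancel]
  choose k hk using hk
  obtain ⟨Q₀, hQ₀⟩ := P.exists_above L
  -- The approximations k(m) differ successively by integral multiples of π^m, as can be read off at
  -- one place above P. They converge as a telescoping power series, and the limit maps to a.
  have hd : ∀ m, ∃ c : P.Completion, (Valued.v c : ℤᵐ⁰) ≤ 1 ∧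
      P.embedding (k (m + 1)) - P.embedding (k m) = P.embedding π ^ m * c := by
    intro m
    have hne : P.embedding π ^ m ≠ 0 := pow_ne_zero _ ((map_ne_zero _).2 hπ0)
    refine ⟨(P.embedding (k (m + 1)) - P.embedding (k m)) / P.embedding π ^ m, ?_,
      (mul_div_cancel₀ _ hne).symm⟩
    rw [map_div₀]
    refine div_le_one_of_le₀ ?_ zero_le
    rw [← value_algebraMap_le_iff (L := L) ⟨Q₀, hQ₀⟩, map_sub, algebraMap_embedding,
      algebraMap_embedding, map_pow]
    have h1 := hk (m + 1) ⟨Q₀, hQ₀⟩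
    have h2 := hk m ⟨Q₀, hQ₀⟩
    have h3 : (ϖ ^ (m + 1)).value ⟨Q₀, hQ₀⟩ ≤ (ϖ ^ m).value ⟨Q₀, hQ₀⟩ := by
      rw [value_pow, value_pow]
      exact pow_le_pow_right_of_le_one' (hϖ1 _).le m.le_succ
    have := value_sub_le (h1.trans h3) h2
    rwa [sub_sub_sub_cancel_right] at this
  choose c hc hc' using hd
  obtain ⟨s, hs⟩ := P.exists_sum_pow_mul hπ1 c hc
  refine ⟨P.embedding (k 0) + s, sub_eq_zero.1 (funext fun Q => ?_)⟩
  refine eq_zero_of_forall_le_pow Valued.v (hϖ1 Q) fun m => ?_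
  have h1 : (Valued.v (P.embedding (k 0) + s - P.embedding (k m)) : ℤᵐ⁰) ≤
      Valued.v (P.embedding π ^ m) := by
    have h2 := hs m
    simp only [← hc'] at h2
    rw [Finset.sum_range_sub (fun m => P.embedding (k m))] at h2
    rw [map_pow]
    convert h2 using 2
    ring
  rw [← value_algebraMap_le_iff (L := L) Q, map_sub, algebraMap_embedding, map_pow] at h1
  have := value_add_le h1 (hk m Q)
  rwa [sub_add_sub_cancel, value_pow] at this

end Finite

end Semilocal

theorem semilocalComponent_smul {K L : Type*} [Field K] [Field L] [Algebra K L] (P : Place K)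
    (σ : L ≃ₐ[K] L) (α : Ideles L) :
    semilocalComponent L P (σ • α) = σ • semilocalComponent L P α :=
  rfl

/-! ### Bases of the semilocal algebra over K_P, and its norm -/

namespace Semilocal

variable {K L : Type*} [Field K] [Field L] [Algebra K L] [FiniteDimensional K L] {P : Place K}

theorem smul_sum_smul (σ : L ≃ₐ[K] L) (a : Semilocal L P) :
    σ • ∑ τ : L ≃ₐ[K] L, τ • a = ∑ τ : L ≃ₐ[K] L, τ • a := by
  rw [Finset.smul_sum]
  simp only [smul_smul]
  exact Equiv.sum_comp (Equiv.mulLeft σ) (fun ρ : L ≃ₐ[K] L => ρ • a)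

theorem nontrivial : Nontrivial (Semilocal L P) := by
  obtain ⟨Q, hQ⟩ := P.exists_above L
  refine ⟨⟨0, 1, fun h => ?_⟩⟩
  have := congrArg (fun a => a.value ⟨Q, hQ⟩) h
  simp only [value_zero, value_one] at this
  exact zero_ne_one this

theorem algebraMap_injective : Function.Injective (algebraMap P.Completion (Semilocal L P)) :=
  have := nontrivial (L := L) (P := P)
  (algebraMap P.Completion (Semilocal L P)).injective

variable [IsGalois K L]

section Conjugates

variable (b : Module.Basis (L ≃ₐ[K] L) K L)

open Classical in
-- The entries of the product are traces of products of a dual basis vector with a basis vector.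
theorem conjugates_mul_dual :
    (Matrix.of fun i τ => τ (b.traceDual i) : Matrix (L ≃ₐ[K] L) (L ≃ₐ[K] L) L) *
      (Matrix.of fun τ i => τ (b i)) = 1 := by
  ext i j
  rw [Matrix.mul_apply, Matrix.one_apply]
  simp only [Matrix.of_apply, ← map_mul]
  rw [← trace_eq_sum_automorphisms, Module.Basis.trace_traceDual_mul]
  simp only [eq_comm (a := i), apply_ite (algebraMap K L), map_one, map_zero]

open Classical in
-- The matrices of conjugates are square, so they are also inverse in the other order; this is the
-- row of the identity automorphism.
theorem sum_basis_mul_dual (τ : L ≃ₐ[K] L) :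
    ∑ i, b i * τ (b.traceDual i) = if τ = 1 then 1 else 0 := by
  have h := congrArg (fun M => M 1 τ) (mul_eq_one_comm.1 (conjugates_mul_dual b))
  rw [Matrix.mul_apply, Matrix.one_apply] at h
  simpa only [Matrix.of_apply, AlgEquiv.one_apply, eq_comm] using h

end Conjugates

section Basis

variable (b : Module.Basis (L ≃ₐ[K] L) K L)

open Classical in
-- Pairing with the dual basis recovers coefficients from K_P, which the Galois group fixes. Linear
-- independence over K_P follows.
theorem sum_smul_diagonal_mul_dual (c : (L ≃ₐ[K] L) → P.Completion) (j : L ≃ₐ[K] L) :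
    ∑ τ : L ≃ₐ[K] L, τ • ((∑ i, c i • diagonal P (b i)) * diagonal P (b.traceDual j)) =
      algebraMap P.Completion _ (c j) := by
  have h1 : ∀ i, ∑ τ : L ≃ₐ[K] L, τ • (diagonal P (b i) * diagonal P (b.traceDual j)) =
      if i = j then 1 else 0 := fun i => by
    simp only [← map_mul, smul_diagonal]
    rw [← map_sum, ← trace_eq_sum_automorphisms, mul_comm, Module.Basis.trace_traceDual_mul]
    simp only [apply_ite (algebraMap K L), apply_ite (diagonal P), map_one, map_zero]
  simp only [Algebra.smul_def, Finset.sum_mul, Finset.smul_sum, mul_assoc]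
  rw [Finset.sum_comm]
  simp only [smul_mul' _ (algebraMap P.Completion (Semilocal L P) _), smul_algebraMap]
  simp only [← Finset.mul_sum, h1, mul_ite, mul_one, mul_zero, Finset.sum_ite_eq', Finset.mem_univ,
    if_true]

open Classical in
-- The expansion has Galois-invariant coefficients, and invariants come from K_P; so the basis of L
-- spans over K_P.
theorem sum_diagonal_mul_sum (a : Semilocal L P) :
    ∑ j, (∑ τ : L ≃ₐ[K] L, τ • (a * diagonal P (b.traceDual j))) * diagonal P (b j) = a := by
  simp only [Finset.sum_mul, smul_mul', smul_diagonal, mul_assoc]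
  rw [Finset.sum_comm]
  simp only [← map_mul, ← Finset.mul_sum, ← map_sum]
  simp only [mul_comm _ (b _), sum_basis_mul_dual, apply_ite (diagonal P), map_one, map_zero,
    mul_ite, mul_one, mul_zero, Finset.sum_ite_eq', Finset.mem_univ, if_true, one_smul]

variable [Finite {Q : Place L // P.Over (algebraMap K L) Q}]

variable (P) in
/-- A basis of `L` over `K` is a basis of `∏_{Q ∣ P} L_Q` over `K_P`. -/
def basis : Module.Basis (L ≃ₐ[K] L) P.Completion (Semilocal L P) :=
  Module.Basis.mk (v := fun i => diagonal P (b i))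
    (by
      classical
      rw [Fintype.linearIndependent_iff]
      intro c hc j
      have h := sum_smul_diagonal_mul_dual b c j
      rw [hc] at h
      simp only [zero_mul, smul_zero, Finset.sum_const_zero] at h
      exact algebraMap_injective (L := L) (h.symm.trans (map_zero _).symm))
    (by
      classical
      rintro a -
      rw [← sum_diagonal_mul_sum b a]
      refine Submodule.sum_mem _ fun j _ => ?_
      obtain ⟨c, hc⟩ := exists_algebraMap_eq _ (fun σ => smul_sum_smul σ
        (a * diagonal P (b.traceDual j)))
      rw [← hc, ← Algebra.smul_def]
      exact Submodule.smul_mem _ _ (Submodule.subset_span ⟨j, rfl⟩))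

theorem basis_apply (i : L ≃ₐ[K] L) : basis P b i = diagonal P (b i) := by
  rw [basis, Module.Basis.mk_apply]

open Classical in
theorem algebraMap_repr (a : Semilocal L P) (j : L ≃ₐ[K] L) :
    algebraMap P.Completion _ ((basis P b).repr a j) =
      ∑ τ : L ≃ₐ[K] L, τ • (a * diagonal P (b.traceDual j)) := by
  conv_rhs => rw [← (basis P b).sum_repr a]
  simp only [basis_apply]
  exact (sum_smul_diagonal_mul_dual b _ j).symm

/-- For a normal basis the Galois group permutes the coordinates, which themselves lie in K_P and
are fixed. -/
theorem repr_smul (hb : ∀ σ τ : L ≃ₐ[K] L, σ (b τ) = b (σ * τ)) (σ τ : L ≃ₐ[K] L)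
    (a : Semilocal L P) : (basis P b).repr (σ • a) (σ * τ) = (basis P b).repr a τ := by
  have h : σ • a = ∑ ρ, (basis P b).repr a (σ⁻¹ * ρ) • basis P b ρ := by
    conv_lhs => rw [← (basis P b).sum_repr a]
    rw [Finset.smul_sum, ← Equiv.sum_comp (Equiv.mulLeft σ)
      (fun ρ => (basis P b).repr a (σ⁻¹ * ρ) • basis P b ρ)]
    refine Finset.sum_congr rfl fun ρ _ => ?_
    rw [Algebra.smul_def, Algebra.smul_def, smul_mul', smul_algebraMap, basis_apply,
      smul_diagonal, hb, basis_apply, Equiv.coe_mulLeft, inv_mul_cancel_left]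
  rw [h, Module.Basis.repr_sum_self, inv_mul_cancel_left]

end Basis

/-- The invertible matrix of conjugates of a basis conjugates the matrix of multiplication by a into
the diagonal matrix of the conjugates of a. Now compare determinants. -/
theorem algebraMap_norm [Finite {Q : Place L // P.Over (algebraMap K L) Q}] (a : Semilocal L P) :
    algebraMap P.Completion _ (Algebra.norm P.Completion a) = ∏ τ : L ≃ₐ[K] L, τ • a := by
  classical
  let b := IsGalois.normalBasis K L
  let X : Matrix (L ≃ₐ[K] L) (L ≃ₐ[K] L) (Semilocal L P) :=
    Matrix.of fun τ i => diagonal P (τ (b i))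
  have hX : IsUnit X.det := by
    refine (Matrix.isUnit_iff_isUnit_det X).1 ?_
    have h := congrArg (RingHom.mapMatrix (diagonal P)) (mul_eq_one_comm.1 (conjugates_mul_dual b))
    rw [map_mul, map_one] at h
    exact IsUnit.of_mul_eq_one _ h
  have hmul : Matrix.diagonal (fun τ : L ≃ₐ[K] L => τ • a) * X =
      X * (algebraMap P.Completion (Semilocal L P)).mapMatrix
        (Algebra.leftMulMatrix (basis P b) a) := by
    ext1 τ i
    rw [Matrix.diagonal_mul, Matrix.mul_apply]
    simp only [RingHom.mapMatrix_apply, Matrix.map_apply, Algebra.leftMulMatrix_eq_repr_mul]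
    have h := congrArg (τ • ·) ((basis P b).sum_repr (a * basis P b i))
    simp only [Finset.smul_sum, Algebra.smul_def, smul_mul', smul_algebraMap, basis_apply,
      smul_diagonal] at h
    simp only [X, Matrix.of_apply, basis_apply]
    rw [← h]
    exact Finset.sum_congr rfl fun j _ => mul_comm _ _
  have hdet := congrArg Matrix.det hmul
  rw [Matrix.det_mul, Matrix.det_mul, Matrix.det_diagonal, mul_comm] at hdet
  rw [Algebra.norm_eq_matrix_det (basis P b), RingHom.map_det]
  exact (hX.mul_left_cancel hdet).symm

end Semilocal

/-! ### The lattice of an integral normal basis -/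

namespace Semilocal

open WithZero

attribute [local instance] Units.mulDistribMulActionRight

variable {K L : Type*} [Field K] [Field L] [Algebra K L] [FiniteDimensional K L] [IsGalois K L]
  {P : Place K} [Finite {Q : Place L // P.Over (algebraMap K L) Q}]

theorem repr_diagonal (b : Module.Basis (L ≃ₐ[K] L) K L) (x : L) (i : L ≃ₐ[K] L) :
    (basis P b).repr (diagonal P x) i = P.embedding (b.repr x i) := by
  have : diagonal P x = ∑ i, P.embedding (b.repr x i) • basis P b i := by
    conv_lhs => rw [← b.sum_repr x]
    simp only [map_sum, Algebra.smul_def, map_mul, algebraMap_embedding, basis_apply]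
  rw [this, Module.Basis.repr_sum_self]

variable (P) in
/-- A normal basis which is integral at `P` and spans a multiplicatively closed lattice. -/
structure IsIntegralNormalBasis (b : Module.Basis (L ≃ₐ[K] L) K L) : Prop where
  smul_eq : ∀ σ τ : L ≃ₐ[K] L, σ (b τ) = b (σ * τ)
  mul_repr_le : ∀ σ τ ρ : L ≃ₐ[K] L, P.valuation (b.repr (b σ * b τ) ρ) ≤ 1
  le_one : ∀ (τ : L ≃ₐ[K] L) (Q : Place L), P.Over (algebraMap K L) Q → Q.valuation (b τ) ≤ 1

omit [IsGalois K L] [FiniteDimensional K L]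
  [Finite {Q : Place L // P.Over (algebraMap K L) Q}] in
theorem _root_.GlobalClassField.Place.Over.lt_one {Q : Place L}
    (h : P.Over (algebraMap K L) Q) {x : K} (hx : P.valuation x < 1) :
    Q.valuation (algebraMap K L x) < 1 :=
  h.lt_one_iff_lt_one.1 hx

variable (L P) in
-- Multiplying a normal basis by π^e multiplies its structure constants and its values by the same
-- factor. Finitely many conditions hold once e is large.
theorem exists_isIntegralNormalBasis :
    ∃ b : Module.Basis (L ≃ₐ[K] L) K L, IsIntegralNormalBasis P b := by
  obtain ⟨π, hπ0, hπ⟩ := P.exists_valuation_eq_exp (-1)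
  have hπ1 : P.valuation π < 1 := by rw [hπ]; exact exp_neg_one_lt_one
  let b := IsGalois.normalBasis K L
  have h1 : ∀ x : (L ≃ₐ[K] L) × (L ≃ₐ[K] L) × (L ≃ₐ[K] L), ∃ d : ℕ, ∀ e ≥ d,
      P.valuation π ^ e * P.valuation (b.repr (b x.1 * b x.2.1) x.2.2) ≤ 1 := fun x => by
    obtain ⟨d, hd⟩ := exists_pow_mul_lt_one hπ1 (P.valuation (b.repr (b x.1 * b x.2.1) x.2.2))
    exact ⟨d, fun e he => (hd e he).le⟩
  have h2 : ∀ x : (L ≃ₐ[K] L) × {Q : Place L // P.Over (algebraMap K L) Q}, ∃ d : ℕ, ∀ e ≥ d,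
      x.2.1.valuation (algebraMap K L π) ^ e * x.2.1.valuation (b x.1) ≤ 1 := fun x => by
    obtain ⟨d, hd⟩ := exists_pow_mul_lt_one (x.2.2.lt_one hπ1) (x.2.1.valuation (b x.1))
    exact ⟨d, fun e he => (hd e he).le⟩
  choose d1 hd1 using h1
  choose d2 hd2 using h2
  obtain ⟨e1, he1⟩ := (Set.finite_range d1).bddAbove
  obtain ⟨e2, he2⟩ := (Set.finite_range d2).bddAbove
  set e := max e1 e2
  have hu : IsUnit (π ^ e) := (pow_ne_zero _ hπ0).isUnit
  have hb : ∀ τ, (b.isUnitSMul fun _ => hu) τ = algebraMap K L (π ^ e) * b τ := fun τ => by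
    rw [Module.Basis.isUnitSMul_apply, Algebra.smul_def]
  refine ⟨b.isUnitSMul fun _ => hu, fun σ τ => ?_, fun σ τ ρ => ?_, fun τ Q hQ => ?_⟩
  · rw [hb, hb, map_mul, AlgEquiv.commutes, IsGalois.normalBasis_apply τ,
      IsGalois.normalBasis_apply (σ * τ)]
    rfl
  · have : (b.isUnitSMul fun _ => hu) σ * (b.isUnitSMul fun _ => hu) τ =
        ∑ κ, (π ^ e * b.repr (b σ * b τ) κ) • (b.isUnitSMul fun _ => hu) κ := by
      conv_lhs => rw [hb, hb, mul_mul_mul_comm, ← b.sum_repr (b σ * b τ), ← map_mul,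
        ← Algebra.smul_def, Finset.smul_sum]
      refine Finset.sum_congr rfl fun κ _ => ?_
      rw [hb, ← Algebra.smul_def, smul_smul, smul_smul]
      congr 1
      ring
    rw [this, Module.Basis.repr_sum_self, map_mul, map_pow]
    exact hd1 (σ, τ, ρ) e ((he1 ⟨_, rfl⟩).trans (le_max_left _ _))
  · rw [hb, map_mul, map_pow, map_pow]
    exact hd2 (τ, ⟨Q, hQ⟩) e ((he2 ⟨_, rfl⟩).trans (le_max_right _ _))

variable (P) in
/-- The lattice spanned by a basis over the ring of integers of `K_P`. -/
def lattice (b : Module.Basis (L ≃ₐ[K] L) K L) : AddSubgroup (Semilocal L P) where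
  carrier := {a | ∀ τ, (Valued.v ((basis P b).repr a τ) : ℤᵐ⁰) ≤ 1}
  zero_mem' τ := by simp
  add_mem' hx hy τ := by
    rw [map_add, Finsupp.add_apply]
    exact Valuation.map_add_le _ (hx τ) (hy τ)
  neg_mem' hx τ := by
    rw [map_neg, Finsupp.neg_apply, Valuation.map_neg]
    exact hx τ

variable {b : Module.Basis (L ≃ₐ[K] L) K L}

theorem algebraMap_mul_mem_lattice {c : P.Completion} (hc : (Valued.v c : ℤᵐ⁰) ≤ 1)
    {a : Semilocal L P} (ha : a ∈ lattice P b) :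
    algebraMap P.Completion _ c * a ∈ lattice P b := fun τ => by
  rw [← Algebra.smul_def, map_smul, Finsupp.smul_apply, smul_eq_mul, map_mul]
  exact mul_le_one' hc (ha τ)

theorem basis_mem_lattice (τ : L ≃ₐ[K] L) : basis P b τ ∈ lattice P b := fun ρ => by
  classical
  rw [Module.Basis.repr_self, Finsupp.single_apply]
  split_ifs <;> simp

theorem value_le_one_of_mem_lattice (h : IsIntegralNormalBasis P b) {a : Semilocal L P}
    (ha : a ∈ lattice P b) (Q : {Q : Place L // P.Over (algebraMap K L) Q}) : a.value Q ≤ 1 := by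
  rw [← (basis P b).sum_repr a]
  refine value_sum_le fun τ _ => ?_
  rw [Algebra.smul_def, value_mul, basis_apply, value_diagonal]
  exact mul_le_one' ((value_algebraMap_le_one_iff Q).2 (ha τ)) (h.le_one τ _ Q.2)

theorem mul_mem_lattice (h : IsIntegralNormalBasis P b) {x y : Semilocal L P}
    (hx : x ∈ lattice P b) (hy : y ∈ lattice P b) : x * y ∈ lattice P b := by
  rw [← (basis P b).sum_repr x, ← (basis P b).sum_repr y, Finset.sum_mul_sum]
  refine sum_mem fun i _ => sum_mem fun j _ => ?_
  rw [Algebra.smul_def, Algebra.smul_def, mul_mul_mul_comm, ← map_mul]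
  refine algebraMap_mul_mem_lattice ?_ fun τ => ?_
  · rw [map_mul]
    exact mul_le_one' (hx i) (hy j)
  · rw [basis_apply, basis_apply, ← map_mul, repr_diagonal, P.valued_embedding]
    exact h.mul_repr_le _ _ _

theorem smul_mem_lattice (h : IsIntegralNormalBasis P b) (σ : L ≃ₐ[K] L) {x : Semilocal L P}
    (hx : x ∈ lattice P b) : σ • x ∈ lattice P b := fun τ => by
  have := repr_smul b h.smul_eq σ (σ⁻¹ * τ) x
  rw [mul_inv_cancel_left] at this
  rw [this]
  exact hx _

/-- The lattice is an induced module: an invariant element has equal coordinates, so it is the trace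
of its component along b_1. -/
theorem exists_trace_lattice (h : IsIntegralNormalBasis P b) {x : Semilocal L P}
    (hx : x ∈ lattice P b) (hfix : ∀ τ : L ≃ₐ[K] L, τ • x = x) :
    ∃ y ∈ lattice P b, ∑ τ : L ≃ₐ[K] L, τ • y = x := by
  refine ⟨algebraMap P.Completion _ ((basis P b).repr x 1) * basis P b 1,
    algebraMap_mul_mem_lattice (hx 1) (basis_mem_lattice 1), ?_⟩
  conv_rhs => rw [← (basis P b).sum_repr x]
  refine Finset.sum_congr rfl fun τ _ => ?_
  have := repr_smul b h.smul_eq τ 1 x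
  rw [hfix, mul_one] at this
  rw [this, smul_mul', smul_algebraMap, basis_apply, smul_diagonal, h.smul_eq, mul_one,
    Algebra.smul_def, basis_apply]

/-- Trace zero means that the coordinates sum to zero, so x is a combination of differences of basis
vectors at σ^n and at 1. Each difference telescopes as (σ - 1) applied to the basis vectors at σ^j,
j < n. -/
theorem exists_sub_lattice (h : IsIntegralNormalBasis P b) {σ : L ≃ₐ[K] L}
    (hσ : ∀ τ : L ≃ₐ[K] L, τ ∈ Subgroup.zpowers σ) {x : Semilocal L P}
    (hx : x ∈ lattice P b) (htr : ∑ τ : L ≃ₐ[K] L, τ • x = 0) :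
    ∃ y ∈ lattice P b, σ • y - y = x := by
  choose n hn using fun τ => mem_powers_iff_mem_zpowers.2 (hσ τ)
  have hsmul : ∀ σ τ : L ≃ₐ[K] L, σ • basis P b τ = basis P b (σ * τ) := fun σ τ => by
    rw [basis_apply, smul_diagonal, h.smul_eq, basis_apply]
  refine ⟨∑ τ, algebraMap P.Completion _ ((basis P b).repr x τ) *
    ∑ j ∈ Finset.range (n τ), basis P b (σ ^ j),
    sum_mem fun τ _ => algebraMap_mul_mem_lattice (hx τ)
      (sum_mem fun j _ => basis_mem_lattice _), ?_⟩
  have h0 : ∑ τ, algebraMap P.Completion (Semilocal L P) ((basis P b).repr x τ) = 0 := by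
    have h1 := congrArg (fun a => (basis P b).repr a 1) htr
    simp only [map_sum, map_zero, Finsupp.coe_finsetSum, Finset.sum_apply, Finsupp.zero_apply] at h1
    have h2 : ∀ τ : L ≃ₐ[K] L, (basis P b).repr (τ • x) 1 = (basis P b).repr x τ⁻¹ := fun τ => by
      have := repr_smul b h.smul_eq τ τ⁻¹ x
      rwa [mul_inv_cancel] at this
    simp only [h2] at h1
    have h4 := Equiv.sum_comp (Equiv.inv (L ≃ₐ[K] L)) (fun τ => (basis P b).repr x τ)
    rw [← map_sum, ← h4]
    exact (congrArg _ h1).trans (map_zero _)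
  rw [Finset.smul_sum, ← Finset.sum_sub_distrib]
  have h3 : ∀ τ, σ • (algebraMap P.Completion (Semilocal L P) ((basis P b).repr x τ) *
      ∑ j ∈ Finset.range (n τ), basis P b (σ ^ j)) -
      algebraMap P.Completion (Semilocal L P) ((basis P b).repr x τ) *
      ∑ j ∈ Finset.range (n τ), basis P b (σ ^ j) =
      algebraMap P.Completion (Semilocal L P) ((basis P b).repr x τ) * basis P b τ -
      algebraMap P.Completion (Semilocal L P) ((basis P b).repr x τ) * basis P b 1 := by
    intro τ
    rw [smul_mul', smul_algebraMap, ← mul_sub, ← mul_sub, Finset.smul_sum]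
    simp only [hsmul, ← pow_succ']
    rw [← Finset.sum_sub_distrib, Finset.sum_range_sub (fun j => basis P b (σ ^ j)), pow_zero]
    congr 3
    exact hn τ
  rw [Finset.sum_congr rfl fun τ _ => h3 τ, Finset.sum_sub_distrib, ← Finset.sum_mul, h0, zero_mul,
    sub_zero]
  simp only [← Algebra.smul_def]
  exact (basis P b).sum_repr x

variable (P) in
-- Coordinates are traces against the dual basis, so those of integral elements have bounded
-- denominators, which can be tested at a single place above P.
theorem exists_pow_mul_mem_lattice {π : K} (hπ1 : P.valuation π < 1)
    (b : Module.Basis (L ≃ₐ[K] L) K L) :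
    ∃ k : ℕ, ∀ a : Semilocal L P, (∀ Q, a.value Q ≤ 1) →
      algebraMap P.Completion _ (P.embedding π) ^ k * a ∈ lattice P b := by
  classical
  obtain ⟨Q₀, hQ₀⟩ := P.exists_above L
  obtain ⟨B, hB⟩ := exists_le_exp fun p : (L ≃ₐ[K] L) × (L ≃ₐ[K] L) =>
    (p.1 • diagonal P (b.traceDual p.2)).value ⟨Q₀, hQ₀⟩
  obtain ⟨k, hk⟩ := exists_pow_mul_lt_one (hQ₀.lt_one hπ1) (exp B)
  refine ⟨k, fun a ha τ => ?_⟩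
  rw [← value_algebraMap_le_one_iff ⟨Q₀, hQ₀⟩, ← map_pow, ← Algebra.smul_def, map_smul,
    Finsupp.smul_apply, smul_eq_mul, map_mul, value_mul, map_pow, value_pow, algebraMap_embedding,
    value_diagonal]
  refine le_trans (mul_le_mul_right ?_ _) (hk k le_rfl).le
  rw [algebraMap_repr]
  refine value_sum_le fun ρ _ => ?_
  rw [smul_mul', value_mul, value_smul]
  exact (mul_le_of_le_one_left' (ha _)).trans (hB (ρ, τ))

theorem tateAcyclicLattice (h : IsIntegralNormalBasis P b) {σ : L ≃ₐ[K] L}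
    (hσ : ∀ τ : L ≃ₐ[K] L, τ ∈ Subgroup.zpowers σ) {π : K} (hπ0 : π ≠ 0)
    (hπ1 : P.valuation π < 1) :
    TateAcyclicLattice σ (algebraMap P.Completion (Semilocal L P) (P.embedding π))
      (lattice P b) := by
  have hπv : (Valued.v (P.embedding π) : ℤᵐ⁰) < 1 := by rwa [P.valued_embedding]
  have hπe : P.embedding π ≠ 0 := (map_ne_zero _).2 hπ0
  have hπM : ∀ x ∈ lattice P b, algebraMap P.Completion _ (P.embedding π) * x ∈ lattice P b :=
    fun x hx => algebraMap_mul_mem_lattice hπv.le hx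
  have hrepr : ∀ (k : ℕ) (x : Semilocal L P) (τ : L ≃ₐ[K] L),
      (basis P b).repr (algebraMap P.Completion _ (P.embedding π) ^ k * x) τ =
        P.embedding π ^ k * (basis P b).repr x τ := fun k x τ => by
    rw [← map_pow, ← Algebra.smul_def, map_smul, Finsupp.smul_apply, smul_eq_mul]
  refine ⟨fun x hx y hy => mul_mem_lattice h hx hy, fun τ x hx => smul_mem_lattice h τ hx,
    hπM, fun τ => smul_algebraMap _ _, fun x hx => ?_, fun x hx => exists_trace_lattice h hx,
    fun x hx => exists_sub_lattice h hσ hx, fun x hx => ?_, fun c hc => ?_, fun x hx => ?_⟩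
  · have hu : IsUnit (algebraMap P.Completion (Semilocal L P) (P.embedding π)) :=
      hπe.isUnit.map _
    exact hu.mul_right_eq_zero.1 hx
  · set ϖ := algebraMap P.Completion (Semilocal L P) (P.embedding π) with hϖ
    have hlt : ∀ Q, (ϖ * x).value Q < 1 := fun Q => by
      rw [value_mul, hϖ, algebraMap_embedding, value_diagonal]
      exact (mul_le_of_le_one_right' (value_le_one_of_mem_lattice h hx Q)).trans_lt
        (Q.2.lt_one hπ1)
    have hone : ∀ Q, (1 + ϖ * x).value Q = 1 := fun Q =>
      value_eq_one_of_sub_one_lt (by rw [add_sub_cancel_left]; exact hlt Q)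
    obtain ⟨u, hu⟩ := isUnit_of_value_ne_zero fun Q => by rw [hone Q]; exact one_ne_zero
    refine ⟨u, hu, fun y hy => ?_⟩
    obtain ⟨k, hk⟩ := exists_pow_mul_mem_lattice P hπ1 b
    have hinv : ϖ ^ k * (↑u⁻¹ : Semilocal L P) ∈ lattice P b := hk _ fun Q => by
      rw [value_inv, hu, hone, inv_one]
    -- A truncated geometric series. The remainder is (-x)^k times ϖ^k u⁻¹, and k was chosen so that
    -- ϖ^k brings the integral element u⁻¹ into the lattice.
    have hgeom : (↑u⁻¹ : Semilocal L P) = ∑ i ∈ Finset.range k, (-(ϖ * x)) ^ i +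
        (-x) ^ k * (ϖ ^ k * (↑u⁻¹ : Semilocal L P)) := by
      have h1 := mul_neg_geom_sum (-(ϖ * x)) k
      rw [sub_neg_eq_add, ← hu] at h1
      have h2 : (↑u⁻¹ : Semilocal L P) * u = 1 := u.inv_mul
      have h3 : (-(ϖ * x)) ^ k = (-x) ^ k * ϖ ^ k := by rw [← mul_pow]; ring
      rw [h3] at h1
      linear_combination -(↑u⁻¹ : Semilocal L P) * h1 +
        (∑ i ∈ Finset.range k, (-(ϖ * x)) ^ i) * h2
    have hpow : ∀ z ∈ lattice P b, ∀ (i : ℕ), ∀ w ∈ lattice P b, z ^ i * w ∈ lattice P b := by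
      intro z hz i w hw
      induction i with
      | zero => simpa using hw
      | succ i ih => rw [pow_succ', mul_assoc]; exact mul_mem_lattice h hz ih
    rw [hgeom, add_mul, Finset.sum_mul]
    exact add_mem (sum_mem fun i _ => hpow _ (neg_mem (hπM x hx)) i y hy)
      (mul_mem_lattice h (hpow _ (neg_mem hx) k _ hinv) hy)
  · choose s hs using fun τ => P.exists_sum_pow_mul hπv (fun i => (basis P b).repr (c i) τ)
      fun i => hc i τ
    have hrs : ∀ τ, (basis P b).repr (∑ τ, s τ • basis P b τ) τ = s τ := fun τ => by
      rw [Module.Basis.repr_sum_self]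
    refine ⟨∑ τ, s τ • basis P b τ, fun τ => ?_, fun k => ?_⟩
    · rw [hrs]
      simpa using hs τ 0
    · refine ⟨algebraMap P.Completion _ (P.embedding π ^ k)⁻¹ * (∑ τ, s τ • basis P b τ -
        ∑ i ∈ Finset.range k, algebraMap P.Completion _ (P.embedding π) ^ i * c i), fun τ => ?_, ?_⟩
      · rw [← Algebra.smul_def, map_smul, Finsupp.smul_apply, smul_eq_mul, map_sub,
          Finsupp.sub_apply, hrs, map_sum, Finsupp.coe_finsetSum, Finset.sum_apply]
        simp only [hrepr]
        rw [map_mul, map_inv₀, map_pow]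
        refine (inv_mul_le_iff₀ (pow_pos (zero_lt_iff.2 (Valued.v.ne_zero_iff.2 hπe)) k)).2 ?_
        rw [mul_one]
        exact hs τ k
      · rw [← mul_assoc, ← map_pow, ← map_mul, mul_inv_cancel₀ (pow_ne_zero _ hπe), map_one,
          one_mul]
  · refine (basis P b).repr.map_eq_zero_iff.1 (Finsupp.ext fun τ => ?_)
    rw [Finsupp.zero_apply]
    refine eq_zero_of_forall_le_pow Valued.v hπv fun m => ?_
    obtain ⟨y, hy, rfl⟩ := hx m
    rw [hrepr, map_mul, map_pow]
    exact mul_le_of_le_one_right' (hy τ)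

end Semilocal

/-! ### Finite index from finite residue rings -/

section FiniteIndex

open WithZero

theorem relIndex_ne_zero_of_finite {B R : Type*} [Group B] [Finite R] {H U : Subgroup B} (φ : U → R)
    (h : ∀ u w : U, φ u = φ w → (u⁻¹ * w : B) ∈ H) : H.relIndex U ≠ 0 := by
  have : Finite (U ⧸ H.subgroupOf U) :=
    Finite.of_injective (fun q : U ⧸ H.subgroupOf U => φ q.out) fun q q' hq => by
      rw [← q.out_eq', ← q'.out_eq']
      exact QuotientGroup.eq.2 (h _ _ hq)
  exact (Subgroup.finiteIndex_of_finite_quotient (H := H.subgroupOf U)).index_ne_zero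

/-- Integral elements of the completion are approximated by integral functions, and those have
finitely many classes modulo the N-th power of the maximal ideal, by the index of balls. -/
theorem Place.exists_finite_residues {k F : Type*} [Field k] [Finite k] [Field F] [Algebra k F]
    (hF : IsFunctionField k F) (Q : Place F) (N : ℕ) :
    ∃ (R : Type) (_ : Finite R) (φ : Q.Completion → R), ∀ x y, (Valued.v x : ℤᵐ⁰) ≤ 1 →
      (Valued.v y : ℤᵐ⁰) ≤ 1 → φ x = φ y → (Valued.v (x - y) : ℤᵐ⁰) ≤ exp (-N : ℤ) := by
  classical
  have hD : (Finsupp.single Q (-N : ℤ) : Divisor F) ≤ 0 := by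
    intro R
    rw [Finsupp.single_apply]
    split_ifs <;> simp
  have hc := (relCard_ball_le (k := k) (S := {Q}) hF hD).1
  rw [relCard_eq_natCard] at hc
  set A := ball k {Q} (Finsupp.single Q (-N : ℤ) : Divisor F)
  set B := ball k {Q} ((0 : Divisor F) : Place F → ℤ)
  have : Finite (B ⧸ A.submoduleOf B) := Nat.finite_of_card_ne_zero hc
  choose l hl using fun x : Q.Completion => Q.exists_embedding_sub_le x (-N : ℤ)
  have hN : exp (-N : ℤ) ≤ 1 := by rw [← exp_zero, exp_le_exp]; omega
  have hlB : ∀ x, (Valued.v x : ℤᵐ⁰) ≤ 1 → l x ∈ B := fun x hx R hR => by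
    obtain rfl := Set.mem_singleton_iff.1 hR
    have h1 := Valuation.map_add_le _ ((hl x).trans hN) hx
    rwa [sub_add_cancel, Place.valued_embedding] at h1
  let e := Finite.equivFin (B ⧸ A.submoduleOf B)
  -- The default class 0 plays no role, because φ is compared only on integral elements.
  refine ⟨Fin (Nat.card (B ⧸ A.submoduleOf B)), inferInstance,
    fun x => if h : l x ∈ B then e (Submodule.Quotient.mk ⟨l x, h⟩)
      else e 0, fun x y hx hy hxy => ?_⟩
  simp only [dif_pos (hlB x hx), dif_pos (hlB y hy)] at hxy
  have h1 : l x - l y ∈ A := (Submodule.Quotient.eq (A.submoduleOf B)).1 (e.injective hxy)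
  have h2 := h1 Q rfl
  rw [Finsupp.single_eq_same, ← Place.valued_embedding, map_sub] at h2
  have h3 := Valuation.map_add_le _ (Valuation.map_sub_le (v := Valued.v) h2 (hl x)) (hl y)
  convert h3 using 2
  ring

end FiniteIndex

/-! ### Tate cohomology of the semilocal units -/

namespace Semilocal

open WithZero

attribute [local instance] Units.mulDistribMulActionRight

variable {K L : Type*} [Field K] [Field L] [Algebra K L] {P : Place K}

theorem sum_apply {ι : Type*} (s : Finset ι) (f : ι → Semilocal L P)
    (Q : {Q : Place L // P.Over (algebraMap K L) Q}) : (∑ i ∈ s, f i) Q = ∑ i ∈ s, f i Q :=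
  map_sum (Pi.evalRingHom (fun Q : {Q : Place L // P.Over (algebraMap K L) Q} =>
    Q.1.Completion) Q) f s

variable (L P) in
/-- The product of the unit groups `U_Q` over the places `Q` over `P`. -/
def unitGroup : Subgroup (Semilocal L P)ˣ where
  carrier := {u | ∀ Q, (u : Semilocal L P).value Q = 1}
  one_mem' Q := value_one Q
  mul_mem' hu hw Q := by rw [Units.val_mul, value_mul, hu Q, hw Q, one_mul]
  inv_mem' hu Q := by rw [value_inv, hu Q, inv_one]

theorem smul_mem_unitGroup (σ : L ≃ₐ[K] L) {u : (Semilocal L P)ˣ} (hu : u ∈ unitGroup L P) :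
    σ • u ∈ unitGroup L P := fun Q => by
  rw [Units.coe_smul, value_smul, hu]

variable [FiniteDimensional K L]

variable (L P) in
/-- A group of semilocal units whose Tate cohomology is trivial. -/
structure IsAcyclic (σ : L ≃ₐ[K] L) (V : Subgroup (Semilocal L P)ˣ) : Prop where
  le : V ≤ unitGroup L P
  smul_mem : ∀ τ : L ≃ₐ[K] L, ∀ v ∈ V, τ • v ∈ V
  exists_groupNorm : ∀ v ∈ V, (∀ τ : L ≃ₐ[K] L, τ • v = v) →
    ∃ w ∈ V, groupNorm (L ≃ₐ[K] L) (Semilocal L P)ˣ w = v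
  exists_augmentation : ∀ v ∈ V, groupNorm (L ≃ₐ[K] L) (Semilocal L P)ˣ v = 1 →
    ∃ w ∈ V, augmentation (Semilocal L P)ˣ σ w = v

variable [IsGalois K L] [Finite {Q : Place L // P.Over (algebraMap K L) Q}]

variable (P) in
-- The group is 1 + πM for the lattice M of an integral normal basis. It has finite index because
-- units that agree modulo a high power of π differ by a factor in it.
theorem exists_isAcyclic {k : Type*} [Field k] [Finite k] [Algebra k L]
    (hF : IsFunctionField k L) {σ : L ≃ₐ[K] L} (hσ : ∀ τ : L ≃ₐ[K] L, τ ∈ Subgroup.zpowers σ) :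
    ∃ V, IsAcyclic L P σ V ∧ V.relIndex (unitGroup L P) ≠ 0 := by
  obtain ⟨π, hπ0, hπ⟩ := P.exists_valuation_eq_exp (-1)
  have hπ1 : P.valuation π < 1 := by rw [hπ]; exact exp_neg_one_lt_one
  obtain ⟨b, hb⟩ := exists_isIntegralNormalBasis L P
  have h := tateAcyclicLattice hb hσ hπ0 hπ1
  obtain ⟨m, hm⟩ := exists_pow_mul_mem_lattice P hπ1 b
  set ϖ := algebraMap P.Completion (Semilocal L P) (P.embedding π) with hϖ
  have hϖv : ∀ Q, ϖ.value Q = Q.1.valuation (algebraMap K L π) := fun Q => by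
    rw [hϖ, algebraMap_embedding, value_diagonal]
  have hϖ0 : ∀ Q, ϖ.value Q ≠ 0 := fun Q => by
    rw [hϖv, Valuation.ne_zero_iff]
    exact (map_ne_zero _).2 hπ0
  refine ⟨h.units 0, ⟨?_, fun τ v hv => h.smul_mem_units hv τ,
    fun v hv hfix => h.exists_groupNorm_eq hv hfix,
    fun v hv hN => h.exists_augmentation_eq hv hN⟩, ?_⟩
  · intro u hu Q
    obtain ⟨x, hx, hux⟩ := TateAcyclicLattice.mem_units_zero.1 hu
    refine value_eq_one_of_sub_one_lt ?_
    rw [hux, add_sub_cancel_left, value_mul, hϖv]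
    exact (mul_le_of_le_one_right' (value_le_one_of_mem_lattice hb hx Q)).trans_lt
      (Q.2.lt_one hπ1)
  -- Of the exponent m + 1, m factors bring integral elements into M and one is the factor π in 1 +
  -- πM.
  · obtain ⟨N, hN⟩ := exists_exp_neg_le (fun Q => (ϖ ^ (m + 1)).value Q) fun Q => by
      rw [value_pow]
      exact pow_ne_zero _ (hϖ0 Q)
    choose R hR φ hφ using fun Q : {Q : Place L // P.Over (algebraMap K L) Q} =>
      Q.1.exists_finite_residues hF N.toNat
    refine relIndex_ne_zero_of_finite (R := ∀ Q, R Q)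
      (fun u Q => φ Q ((u.1 : Semilocal L P) Q)) fun ⟨u, hu⟩ ⟨w, hw⟩ huw => ?_
    rw [TateAcyclicLattice.mem_units_zero]
    have hval : ∀ Q, ((w : Semilocal L P) - u).value Q ≤ (ϖ ^ (m + 1)).value Q := fun Q => by
      refine (hφ Q _ _ (hw Q).le (hu Q).le (congrFun huw Q).symm).trans (le_trans ?_ (hN Q))
      rw [exp_le_exp]
      have := Int.self_le_toNat N
      omega
    obtain ⟨t, ht⟩ := isUnit_of_value_ne_zero hϖ0
    refine ⟨ϖ ^ m * ((↑(t ^ (m + 1))⁻¹ : Semilocal L P) * ((↑u⁻¹ : Semilocal L P) * (w - u))),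
      hm _ fun Q => ?_, ?_⟩
    · rw [value_mul, value_mul, value_inv, value_inv, hu Q, inv_one, one_mul, Units.val_pow_eq_pow_val,
        ht]
      refine (inv_mul_le_iff₀ ?_).2 ?_
      · rw [value_pow]
        exact pow_pos (zero_lt_iff.2 (hϖ0 Q)) _
      · rw [mul_one]
        exact hval Q
    · have h1 : (↑(t ^ (m + 1)) : Semilocal L P) * (↑(t ^ (m + 1))⁻¹ : Semilocal L P) = 1 :=
        Units.mul_inv _
      have h2 : (↑u⁻¹ : Semilocal L P) * u = 1 := u.inv_mul
      rw [Units.val_pow_eq_pow_val, ht] at h1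
      rw [Units.val_mul]
      linear_combination -((↑u⁻¹ : Semilocal L P) * (w - u)) * h1 + h2

/-- Powers of an element of nontrivial value are distinct. The infinity of K ensures that L is not a
union of finitely many proper K-subspaces. -/
theorem _root_.GlobalClassField.Place.infinite (P : Place K) : Infinite K := by
  obtain ⟨π, -, hπ⟩ := P.exists_valuation_eq_exp 1
  refine Infinite.of_injective (fun n : ℕ => π ^ n) fun m n hmn => ?_
  have := congrArg P.valuation hmn
  simp only [map_pow, hπ, ← exp_nsmul, exp_inj] at this
  simpa using this

omit [IsGalois K L] in
/-- Hilbert's Theorem 90 for `∏_{Q ∣ P} L_Q`. -/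
theorem exists_augmentation_eq {σ : L ≃ₐ[K] L} (hσ : ∀ τ : L ≃ₐ[K] L, τ ∈ Subgroup.zpowers σ)
    {u : (Semilocal L P)ˣ} (hu : groupNorm (L ≃ₐ[K] L) (Semilocal L P)ˣ u = 1) :
    ∃ w, augmentation (Semilocal L P)ˣ σ w = u := by
  classical
  have := P.infinite
  have := Fintype.ofFinite {Q : Place L // P.Over (algebraMap K L) Q}
  set n := orderOf σ with hn
  have hn0 : 0 < n := orderOf_pos σ
  obtain ⟨f, hf0, hf⟩ := exists_twisted_trace hσ (u := (u : Semilocal L P))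
    (by rw [← TateAcyclicLattice.groupNorm_eq, hu, Units.val_one])
  let β : L →+ Semilocal L P :=
    ∑ i ∈ Finset.range n, (AddMonoidHom.mulLeft (f i)).comp
      ((diagonal P).toAddMonoidHom.comp ((σ ^ i : L ≃ₐ[K] L) : L →+* L).toAddMonoidHom)
  have hβ : ∀ l, β l = ∑ i ∈ Finset.range n, f i * diagonal P ((σ ^ i) l) :=
    fun l => by
      simp only [β, AddMonoidHom.finsetSum_apply]
      rfl
  have hβσ : ∀ l, (u : Semilocal L P) * σ • β l = β l := fun l => by
    have h1 := hf (diagonal P l)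
    simp only [smul_diagonal] at h1
    rwa [hβ]
  have hβK : ∀ (c : K) (l : L), β (c • l) = diagonal P (algebraMap K L c) * β l := fun c l => by
    rw [hβ, hβ, Finset.mul_sum]
    refine Finset.sum_congr rfl fun i _ => ?_
    rw [Algebra.smul_def, map_mul, AlgEquiv.commutes, map_mul]
    ring
  -- The twisted trace must be nonzero at all Q simultaneously. At each Q its zeros form a
  -- K-subspace, proper by independence of characters, and finitely many proper subspaces do not
  -- cover L.
  let κ : {Q : Place L // P.Over (algebraMap K L) Q} → Submodule K L := fun Q =>
    { carrier := {l | (β l).value Q = 0}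
      zero_mem' := by
        change (β 0).value Q = 0
        rw [map_zero, value_zero]
      add_mem' := fun {x y} hx hy => by
        change (β (x + y)).value Q = 0
        rw [map_add]
        exact le_antisymm (value_add_le hx.le hy.le) zero_le
      smul_mem' := fun c x hx => by
        change (β (c • x)).value Q = 0
        rw [hβK, value_mul, show (β x).value Q = 0 from hx, mul_zero] }
  have htop : ∀ Q, κ Q ≠ ⊤ := fun Q hQ => by
    have hli := (linearIndependent_monoidHom L Q.1.Completion).comp
      (fun i : Fin n => ((Q.1.embedding.comp ((σ ^ (i : ℕ) : L ≃ₐ[K] L) : L →+* L) :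
        L →+* Q.1.Completion) : L →* Q.1.Completion)) fun i j hij => by
          refine Fin.ext (pow_injOn_Iio_orderOf i.2 j.2 (AlgEquiv.ext fun l => ?_))
          exact Q.1.embedding.injective (DFunLike.congr_fun hij l)
    rw [Fintype.linearIndependent_iff] at hli
    have h0 := hli (fun i => f i Q) (funext fun l => by
      have hl : l ∈ κ Q := by rw [hQ]; trivial
      have h1 : (β l) Q = 0 := (Valuation.zero_iff (Valued.v (R := Q.1.Completion))).1 hl
      rw [hβ, ← Fin.sum_univ_eq_sum_range
        (fun i => f i * diagonal P ((σ ^ i) l))] at h1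
      rw [sum_apply] at h1
      rw [Finset.sum_apply]
      exact h1) ⟨0, hn0⟩
    rw [hf0] at h0
    exact one_ne_zero (α := Q.1.Completion) h0
  obtain ⟨l, hl⟩ : ∃ l, ∀ Q, l ∉ κ Q := by
    have h1 : ⊤ ∉ Finset.univ.image κ := fun h => by
      obtain ⟨Q, -, hQ⟩ := Finset.mem_image.1 h
      exact htop Q hQ
    have h2 := Subspace.biUnion_ne_univ_of_top_notMem h1
    rw [Ne, Set.eq_univ_iff_forall] at h2
    push Not at h2
    obtain ⟨l, hl⟩ := h2
    refine ⟨l, fun Q hQ => hl ?_⟩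
    exact Set.mem_biUnion (Finset.mem_image_of_mem κ (Finset.mem_univ Q)) hQ
  obtain ⟨w, hw⟩ := isUnit_of_value_ne_zero hl
  refine ⟨w⁻¹, ?_⟩
  have : u * σ • w = w := Units.ext (by rw [Units.val_mul, Units.coe_smul, hw]; exact hβσ l)
  rw [augmentation_apply, smul_inv', inv_div_inv, div_eq_iff_eq_mul]
  exact this.symm

/-- At a place which is unramified in `L`, the unit group has trivial Tate cohomology. -/
theorem isAcyclic_unitGroup {k : Type*} [Field k] [Finite k] [Algebra k L]
    (hF : IsFunctionField k L) {σ : L ≃ₐ[K] L} (hσ : ∀ τ : L ≃ₐ[K] L, τ ∈ Subgroup.zpowers σ)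
    {π : K} (hπ : ∀ Q : Place L, P.Over (algebraMap K L) Q →
      Q.valuation (algebraMap K L π) = exp (-1)) :
    IsAcyclic L P σ (unitGroup L P) := by
  have haug : ∀ v ∈ unitGroup L P, groupNorm (L ≃ₐ[K] L) (Semilocal L P)ˣ v = 1 →
      ∃ w ∈ unitGroup L P, augmentation (Semilocal L P)ˣ σ w = v := by
    intro v hv hN
    obtain ⟨w, hw⟩ := exists_augmentation_eq hσ hN
    -- Theorem 90 gives w that need not be a unit. Since v is a unit, w and σw have equal values, so
    -- the powers of π, a uniformiser at every Q, with the values of w form a σ-invariant element;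
    -- dividing by it leaves a unit.
    let c : Semilocal L P := fun Q =>
      Q.1.embedding (algebraMap K L π) ^ (-log ((w : Semilocal L P).value Q))
    have hc : ∀ Q, c.value Q = (w : Semilocal L P).value Q := fun Q => by
      change Valued.v (Q.1.embedding (algebraMap K L π) ^ (-log ((w : Semilocal L P).value Q))) = _
      rw [map_zpow₀, Q.1.valued_embedding, hπ _ Q.2, ← exp_zsmul]
      rw [smul_eq_mul, neg_mul_neg, mul_one, exp_log (value_unit_ne_zero w Q)]
    obtain ⟨z, hz⟩ := isUnit_of_value_ne_zero fun Q => by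
      rw [hc]
      exact value_unit_ne_zero w Q
    have hwσ : ∀ Q, (σ • (w : Semilocal L P)).value Q = (w : Semilocal L P).value Q := fun Q => by
      have h1 : σ • w = v * w := by rw [← hw, augmentation_apply, div_mul_cancel]
      rw [← Units.coe_smul, h1, Units.val_mul, value_mul, hv Q, one_mul]
    have hcσ : σ • c = c := funext fun Q => by
      have h1 := hwσ Q
      rw [value_smul] at h1
      change (Q.1.comap_over (σ : L ≃+* L)).map
        ((Q.1.comap (σ : L ≃+* L)).embedding (algebraMap K L π) ^ _) = _
      rw [map_zpow₀, Place.Over.map_embedding]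
      change Q.1.embedding (σ (algebraMap K L π)) ^ _ = _
      rw [AlgEquiv.commutes, h1]
    have hzσ : σ • z = z := Units.ext (by rw [Units.coe_smul, hz, hcσ])
    refine ⟨w / z, fun Q => ?_, ?_⟩
    · rw [div_eq_mul_inv, Units.val_mul, value_mul, value_inv, hz, hc,
        mul_inv_cancel₀ (value_unit_ne_zero w Q)]
    · rw [map_div, hw, augmentation_apply, hzσ, div_self', div_one]
  refine ⟨le_rfl, fun τ v hv => smul_mem_unitGroup τ hv, ?_, haug⟩
  -- Surjectivity of the norm onto invariants is not proved directly: the Herbrand quotient of the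
  -- units is 1 by comparison with V, and H⁻¹ has just been seen to vanish.
  obtain ⟨V, hV, hind⟩ := exists_isAcyclic P hF hσ
  let d := augmentation (Semilocal L P)ˣ σ
  let e := groupNorm (L ≃ₐ[K] L) (Semilocal L P)ˣ
  have hde : ∀ x, d (e x) = 1 := augmentation_groupNorm σ
  have hed : ∀ x, e (d x) = 1 := groupNorm_augmentation σ
  have hVd : V.map d ≤ V := by
    rintro _ ⟨x, hx, rfl⟩
    exact div_mem (hV.smul_mem σ x hx) hx
  have hVe : V.map e ≤ V := by
    rintro _ ⟨x, hx, rfl⟩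
    exact groupNorm_mem hV.smul_mem hx
  have hUd : (unitGroup L P).map d ≤ unitGroup L P := by
    rintro _ ⟨x, hx, rfl⟩
    exact div_mem (smul_mem_unitGroup σ hx) hx
  have hUe : (unitGroup L P).map e ≤ unitGroup L P := by
    rintro _ ⟨x, hx, rfl⟩
    exact groupNorm_mem (fun τ x hx => smul_mem_unitGroup τ hx) hx
  have h1 : HasHerbrand d e V 1 := hasHerbrand_one_of_trivial
    (fun v hv => hV.exists_groupNorm v hv.1 ((augmentation_eq_one_iff hσ).1 hv.2))
    (fun v hv => hV.exists_augmentation v hv.1 hv.2)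
  have h2 := HasHerbrand.of_relIndex_ne_zero hde hed hUd hUe hVd hVe hV.le hind h1
  have h3 : tateCard e d (unitGroup L P) = 1 :=
    Subgroup.relIndex_eq_one.2 fun v hv => haug v hv.1 hv.2
  have h4 : tateCard d e (unitGroup L P) = 1 := by
    have := h2.eq
    rw [h3, Nat.cast_one, div_one] at this
    exact_mod_cast this
  intro v hv hfix
  exact Subgroup.relIndex_eq_one.1 h4 ⟨hv, (augmentation_eq_one_iff hσ).2 hfix⟩

end Semilocal

/-! ### Finiteness of fibres and of ramification -/

section Ramification

open WithZero

variable {k K L : Type*} [Field k] [Finite k] [Field K] [Field L] [Algebra k L] [Algebra K L]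

/-- All places above P are zeros of one nonzero function, a uniformiser of P. -/
theorem finite_places_over (hL : IsFunctionField k L) (P : Place K) :
    Finite {Q : Place L // P.Over (algebraMap K L) Q} := by
  obtain ⟨π, hπ0, hπ⟩ := P.exists_valuation_eq_exp (-1)
  refine ((finite_setOf_valuation_ne_one hL ((map_ne_zero (algebraMap K L)).2 hπ0)).subset
    fun Q (hQ : P.Over (algebraMap K L) Q) => ?_ :
      {Q : Place L | P.Over (algebraMap K L) Q}.Finite)
  exact (hQ.lt_one (by rw [hπ]; exact exp_neg_one_lt_one)).ne

variable [FiniteDimensional K L] [IsGalois K L]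

/-- Almost all places are unramified. -/
theorem finite_ramified (hL : IsFunctionField k L) :
    {P : Place K | ¬ ∃ π : K, ∀ Q : Place L, P.Over (algebraMap K L) Q →
      Q.valuation (algebraMap K L π) = exp (-1)}.Finite := by
  classical
  let b := IsGalois.normalBasis K L
  have h1 : {Q : Place L | ∃ p : (L ≃ₐ[K] L) × (L ≃ₐ[K] L), Q.valuation (b p.1) ≠ 1 ∨
      Q.valuation (p.1 (b.traceDual p.2)) ≠ 1}.Finite := by
    have : {Q : Place L | ∃ p : (L ≃ₐ[K] L) × (L ≃ₐ[K] L), Q.valuation (b p.1) ≠ 1 ∨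
      Q.valuation (p.1 (b.traceDual p.2)) ≠ 1} = ⋃ p : (L ≃ₐ[K] L) × (L ≃ₐ[K] L),
        ({Q : Place L | Q.valuation (b p.1) ≠ 1} ∪
          {Q : Place L | Q.valuation (p.1 (b.traceDual p.2)) ≠ 1}) := by
      ext Q
      simp
    rw [this]
    exact Set.finite_iUnion fun p => (finite_setOf_valuation_ne_one hL (b.ne_zero _)).union
      (finite_setOf_valuation_ne_one hL ((map_ne_zero p.1).2 (b.traceDual.ne_zero _)))
  -- Discard the places below those where a basis vector or a conjugate of a dual basis vector is
  -- not a unit. At the remaining P, an element z small at all Q above P has coordinates Tr(z b_i*)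
  -- divisible by π, so z is no larger than π at each Q.
  refine (h1.image (Place.below K)).subset fun P hP => ?_
  by_contra hPim
  have hgood : ∀ Q : Place L, P.Over (algebraMap K L) Q → ∀ σ τ : L ≃ₐ[K] L,
      Q.valuation (b σ) = 1 ∧ Q.valuation (σ (b.traceDual τ)) = 1 := fun Q hQ σ τ => by
    by_contra hc
    refine hPim ⟨Q, ⟨(σ, τ), ?_⟩, hQ.below_eq⟩
    rwa [← not_and_or]
  refine hP ?_
  obtain ⟨π, hπ0, hπ⟩ := P.exists_valuation_eq_exp (-1)
  have := finite_places_over hL P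
  have hfin : {Q : Place L | P.Over (algebraMap K L) Q}.Finite := this
  refine ⟨π, fun Q hQ => le_antisymm (lt_one_iff_le_exp.1
    (hQ.lt_one (by rw [hπ]; exact exp_neg_one_lt_one))) ?_⟩
  obtain ⟨t, -, ht⟩ := Q.exists_valuation_eq_exp (-1)
  -- Precision -2 makes z a uniformiser at Q and still small at the other places above P. Hence π
  -- has value at least exp(-1) at Q.
  obtain ⟨z, hz⟩ := Place.exists_approx hfin.toFinset (fun R => if R = Q then t else 0) (-2)
  have hzQ : Q.valuation z = exp (-1) := by
    have h2 := hz Q (hfin.mem_toFinset.2 hQ)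
    rw [if_pos rfl] at h2
    have h3 : Q.valuation (z - t) < Q.valuation t := by
      rw [ht]
      exact h2.trans_lt (exp_lt_exp.2 (by norm_num))
    rw [← ht, ← Valuation.map_add_eq_of_lt_left _ h3, add_sub_cancel]
  have hzlt : ∀ R, P.Over (algebraMap K L) R → R.valuation z < 1 := fun R hR => by
    by_cases hRQ : R = Q
    · rw [hRQ, hzQ]
      exact exp_neg_one_lt_one
    · have h2 := hz R (hfin.mem_toFinset.2 hR)
      rw [if_neg hRQ, sub_zero] at h2
      refine h2.trans_lt ?_
      rw [← exp_zero, exp_lt_exp]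
      norm_num
  have hcoord : ∀ i, b.repr z i = Algebra.trace K L (z * b.traceDual i) := fun i => by
    conv_rhs => rw [← b.sum_repr z]
    simp only [Finset.sum_mul, map_sum, smul_mul_assoc, map_smul, smul_eq_mul,
      Module.Basis.trace_mul_traceDual]
    simp
  have hc : ∀ i, Q.valuation (algebraMap K L (b.repr z i)) ≤ Q.valuation (algebraMap K L π) := by
    intro i
    have h2 : Q.valuation (algebraMap K L (b.repr z i)) < 1 := by
      rw [hcoord, trace_eq_sum_automorphisms]
      refine Valuation.map_sum_lt _ one_ne_zero fun τ _ => ?_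
      rw [map_mul, map_mul, (hgood Q hQ τ i).2, mul_one]
      exact hzlt _ (hQ.comap_algEquiv τ)
    have h3 : P.valuation (b.repr z i) ≤ P.valuation π := by
      rw [hπ]
      exact lt_one_iff_le_exp.1 (hQ.lt_one_iff_lt_one.2 h2)
    exact (hQ _ _).1 h3
  rw [← hzQ]
  conv_lhs => rw [← b.sum_repr z]
  refine Valuation.map_sum_le _ fun i _ => ?_
  rw [Algebra.smul_def, map_mul, (hgood Q hQ i 1).1, mul_one]
  exact hc i

end Ramification

/-! ### Unit ideles have Herbrand quotient 1 -/

section UnitIdeles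

open WithZero

attribute [local instance] Units.mulDistribMulActionRight

/-- The idele with given components. -/
def Ideles.mk {F : Type*} [Field F] (f : (P : Place F) → P.Completionˣ)
    (hf : {P | f P ∉ P.unitGroup}.Finite) : Ideles F :=
  RestrictedProduct.mk f hf

theorem Ideles.mk_apply {F : Type*} [Field F] {f : (P : Place F) → P.Completionˣ}
    (hf : {P | f P ∉ P.unitGroup}.Finite) (P : Place F) : Ideles.mk f hf P = f P := rfl

theorem Ideles.finite_notMem {F : Type*} [Field F] (α : Ideles F) :
    {P | α P ∉ P.unitGroup}.Finite :=
  α.2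

theorem Ideles.mul_apply {F : Type*} [Field F] (α β : Ideles F) (P : Place F) :
    (α * β) P = α P * β P := rfl

variable (F : Type*) [Field F] in
/-- The group `∏ U_P` of unit ideles. -/
def unitIdeles : Subgroup (Ideles F) where
  carrier := {α | ∀ P, α P ∈ P.unitGroup}
  one_mem' P := one_mem P.unitGroup
  mul_mem' hα hβ P := mul_mem (hα P) (hβ P)
  inv_mem' hα P := inv_mem (hα P)

variable {K L : Type*} [Field K] [Field L] [Algebra K L]

/-- The components over `P` of an idele. -/
def semilocalUnit (P : Place K) : Ideles L →* (Semilocal L P)ˣ :=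
  (semilocalComponent L P).toHomUnits

theorem semilocalUnit_smul (P : Place K) (σ : L ≃ₐ[K] L) (α : Ideles L) :
    semilocalUnit P (σ • α) = σ • semilocalUnit P α :=
  Units.ext (semilocalComponent_smul P σ α)

theorem mem_unitIdeles_iff [Algebra.IsAlgebraic K L] {α : Ideles L} :
    α ∈ unitIdeles L ↔ ∀ P : Place K, semilocalUnit P α ∈ Semilocal.unitGroup L P :=
  ⟨fun h _ Q => h Q.1, fun h Q => h (Q.below K) ⟨Q, Q.below_over⟩⟩

theorem ideles_ext [Algebra.IsAlgebraic K L] {α β : Ideles L}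
    (h : ∀ P : Place K, semilocalUnit P α = semilocalUnit P β) : α = β := by
  refine DFunLike.ext _ _ fun Q => Units.ext ?_
  exact congrFun (congrArg Units.val (h (Q.below K))) ⟨Q, Q.below_over⟩

/-- Each place of L lies over exactly one place of K, so the components glue. Finite fibres keep the
set of non-unit components finite. -/
theorem exists_semilocalUnit_eq [Algebra.IsAlgebraic K L] (w : (P : Place K) → (Semilocal L P)ˣ)
    (hw : {P | w P ∉ Semilocal.unitGroup L P}.Finite)
    (hfin : ∀ P : Place K, Finite {Q : Place L // P.Over (algebraMap K L) Q}) :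
    ∃ α : Ideles L, ∀ P, semilocalUnit P α = w P := by
  let f : (Q : Place L) → Q.Completionˣ := fun Q =>
    Units.map (Pi.evalMonoidHom (fun R : {R : Place L // (Q.below K).Over (algebraMap K L) R} =>
      R.1.Completion) ⟨Q, Q.below_over⟩) (w (Q.below K))
  have hf : {Q | f Q ∉ Q.unitGroup}.Finite := by
    refine (hw.biUnion (t := fun P => {Q | P.Over (algebraMap K L) Q})
      fun P _ => hfin P).subset fun Q hQ => ?_
    refine Set.mem_biUnion (x := Q.below K) ?_ Q.below_over
    exact fun h => hQ (h ⟨Q, Q.below_over⟩)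
  refine ⟨Ideles.mk f hf, fun P => Units.ext (funext fun Q => ?_)⟩
  obtain ⟨Q, hQ⟩ := Q
  obtain rfl := hQ.below_eq
  rfl

theorem smul_mem_unitIdeles (σ : L ≃ₐ[K] L) {α : Ideles L} (h : α ∈ unitIdeles L) :
    σ • α ∈ unitIdeles L := fun Q => by
  change (Valued.v (((σ • α) Q : Q.Completionˣ) : Q.Completion) : ℤᵐ⁰) = 1
  rw [smul_ideles_apply, Place.valued_map_comap]
  exact h _

theorem map_augmentation_unitIdeles_le (σ : L ≃ₐ[K] L) :
    (unitIdeles L).map (augmentation (Ideles L) σ) ≤ unitIdeles L := by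
  rintro _ ⟨α, hα, rfl⟩
  exact div_mem (smul_mem_unitIdeles σ hα) hα

theorem map_groupNorm_unitIdeles_le [FiniteDimensional K L] :
    (unitIdeles L).map (groupNorm (L ≃ₐ[K] L) (Ideles L)) ≤ unitIdeles L := by
  rintro _ ⟨α, hα, rfl⟩
  exact groupNorm_mem (fun τ x hx => smul_mem_unitIdeles τ hx) hα

variable [FiniteDimensional K L] [IsGalois K L]

/-- The unit ideles have Herbrand quotient one. -/
theorem hasHerbrand_unitIdeles {k : Type*} [Field k] [Finite k] [Algebra k L]
    (hL : IsFunctionField k L) {σ : L ≃ₐ[K] L} (hσ : ∀ τ : L ≃ₐ[K] L, τ ∈ Subgroup.zpowers σ) :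
    HasHerbrand (augmentation (Ideles L) σ) (groupNorm (L ≃ₐ[K] L) (Ideles L))
      (unitIdeles L) 1 := by
  have hfin := fun P : Place K => finite_places_over hL P
  let S : Set (Place K) := {P : Place K | ¬ ∃ π : K, ∀ Q : Place L, P.Over (algebraMap K L) Q →
      Q.valuation (algebraMap K L π) = exp (-1)}
  have hS : S.Finite := finite_ramified hL
  -- Taking all units outside the finite set S is what gives the product W of these groups finite
  -- index in the unit ideles. W is acyclic because preimages can be chosen separately over each P.
  have hV : ∀ P : Place K, ∃ V, Semilocal.IsAcyclic L P σ V ∧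
      V.relIndex (Semilocal.unitGroup L P) ≠ 0 ∧ (P ∉ S → V = Semilocal.unitGroup L P) := by
    intro P
    by_cases hP : P ∈ S
    · obtain ⟨V, hV, hV'⟩ := Semilocal.exists_isAcyclic P hL hσ
      exact ⟨V, hV, hV', fun h => (h hP).elim⟩
    · obtain ⟨π, hπ⟩ := not_not.1 hP
      exact ⟨_, Semilocal.isAcyclic_unitGroup hL hσ hπ, by simp, fun _ => rfl⟩
  choose V hV hVind hVS using hV
  let W : Subgroup (Ideles L) := ⨅ P : Place K, (V P).comap (semilocalUnit P)
  have hW : ∀ {α}, α ∈ W ↔ ∀ P, semilocalUnit P α ∈ V P := by simp [W, Subgroup.mem_iInf]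
  have hWU : W ≤ unitIdeles L := fun α hα => mem_unitIdeles_iff.2 fun P => (hV P).le (hW.1 hα P)
  have hWsmul : ∀ τ : L ≃ₐ[K] L, ∀ α ∈ W, τ • α ∈ W := fun τ α hα => hW.2 fun P => by
    rw [semilocalUnit_smul]
    exact (hV P).smul_mem τ _ (hW.1 hα P)
  have hassemble : ∀ w : (P : Place K) → (Semilocal L P)ˣ, (∀ P, w P ∈ V P) →
      ∃ α ∈ W, ∀ P, semilocalUnit P α = w P := fun w hw => by
    obtain ⟨α, hα⟩ := exists_semilocalUnit_eq w
      (Set.finite_empty.subset fun P hP => hP ((hV P).le (hw P))) hfin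
    exact ⟨α, hW.2 fun P => by rw [hα]; exact hw P, hα⟩
  have hind : W.relIndex (unitIdeles L) ≠ 0 := by
    have := hS.to_subtype
    have h1 : (⨅ P : S, (V P).comap (semilocalUnit P.1)).relIndex (unitIdeles L) ≠ 0 := by
      refine Subgroup.relIndex_iInf_ne_zero fun P => ?_
      rw [Subgroup.relIndex_comap]
      intro h0
      refine hVind P (Subgroup.relIndex_eq_zero_of_le_right ?_ h0)
      rintro _ ⟨α, hα, rfl⟩
      exact mem_unitIdeles_iff.1 hα P.1
    rw [← Subgroup.inf_relIndex_right] at h1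
    refine fun h0 => h1 (Subgroup.relIndex_eq_zero_of_le_left ?_ h0)
    rintro α ⟨hα, hα'⟩
    refine hW.2 fun P => ?_
    by_cases hP : P ∈ S
    · exact (Subgroup.mem_iInf.1 hα) ⟨P, hP⟩
    · rw [hVS P hP]
      exact mem_unitIdeles_iff.1 hα' P
  refine HasHerbrand.of_relIndex_ne_zero (augmentation_groupNorm σ) (groupNorm_augmentation σ)
    (map_augmentation_unitIdeles_le σ) map_groupNorm_unitIdeles_le ?_ ?_ hWU hind
    (hasHerbrand_one_of_trivial ?_ ?_)
  · rintro _ ⟨α, hα, rfl⟩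
    exact div_mem (hWsmul σ α hα) hα
  · rintro _ ⟨α, hα, rfl⟩
    exact groupNorm_mem hWsmul hα
  · rintro α ⟨hα, hfix⟩
    have hfix' := (augmentation_eq_one_iff hσ).1 hfix
    choose w hw hw' using fun P => (hV P).exists_groupNorm (semilocalUnit P α) (hW.1 hα P)
      fun τ => by rw [← semilocalUnit_smul, hfix']
    obtain ⟨β, hβ, hβw⟩ := hassemble w hw
    refine ⟨β, hβ, ideles_ext (K := K) fun P => ?_⟩
    rw [map_groupNorm _ (semilocalUnit_smul P), hβw, hw']
  · rintro α ⟨hα, hN⟩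
    have hN' : groupNorm (L ≃ₐ[K] L) (Ideles L) α = 1 := hN
    choose w hw hw' using fun P => (hV P).exists_augmentation (semilocalUnit P α) (hW.1 hα P)
      (by rw [← map_groupNorm _ (semilocalUnit_smul P), hN', map_one])
    obtain ⟨β, hβ, hβw⟩ := hassemble w hw
    refine ⟨β, hβ, ideles_ext (K := K) fun P => ?_⟩
    rw [map_augmentation _ (semilocalUnit_smul P), hβw, hw']

end UnitIdeles

/-! ### Degree of idele classes and the unit classes -/

section Degree

open WithZero

variable {k F : Type*} [Field k] [Field F] [Algebra k F]

/-- The divisor of an idele. -/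
def ideleDivisor : Ideles F →* Multiplicative (Divisor F) where
  toFun α := Multiplicative.ofAdd (Finsupp.ofSupportFinite
    (fun Q => log (Valued.v (α Q : Q.Completion) : ℤᵐ⁰)) (α.finite_notMem.subset fun Q hQ h => hQ (by
      change log (Valued.v (α Q : Q.Completion) : ℤᵐ⁰) = 0
      rw [show (Valued.v (α Q : Q.Completion) : ℤᵐ⁰) = 1 from h, log_one])))
  map_one' := by
    refine Multiplicative.toAdd.injective (Finsupp.ext fun Q => ?_)
    change log (Valued.v (1 : Q.Completion) : ℤᵐ⁰) = 0
    rw [map_one, log_one]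
  map_mul' α β := by
    refine Multiplicative.toAdd.injective (Finsupp.ext fun Q => ?_)
    change log (Valued.v ((α Q : Q.Completion) * (β Q : Q.Completion)) : ℤᵐ⁰) = _
    rw [map_mul, log_mul ((Valuation.ne_zero_iff _).2 (α Q).ne_zero)
      ((Valuation.ne_zero_iff _).2 (β Q).ne_zero)]
    rfl

theorem ideleDivisor_apply (α : Ideles F) (Q : Place F) :
    (ideleDivisor α).toAdd Q = log (Valued.v (α Q : Q.Completion) : ℤᵐ⁰) := rfl

theorem mem_unitIdeles_iff_ideleDivisor {α : Ideles F} :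
    α ∈ unitIdeles F ↔ ideleDivisor α = 1 := by
  constructor
  · refine fun h => Multiplicative.toAdd.injective (Finsupp.ext fun Q => ?_)
    rw [ideleDivisor_apply, show (Valued.v (α Q : Q.Completion) : ℤᵐ⁰) = 1 from h Q, log_one]
    rfl
  · intro h Q
    have h1 := ideleDivisor_apply α Q
    rw [h] at h1
    change (Valued.v (α Q : Q.Completion) : ℤᵐ⁰) = 1
    have h2 : (Valued.v (α Q : Q.Completion) : ℤᵐ⁰) ≠ 0 :=
      (Valuation.ne_zero_iff _).2 (α Q).ne_zero
    rw [← exp_log h2, ← h1]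
    rfl

theorem mem_principalIdeles_iff {α : Ideles F} :
    α ∈ principalIdeles F ↔ ∃ y : Fˣ, ∀ Q : Place F, (α Q : Q.Completion) = Q.embedding y := by
  constructor
  · rintro ⟨y, hy⟩
    exact ⟨y, fun Q => (congrArg Units.val (congrFun hy Q)).symm⟩
  · rintro ⟨y, hy⟩
    exact ⟨y, funext fun Q => Units.ext (hy Q).symm⟩

variable [Finite k]

theorem ideleDivisor_of_forall_eq (hF : IsFunctionField k F) {α : Ideles F} {y : F} (hy0 : y ≠ 0)
    (h : ∀ Q : Place F, (α Q : Q.Completion) = Q.embedding y) :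
    (ideleDivisor α).toAdd = principalDivisor hF y hy0 := by
  ext Q
  rw [ideleDivisor_apply, h, Q.valued_embedding, principalDivisor_apply]

theorem exists_principalIdele (hF : IsFunctionField k F) (y : Fˣ) :
    ∃ α : Ideles F, ∀ Q : Place F, (α Q : Q.Completion) = Q.embedding y := by
  refine ⟨Ideles.mk (fun Q => Units.map (Q.embedding : F →* Q.Completion) y)
    ((finite_setOf_valuation_ne_one hF y.ne_zero).subset fun Q hQ h => hQ ?_), fun Q => rfl⟩
  exact (Q.valued_embedding _).trans h

variable (k) in
/-- The degree of an idele. -/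
def ideleDegree : Ideles F →* Multiplicative ℤ :=
  (Divisor.deg k).toAddMonoidHom.toMultiplicative.comp ideleDivisor

theorem ideleDegree_apply (α : Ideles F) :
    (ideleDegree k α).toAdd = Divisor.deg k (ideleDivisor α).toAdd := rfl

/-- The degree of an idele class. -/
def classDegree (hF : IsFunctionField k F) : IdeleClassGroup F →* Multiplicative ℤ :=
  QuotientGroup.lift _ (ideleDegree k) fun α hα => by
    obtain ⟨y, hy⟩ := mem_principalIdeles_iff.1 hα
    refine Multiplicative.toAdd.injective ?_
    rw [ideleDegree_apply, ideleDivisor_of_forall_eq hF y.ne_zero hy, deg_principalDivisor]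
    rfl

/-- Only the order of the residue field enters the degree, so σ need not fix the constants k. -/
theorem placeDeg_comap (σ : F ≃+* F) (Q : Place F) : placeDeg k (Q.comap σ) = placeDeg k Q := by
  have hball : ∀ m : ℤ, (ball k {Q.comap σ} fun _ => m).toAddSubgroup =
      (ball k {Q} fun _ => m).toAddSubgroup.comap (σ : F →+ F) := fun m => by
    ext x
    simp only [Submodule.mem_toAddSubgroup, AddSubgroup.mem_comap, mem_ball,
      Set.mem_singleton_iff, forall_eq]
    rfl
  have : residueCard k (Q.comap σ) = residueCard k Q := by
    change AddSubgroup.relIndex _ _ = AddSubgroup.relIndex _ _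
    have h0 : ∀ R : Place F, ball k {R} 0 = ball k {R} fun _ => 0 := fun _ => rfl
    rw [h0, h0, hball, hball, AddSubgroup.relIndex_comap,
      AddSubgroup.map_comap_eq_self_of_surjective]
    exact σ.surjective
  rw [placeDeg, placeDeg, this]

theorem ideleDegree_smul {K : Type*} [Field K] [Algebra K F] (σ : F ≃ₐ[K] F) (α : Ideles F) :
    ideleDegree k (σ • α) = ideleDegree k α := by
  let f : Place F ≃ Place F :=
    ⟨Place.comap (σ : F ≃+* F).symm, Place.comap (σ : F ≃+* F),
      fun Q => Place.ext (Valuation.ext fun x => by simp [Place.comap]),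
      fun Q => Place.ext (Valuation.ext fun x => by simp [Place.comap])⟩
  have h : (ideleDivisor (σ • α)).toAdd = Finsupp.equivMapDomain f (ideleDivisor α).toAdd := by
    ext Q
    rw [ideleDivisor_apply, smul_ideles_apply, Place.valued_map_comap]
    rfl
  refine Multiplicative.toAdd.injective ?_
  rw [ideleDegree_apply, ideleDegree_apply, h, Divisor.deg, Finsupp.linearCombination_equivMapDomain]
  congr 2
  funext Q
  exact congrArg Nat.cast (placeDeg_comap _ Q)

theorem classDegree_smul (hF : IsFunctionField k F) {K : Type*} [Field K] [Algebra K F]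
    (σ : F ≃ₐ[K] F) (c : IdeleClassGroup F) : classDegree hF (σ • c) = classDegree hF c := by
  induction c using QuotientGroup.induction_on with
  | H α => exact ideleDegree_smul σ α

/-- An idele of value exp 1 at a single place Q and 1 elsewhere has degree deg Q > 0. Nothing finer
is needed, since all nonzero subgroups of ℤ are isomorphic. -/
theorem classDegree_range_ne_bot (hF : IsFunctionField k F) : (classDegree hF).range ≠ ⊥ := by
  classical
  obtain ⟨Q⟩ := exists_place hF
  obtain ⟨t, ht0, ht⟩ := Q.exists_valuation_eq_exp 1
  let u : Q.Completionˣ := Units.map (Q.embedding : F →* Q.Completion) (Units.mk0 t ht0)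
  let α : Ideles F := Ideles.mk (Pi.mulSingle Q u) ((Set.finite_singleton Q).subset fun R hR => by
    by_contra hne
    exact hR (by rw [Pi.mulSingle_eq_of_ne hne]; exact one_mem _))
  have hα : (ideleDivisor α).toAdd = Finsupp.single Q 1 := by
    ext R
    rw [ideleDivisor_apply, Ideles.mk_apply]
    by_cases hR : R = Q
    · subst hR
      rw [Pi.mulSingle_eq_same, Finsupp.single_eq_same]
      refine (congrArg log (R.valued_embedding t)).trans ?_
      rw [ht, log_exp]
    · rw [Pi.mulSingle_eq_of_ne hR, Finsupp.single_eq_of_ne hR, Units.val_one, map_one, log_one]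
  intro h
  have h1 : classDegree hF (QuotientGroup.mk α) ∈ (classDegree hF).range := ⟨_, rfl⟩
  rw [h, Subgroup.mem_bot] at h1
  have h2 : Divisor.deg k (ideleDivisor α).toAdd = 0 := congrArg Multiplicative.toAdd h1
  rw [hα, Divisor.deg_single, one_mul] at h2
  exact (placeDeg_pos hF Q).ne' (by exact_mod_cast h2)

/-- The group of unit idele classes. -/
abbrev unitClasses (F : Type*) [Field F] : Subgroup (IdeleClassGroup F) :=
  (unitIdeles F).map (QuotientGroup.mk' (principalIdeles F))

theorem unitClasses_le (hF : IsFunctionField k F) : unitClasses F ≤ (classDegree hF).ker := by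
  rintro _ ⟨α, hα, rfl⟩
  change ideleDegree k α = 1
  rw [ideleDegree, MonoidHom.comp_apply, mem_unitIdeles_iff_ideleDivisor.1 hα, map_one]

/-- The divisor of an idele embeds the quotient in the finite group of divisor classes of degree
zero: ideles with equal divisors differ by a unit idele. -/
theorem relIndex_unitClasses_ne_zero (hF : IsFunctionField k F) :
    (unitClasses F).relIndex (classDegree hF).ker ≠ 0 := by
  obtain ⟨R, hR, hRD⟩ := exists_finite_classes hF
  have := hR.to_subtype
  have h1 : ∀ c : (classDegree hF).ker, ∃ r ∈ R, ∃ α : Ideles F, QuotientGroup.mk α = c.1 ∧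
      (ideleDivisor α).toAdd = r := by
    rintro ⟨c, hc⟩
    induction c using QuotientGroup.induction_on with
    | H α =>
      obtain ⟨r, hr, z, hz, h⟩ := hRD (ideleDivisor α).toAdd (congrArg Multiplicative.toAdd hc)
      obtain ⟨β, hβ⟩ := exists_principalIdele hF (Units.mk0 z hz)
      refine ⟨r, hr, α * β⁻¹, ?_, ?_⟩
      · refine QuotientGroup.eq.2 ?_
        rw [mul_inv_rev, inv_inv, inv_mul_cancel_right]
        exact mem_principalIdeles_iff.2 ⟨_, hβ⟩
      · rw [map_mul, map_inv, toAdd_mul, toAdd_inv, ideleDivisor_of_forall_eq hF hz hβ, h,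
          add_neg_cancel_right]
  choose r hr α hα hαr using h1
  refine relIndex_ne_zero_of_finite (R := R) (fun c => ⟨r c, hr c⟩) fun c c' hcc => ?_
  have h2 : r c = r c' := congrArg Subtype.val hcc
  refine ⟨(α c)⁻¹ * α c', mem_unitIdeles_iff_ideleDivisor.2 ?_, ?_⟩
  · refine Multiplicative.toAdd.injective ?_
    rw [map_mul, map_inv, toAdd_mul, toAdd_inv, hαr, hαr, h2, neg_add_cancel]
    rfl
  · change _ = (c.1)⁻¹ * c'.1
    rw [map_mul, map_inv, ← hα c, ← hα c']
    rfl

/-- A principal unit idele comes from a function without poles, and the space of such functions is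
finite. -/
theorem finite_units_inf_principal (hF : IsFunctionField k F) :
    Finite ↥(unitIdeles F ⊓ (QuotientGroup.mk' (principalIdeles F)).ker) := by
  have := finite_rrSpace hF 0
  have h : ∀ α : ↥(unitIdeles F ⊓ (QuotientGroup.mk' (principalIdeles F)).ker),
      ∃ y : rrSpace k (0 : Divisor F), ∀ Q : Place F, (α.1 Q : Q.Completion) = Q.embedding y := by
    rintro ⟨α, hα, hα'⟩
    rw [SetLike.mem_coe, QuotientGroup.ker_mk'] at hα'
    obtain ⟨y, hy⟩ := mem_principalIdeles_iff.1 hα'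
    refine ⟨⟨y, fun Q _ => ?_⟩, hy⟩
    have h1 : (Valued.v (α Q : Q.Completion) : ℤᵐ⁰) = 1 := hα Q
    rw [hy, Q.valued_embedding] at h1
    rw [h1]
    simp
  choose y hy using h
  refine Finite.of_injective y fun α β hαβ => Subtype.ext (DFunLike.ext _ _ fun Q => Units.ext ?_)
  rw [hy, hy, hαβ]

end Degree

/-! ### The Herbrand quotient of the idele class group -/

section Herbrand

/-- A generator t identifies ℤ with Y compatibly with n-th powers, so the computation for ℤ carries
over. -/
theorem hasHerbrand_subgroup_int {n : ℕ} (hn : n ≠ 0) {Y : Subgroup (Multiplicative ℤ)}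
    (hY : Y ≠ ⊥) : HasHerbrand (1 : Multiplicative ℤ →* Multiplicative ℤ) (powMonoidHom n) Y n := by
  obtain ⟨t, rfl⟩ : ∃ t : Multiplicative ℤ, Subgroup.zpowers t = Y := by
    obtain ⟨g, hg⟩ := IsCyclic.exists_generator (α := Y)
    refine ⟨g, le_antisymm ((Subgroup.zpowers_le).2 g.2) fun y hy => ?_⟩
    obtain ⟨m, hm⟩ := hg ⟨y, hy⟩
    exact ⟨m, congrArg Subtype.val hm⟩
  have ht : t ≠ 1 := fun h => hY (by rw [h, Subgroup.zpowers_one_eq_bot])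
  have hker : (zpowersHom (Multiplicative ℤ) t).ker = ⊥ := by
    refine (Subgroup.eq_bot_iff_forall _).2 fun m hm => ?_
    have h0 : t ^ m.toAdd = 1 := hm
    have h1 : m.toAdd • t.toAdd = 0 := by rw [← toAdd_zpow, h0, toAdd_one]
    exact (smul_eq_zero.1 h1).resolve_right fun h => ht (Multiplicative.toAdd.injective h)
  have hrange : (⊤ : Subgroup (Multiplicative ℤ)).map (zpowersHom (Multiplicative ℤ) t) =
      Subgroup.zpowers t := by
    rw [← MonoidHom.range_eq_map]
    rfl
  have hfin : Finite ↥((⊤ : Subgroup (Multiplicative ℤ)) ⊓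
      (zpowersHom (Multiplicative ℤ) t).ker) := by
    rw [hker, inf_bot_eq]
    infer_instance
  have h := HasHerbrand.map (g := zpowersHom (Multiplicative ℤ) t) (X := ⊤)
    (d := 1) (e := powMonoidHom n) (d' := 1) (e' := powMonoidHom n) (a := 1) (b := n)
    (fun x => by simp) (fun x => map_pow _ x n) (fun x => rfl) (fun x => by simp) le_top le_top
    (HasHerbrand.of_finite (fun x => rfl) (fun x => by simp) ?_ ?_) (hasHerbrand_int n hn)
  · rwa [hrange, div_one] at h
  · rintro _ ⟨x, hx, rfl⟩
    exact one_mem _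
  · rintro _ ⟨x, hx, rfl⟩
    exact pow_mem hx n

variable {k K L : Type*} [Field k] [Finite k] [Field K] [Field L] [Algebra k L] [Algebra K L]
  [FiniteDimensional K L] [IsGalois K L]

/-- The unit classes are the image of the unit ideles with finite kernel, so the quotient 1 is
inherited. -/
theorem hasHerbrand_unitClasses (hL : IsFunctionField k L) {σ : L ≃ₐ[K] L}
    (hσ : ∀ τ : L ≃ₐ[K] L, τ ∈ Subgroup.zpowers σ) :
    HasHerbrand (augmentation (IdeleClassGroup L) σ)
      (groupNorm (L ≃ₐ[K] L) (IdeleClassGroup L)) (unitClasses L) 1 := by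
  have hsmul : ∀ (τ : L ≃ₐ[K] L) (α : Ideles L), QuotientGroup.mk' (principalIdeles L) (τ • α) =
      τ • QuotientGroup.mk' (principalIdeles L) α := fun _ _ => rfl
  have := finite_units_inf_principal hL
  have hker : ∀ (τ : L ≃ₐ[K] L), ∀ α ∈ unitIdeles L ⊓ (QuotientGroup.mk' (principalIdeles L)).ker,
      τ • α ∈ unitIdeles L ⊓ (QuotientGroup.mk' (principalIdeles L)).ker := fun τ α hα =>
    ⟨smul_mem_unitIdeles τ hα.1, by
      have h1 : QuotientGroup.mk' (principalIdeles L) α = 1 := hα.2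
      change QuotientGroup.mk' (principalIdeles L) (τ • α) = 1
      rw [hsmul, h1, smul_one]⟩
  have h := HasHerbrand.map (g := QuotientGroup.mk' (principalIdeles L))
    (map_augmentation _ hsmul σ) (map_groupNorm _ hsmul) (augmentation_groupNorm σ)
    (groupNorm_augmentation σ) (map_augmentation_unitIdeles_le σ) map_groupNorm_unitIdeles_le
    (HasHerbrand.of_finite (augmentation_groupNorm σ) (groupNorm_augmentation σ) ?_ ?_)
    (hasHerbrand_unitIdeles hL hσ)
  · rwa [div_one] at h
  · rintro _ ⟨α, hα, rfl⟩
    exact div_mem (hker σ α hα) hα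
  · rintro _ ⟨α, hα, rfl⟩
    exact groupNorm_mem hker hα

/-- The Herbrand quotient of the idele class group is the degree of the extension. -/
theorem hasHerbrand_ideleClassGroup (hL : IsFunctionField k L) {σ : L ≃ₐ[K] L}
    (hσ : ∀ τ : L ≃ₐ[K] L, τ ∈ Subgroup.zpowers σ) :
    HasHerbrand (augmentation (IdeleClassGroup L) σ)
      (groupNorm (L ≃ₐ[K] L) (IdeleClassGroup L)) ⊤ (Module.finrank K L : ℕ) := by
  have hdeg : ∀ (τ : L ≃ₐ[K] L) (c : IdeleClassGroup L), classDegree hL (τ • c) =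
    classDegree hL c := classDegree_smul hL
  have hsmulker : ∀ (τ : L ≃ₐ[K] L), ∀ c ∈ (classDegree hL).ker, τ • c ∈ (classDegree hL).ker :=
    fun τ c hc => by
      have h1 : classDegree hL c = 1 := hc
      change classDegree hL (τ • c) = 1
      rw [hdeg, h1]
  have hsmulunit : ∀ (τ : L ≃ₐ[K] L), ∀ c ∈ unitClasses L, τ • c ∈ unitClasses L := by
    rintro τ _ ⟨α, hα, rfl⟩
    exact ⟨τ • α, smul_mem_unitIdeles τ hα, rfl⟩
  have h0 : HasHerbrand (augmentation (IdeleClassGroup L) σ)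
      (groupNorm (L ≃ₐ[K] L) (IdeleClassGroup L)) (classDegree hL).ker 1 := by
    refine HasHerbrand.of_relIndex_ne_zero (augmentation_groupNorm σ) (groupNorm_augmentation σ)
      ?_ ?_ ?_ ?_ (unitClasses_le hL) (relIndex_unitClasses_ne_zero hL)
      (hasHerbrand_unitClasses hL hσ)
    · rintro _ ⟨c, hc, rfl⟩
      exact div_mem (hsmulker σ c hc) hc
    · rintro _ ⟨c, hc, rfl⟩
      exact groupNorm_mem hsmulker hc
    · rintro _ ⟨c, hc, rfl⟩
      exact div_mem (hsmulunit σ c hc) hc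
    · rintro _ ⟨c, hc, rfl⟩
      exact groupNorm_mem hsmulunit hc
  have hcard : Fintype.card (L ≃ₐ[K] L) = Module.finrank K L := by
    rw [← Nat.card_eq_fintype_card, IsGalois.card_aut_eq_finrank]
  -- Degrees are Galois invariant, so on the image of the degree map the augmentation becomes
  -- trivial and the norm becomes multiplication by the order of the group. The kernel contributes 1
  -- and the image n.
  have h := HasHerbrand.extension (g := classDegree hL) (X := ⊤)
    (d := augmentation (IdeleClassGroup L) σ)
    (e := groupNorm (L ≃ₐ[K] L) (IdeleClassGroup L)) (d' := 1)
    (e' := powMonoidHom (Module.finrank K L)) (a := 1) (c := (Module.finrank K L : ℕ))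
    (fun c => by rw [augmentation_apply, map_div, hdeg, div_self']; rfl)
    (fun c => by
      rw [groupNorm_apply, map_prod, Finset.prod_congr rfl fun τ _ => hdeg τ c,
        Finset.prod_const, Finset.card_univ, hcard]
      rfl)
    (augmentation_groupNorm σ) (groupNorm_augmentation σ) le_top le_top
    (by rwa [top_inf_eq])
    (hasHerbrand_subgroup_int Module.finrank_pos.ne' (by
      rw [← MonoidHom.range_eq_map]
      exact classDegree_range_ne_bot hL))
  rwa [one_mul] at h

theorem card_HZero {G B : Type*} [Group G] [Finite G] [CommGroup B] [MulDistribMulAction G B]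
    {σ : G} (hσ : ∀ τ : G, τ ∈ Subgroup.zpowers σ) :
    Nat.card (HZero G B) = tateCard (augmentation B σ) (groupNorm G B) ⊤ := by
  have : FixedPoints.subgroup G B = ⊤ ⊓ (augmentation B σ).ker := by
    ext x
    rw [top_inf_eq]
    exact (augmentation_eq_one_iff hσ).symm
  rw [tateCard, ← this, ← MonoidHom.range_eq_map]
  rfl

theorem card_HNegOne {G B : Type*} [Group G] [Finite G] [CommGroup B] [MulDistribMulAction G B]
    (σ : G) : Nat.card (HNegOne B σ) = tateCard (groupNorm G B) (augmentation B σ) ⊤ := by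
  rw [tateCard, top_inf_eq, ← MonoidHom.range_eq_map]
  rfl

end Herbrand

/-! ### Galois descent from ideles of L to ideles of K -/

section Descent

open WithZero

attribute [local instance] Units.mulDistribMulActionRight

variable {K L : Type*} [Field K] [Field L] [Algebra K L] [FiniteDimensional K L]

/-- The inclusion of the ideles of `K` in those of a finite extension `L`. -/
def ideleInclusion (hfin : ∀ P : Place K, Finite {Q : Place L // P.Over (algebraMap K L) Q}) :
    Ideles K →* Ideles L where
  toFun α := Ideles.mk (fun Q => Units.map (Q.below_over (K := K)).map.toMonoidHom (α (Q.below K)))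
    ((α.finite_notMem.biUnion (t := fun P => {Q | P.Over (algebraMap K L) Q})
      fun P _ => hfin P).subset fun Q hQ => Set.mem_biUnion (x := Q.below K)
        (fun h => hQ ((Q.below_over (K := K)).valued_map_eq_one_iff.2 h)) Q.below_over)
  map_one' := DFunLike.ext _ _ fun Q => Units.ext (map_one (Q.below_over (K := K)).map)
  map_mul' _ _ := DFunLike.ext _ _ fun Q => Units.ext (map_mul (Q.below_over (K := K)).map _ _)

variable {hfin : ∀ P : Place K, Finite {Q : Place L // P.Over (algebraMap K L) Q}}

theorem semilocalUnit_ideleInclusion (P : Place K) (α : Ideles K) :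
    (semilocalUnit P (ideleInclusion hfin α) : Semilocal L P) =
      algebraMap P.Completion (Semilocal L P) (α P) := by
  funext ⟨Q, hQ⟩
  obtain rfl := hQ.below_eq
  rfl

theorem smul_ideleInclusion (σ : L ≃ₐ[K] L) (α : Ideles K) :
    σ • ideleInclusion hfin α = ideleInclusion hfin α :=
  ideles_ext (K := K) fun P => Units.ext (by
    rw [semilocalUnit_smul, Units.coe_smul, semilocalUnit_ideleInclusion,
      Semilocal.smul_algebraMap])

omit [FiniteDimensional K L] in
theorem smul_eq_embedding (σ : L ≃ₐ[K] L) {α : Ideles L} {y : L}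
    (h : ∀ Q : Place L, (α Q : Q.Completion) = Q.embedding y) (Q : Place L) :
    ((σ • α) Q : Q.Completion) = Q.embedding (σ y) := by
  rw [smul_ideles_apply, h, Place.Over.map_embedding]
  rfl

theorem groupNorm_eq_embedding {α : Ideles L} {y : L}
    (h : ∀ Q : Place L, (α Q : Q.Completion) = Q.embedding y) (Q : Place L) :
    ((groupNorm (L ≃ₐ[K] L) (Ideles L) α) Q : Q.Completion) =
      Q.embedding (∏ σ : L ≃ₐ[K] L, σ y) := by
  have h1 : ∀ β : Ideles L, (β Q : Q.Completion) = ((Units.coeHom Q.Completion).comp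
      ((Pi.evalMonoidHom (fun Q : Place L => Q.Completionˣ) Q).comp (Ideles.components L))) β :=
    fun _ => rfl
  rw [h1, groupNorm_apply, map_prod, map_prod]
  refine Finset.prod_congr rfl fun σ _ => ?_
  rw [← h1, smul_eq_embedding σ h]

/-- Hilbert's Theorem 90. -/
theorem exists_mul_eq_of_prod_eq_one {σ : L ≃ₐ[K] L}
    (hσ : ∀ τ : L ≃ₐ[K] L, τ ∈ Subgroup.zpowers σ) {y : L} (hy : ∏ τ : L ≃ₐ[K] L, τ y = 1) :
    ∃ z : Lˣ, y * σ z = z := by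
  obtain ⟨f, hf0, hf⟩ := exists_twisted_trace hσ hy
  -- Independence of the characters σ^i makes the twisted trace nonzero somewhere, because its
  -- coefficient at i = 0 is 1.
  have hli := (linearIndependent_monoidHom L L).comp
    (fun i : Fin (orderOf σ) => ((σ ^ (i : ℕ) : L ≃ₐ[K] L) : L →* L)) fun i j hij =>
      Fin.ext (pow_injOn_Iio_orderOf i.2 j.2 (AlgEquiv.ext fun l => DFunLike.congr_fun hij l))
  rw [Fintype.linearIndependent_iff] at hli
  obtain ⟨l, hl⟩ : ∃ l : L, ∑ i ∈ Finset.range (orderOf σ), f i * (σ ^ i) • l ≠ 0 := by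
    by_contra! h
    have h0 := hli (fun i => f i) (funext fun l => by
      rw [Finset.sum_apply]
      exact (Fin.sum_univ_eq_sum_range (fun i => f i * (σ ^ i) • l) _).trans (h l))
      ⟨0, orderOf_pos σ⟩
    exact one_ne_zero (hf0.symm.trans h0)
  exact ⟨Units.mk0 _ hl, hf l⟩

variable [IsGalois K L]

/-- The invariants of the ideles of `L` are the ideles of `K`. -/
theorem exists_ideleInclusion_eq {α : Ideles L} (h : ∀ σ : L ≃ₐ[K] L, σ • α = α) :
    ∃ β, ideleInclusion hfin β = α := by
  have h1 : ∀ P : Place K, ∃ c : P.Completion, algebraMap P.Completion (Semilocal L P) c =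
      semilocalUnit P α := fun P => by
    have := hfin P
    refine Semilocal.exists_algebraMap_eq _ fun σ => ?_
    rw [← Units.coe_smul, ← semilocalUnit_smul, h]
  choose c hc using h1
  have hv : ∀ (P : Place K) (Q : {Q : Place L // P.Over (algebraMap K L) Q}),
      Q.2.map (c P) = (α Q.1 : Q.1.Completion) := fun P Q => congrFun (hc P) Q
  have hc0 : ∀ P, c P ≠ 0 := fun P h0 => by
    obtain ⟨Q, hQ⟩ := P.exists_above L
    have := hv P ⟨Q, hQ⟩
    rw [h0, map_zero] at this
    exact (α Q).ne_zero this.symm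
  refine ⟨Ideles.mk (fun P => Units.mk0 (c P) (hc0 P)) ((α.finite_notMem.image
    (Place.below K)).subset fun P hP => ?_), ideles_ext (K := K) fun P => Units.ext ?_⟩
  · obtain ⟨Q, hQ⟩ := P.exists_above L
    refine ⟨Q, fun hα => hP ?_, hQ.below_eq⟩
    change (Valued.v (c P) : ℤᵐ⁰) = 1
    rw [← hQ.valued_map_eq_one_iff, hv P ⟨Q, hQ⟩]
    exact hα
  · rw [semilocalUnit_ideleInclusion, ← hc]
    rfl

/-- Over each P the algebra norm over K_P is the product of the conjugates, so the idele norm and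
the Galois norm agree after inclusion in the ideles of L. -/
theorem groupNorm_eq_ideleInclusion_iff {α : Ideles L} {β : Ideles K} :
    ideleInclusion hfin β = groupNorm (L ≃ₐ[K] L) (Ideles L) α ↔
      ideleNorm (K := K) L α = Ideles.components K β := by
  have key : ∀ P : Place K, semilocalUnit P (ideleInclusion hfin β) =
      semilocalUnit P (groupNorm (L ≃ₐ[K] L) (Ideles L) α) ↔
      ideleNorm (K := K) L α P = β P := by
    intro P
    have := hfin P
    have h1 : (semilocalUnit P (groupNorm (L ≃ₐ[K] L) (Ideles L) α) : Semilocal L P) =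
        algebraMap P.Completion _ (ideleNorm (K := K) L α P : P.Completion) := by
      rw [map_groupNorm _ (semilocalUnit_smul P), TateAcyclicLattice.groupNorm_eq]
      exact (Semilocal.algebraMap_norm _).symm
    rw [Units.ext_iff, Units.ext_iff, semilocalUnit_ideleInclusion, h1,
      (Semilocal.algebraMap_injective (L := L)).eq_iff, eq_comm]
  constructor
  · exact fun h => funext fun P => (key P).1 (by rw [h])
  · exact fun h => ideles_ext (K := K) fun P => (key P).2 (congrFun h P)

theorem exists_components_eq_ideleNorm
    (hfin : ∀ P : Place K, Finite {Q : Place L // P.Over (algebraMap K L) Q}) (α : Ideles L) :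
    ∃ β : Ideles K, ideleNorm (K := K) L α = Ideles.components K β := by
  obtain ⟨β, hβ⟩ := exists_ideleInclusion_eq (hfin := hfin)
    (α := groupNorm (L ≃ₐ[K] L) (Ideles L) α) fun σ => smul_groupNorm σ α
  exact ⟨β, groupNorm_eq_ideleInclusion_iff.1 hβ⟩

/-- If an idele of K becomes principal in L, the generating element is Galois invariant, as is seen
at any one place of L, so it lies in K. This gives injectivity on classes. -/
theorem ideleInclusion_mem_principalIdeles_iff [Nonempty (Place L)] {β : Ideles K} :
    ideleInclusion hfin β ∈ principalIdeles L ↔ β ∈ principalIdeles K := by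
  rw [mem_principalIdeles_iff, mem_principalIdeles_iff]
  constructor
  · rintro ⟨y, hy⟩
    have hfix : ∀ σ : L ≃ₐ[K] L, σ (y : L) = y := fun σ => by
      obtain ⟨Q⟩ := ‹Nonempty (Place L)›
      have h1 := smul_eq_embedding σ hy Q
      rw [smul_ideleInclusion, hy] at h1
      exact (Q.embedding.injective h1).symm
    obtain ⟨x, hx⟩ := (IsGalois.mem_range_algebraMap_iff_fixed (F := K) (y : L)).2 hfix
    have hx0 : x ≠ 0 := by
      rintro rfl
      rw [map_zero] at hx
      exact y.ne_zero hx.symm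
    refine ⟨Units.mk0 x hx0, fun P => ?_⟩
    have := hfin P
    refine Semilocal.algebraMap_injective (L := L) ?_
    rw [← semilocalUnit_ideleInclusion (hfin := hfin), Units.val_mk0,
      Semilocal.algebraMap_embedding, hx]
    exact funext fun Q => hy Q.1
  · rintro ⟨x, hx⟩
    refine ⟨Units.map (algebraMap K L).toMonoidHom x, fun Q => ?_⟩
    change (Q.below_over (K := K)).map (β (Q.below K)) = _
    rw [hx, Place.Over.map_embedding]
    rfl

variable (hfin) in
/-- The map of idele class groups induced by the inclusion `K → L`. -/
def classInclusion [Nonempty (Place L)] : IdeleClassGroup K →* IdeleClassGroup L :=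
  QuotientGroup.map _ _ (ideleInclusion hfin) fun _ h =>
    ideleInclusion_mem_principalIdeles_iff.2 h

theorem classInclusion_injective [Nonempty (Place L)] :
    Function.Injective (classInclusion hfin) := by
  refine (injective_iff_map_eq_one _).2 fun c hc => ?_
  induction c using QuotientGroup.induction_on with
  | H β =>
    exact (QuotientGroup.eq_one_iff β).2
      (ideleInclusion_mem_principalIdeles_iff.1 ((QuotientGroup.eq_one_iff _).1 hc))

/-- The invariants of the idele class group of `L` are the idele classes of `K`. -/
theorem classInclusion_range [Nonempty (Place L)] {k : Type*} [Field k] [Finite k] [Algebra k L]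
    (hL : IsFunctionField k L) {σ : L ≃ₐ[K] L} (hσ : ∀ τ : L ≃ₐ[K] L, τ ∈ Subgroup.zpowers σ) :
    (classInclusion hfin).range = FixedPoints.subgroup (L ≃ₐ[K] L) (IdeleClassGroup L) := by
  refine le_antisymm ?_ fun c hc => ?_
  · rintro _ ⟨c, rfl⟩ τ
    induction c using QuotientGroup.induction_on with
    | H β => exact congrArg QuotientGroup.mk (smul_ideleInclusion (hfin := hfin) τ β)
  · induction c using QuotientGroup.induction_on with
    | H α =>
      have h1 : (QuotientGroup.mk (σ • α) : IdeleClassGroup L) = QuotientGroup.mk α := hc σ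
      -- The obstruction to lifting an invariant class is y = α/σα, of norm 1. Theorem 90 writes y =
      -- z/σz, and then α/z is an invariant idele in the same class.
      obtain ⟨y, hy⟩ := mem_principalIdeles_iff.1 (QuotientGroup.eq.1 h1)
      have hN : ∏ τ : L ≃ₐ[K] L, τ (y : L) = 1 := by
        obtain ⟨Q⟩ := ‹Nonempty (Place L)›
        have h2 := groupNorm_eq_embedding (K := K) hy Q
        rw [map_mul, map_inv, groupNorm_smul, inv_mul_cancel] at h2
        exact Q.embedding.injective (h2.symm.trans (map_one _).symm)
      obtain ⟨z, hz⟩ := exists_mul_eq_of_prod_eq_one hσ hN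
      obtain ⟨ζ, hζ⟩ := exists_principalIdele hL z
      have hfix : σ • (α * ζ⁻¹) = α * ζ⁻¹ := by
        rw [smul_mul', smul_inv', ← div_eq_mul_inv, ← div_eq_mul_inv, div_eq_div_iff_mul_eq_mul]
        refine DFunLike.ext _ _ fun Q => Units.ext ?_
        have h3 : (((σ • α) Q : Q.Completionˣ) : Q.Completion) * Q.embedding y =
            (α Q : Q.Completion) := by
          rw [← hy Q, ← Units.val_mul, ← Ideles.mul_apply, mul_inv_cancel_left]
        have h4 : Q.embedding y * Q.embedding (σ z) = Q.embedding z := by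
          rw [← map_mul, hz]
        rw [Ideles.mul_apply, Ideles.mul_apply, Units.val_mul, Units.val_mul, hζ,
          smul_eq_embedding σ hζ, ← h3, mul_assoc, h4]
      obtain ⟨β, hβ⟩ := exists_ideleInclusion_eq (hfin := hfin)
        ((augmentation_eq_one_iff hσ).1 (div_eq_one.2 hfix))
      refine ⟨QuotientGroup.mk β, ?_⟩
      change QuotientGroup.mk (ideleInclusion hfin β) = QuotientGroup.mk α
      rw [hβ]
      refine QuotientGroup.eq.2 ?_
      rw [mul_inv_rev, inv_inv, inv_mul_cancel_right]
      exact mem_principalIdeles_iff.2 ⟨z, hζ⟩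

theorem map_normClassGroup [Nonempty (Place L)] :
    (normClassGroup K L).map (classInclusion hfin) =
      (groupNorm (L ≃ₐ[K] L) (IdeleClassGroup L)).range := by
  have hmk : ∀ α : Ideles L, groupNorm (L ≃ₐ[K] L) (IdeleClassGroup L) (QuotientGroup.mk α) =
      QuotientGroup.mk (groupNorm (L ≃ₐ[K] L) (Ideles L) α) := fun α =>
    (map_groupNorm (QuotientGroup.mk' (principalIdeles L)) (fun _ _ => rfl) α).symm
  refine le_antisymm ?_ ?_
  · rintro _ ⟨_, ⟨β, ⟨α, hα⟩, rfl⟩, rfl⟩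
    refine ⟨QuotientGroup.mk α, ?_⟩
    rw [hmk, ← (groupNorm_eq_ideleInclusion_iff (hfin := hfin)).2 hα]
    rfl
  · rintro _ ⟨c, rfl⟩
    induction c using QuotientGroup.induction_on with
    | H α =>
      obtain ⟨β, hβ⟩ := exists_components_eq_ideleNorm hfin α
      refine ⟨QuotientGroup.mk β, ⟨β, ⟨α, hβ⟩, rfl⟩, ?_⟩
      rw [hmk, ← (groupNorm_eq_ideleInclusion_iff (hfin := hfin)).2 hβ]
      rfl

/-- The inclusion identifies the class group of K with the invariant classes of L and carries the
norm group to the image of the Galois norm; an injective map preserves the index. -/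
theorem card_HZero_eq_index {k : Type*} [Field k] [Finite k] [Algebra k L]
    (hL : IsFunctionField k L) {σ : L ≃ₐ[K] L} (hσ : ∀ τ : L ≃ₐ[K] L, τ ∈ Subgroup.zpowers σ) :
    Nat.card (HZero (L ≃ₐ[K] L) (IdeleClassGroup L)) = (normClassGroup K L).index := by
  have := exists_place hL
  have hfin := fun P : Place K => finite_places_over hL P
  rw [← Subgroup.relIndex_top_right, ← Subgroup.relIndex_map_map_of_injective _ _
    (classInclusion_injective (hfin := hfin)), map_normClassGroup, ← MonoidHom.range_eq_map,
    classInclusion_range hL hσ]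
  rfl

end Descent

end GlobalClassField

end

/-! ### The theorem for extensions of global function fields -/

theorem mainTheorem2 {Fq K L : Type*} [Field Fq] [Finite Fq]
    [Field K] [Algebra (RatFunc Fq) K] [FunctionField Fq K]
    [Field L] [Algebra K L] [FiniteDimensional K L] [IsGalois K L]
    (n : ℕ) (hn : Module.finrank K L = n)
    (σ : L ≃ₐ[K] L) (hσ : ∀ τ : L ≃ₐ[K] L, τ ∈ Subgroup.zpowers σ) :
    (Finite (GlobalClassField.HZero (L ≃ₐ[K] L) (GlobalClassField.IdeleClassGroup L)) ∧
      Finite (GlobalClassField.HNegOne (GlobalClassField.IdeleClassGroup L) σ) ∧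
      GlobalClassField.herbrandQuotient (GlobalClassField.IdeleClassGroup L) σ = n) ∧
    Nat.card (GlobalClassField.HZero (L ≃ₐ[K] L) (GlobalClassField.IdeleClassGroup L)) =
      (GlobalClassField.normClassGroup K L).index ∧
    n ≤ (GlobalClassField.normClassGroup K L).index := by
  -- The structures over the constants and over the rational function field are defined by
  -- composition, so L becomes a function field over Fq with compatible scalars.
  let : Algebra Fq K := ((algebraMap (RatFunc Fq) K).comp (algebraMap Fq (RatFunc Fq))).toAlgebra
  let : Algebra (RatFunc Fq) L := ((algebraMap K L).comp (algebraMap (RatFunc Fq) K)).toAlgebra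
  let : Algebra Fq L := ((algebraMap (RatFunc Fq) L).comp (algebraMap Fq (RatFunc Fq))).toAlgebra
  have : IsScalarTower (RatFunc Fq) K L := IsScalarTower.of_algebraMap_eq fun _ => rfl
  have : IsScalarTower Fq (RatFunc Fq) L := IsScalarTower.of_algebraMap_eq fun _ => rfl
  have : FiniteDimensional (RatFunc Fq) K := ‹FunctionField Fq K›
  have : FiniteDimensional (RatFunc Fq) L := FiniteDimensional.trans (RatFunc Fq) K L
  have hL : GlobalClassField.IsFunctionField Fq L :=
    GlobalClassField.isFunctionField_of_ratFunc Fq L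
  have h := GlobalClassField.hasHerbrand_ideleClassGroup hL hσ
  have h0 := GlobalClassField.card_HZero (B := GlobalClassField.IdeleClassGroup L) hσ
  have h1 := GlobalClassField.card_HNegOne (B := GlobalClassField.IdeleClassGroup L) σ
  have hn0 := h0.trans_ne h.left
  have hn1 := h1.trans_ne h.right
  have heq : (Nat.card (GlobalClassField.HZero (L ≃ₐ[K] L)
      (GlobalClassField.IdeleClassGroup L)) : ℚ) /
      Nat.card (GlobalClassField.HNegOne (GlobalClassField.IdeleClassGroup L) σ) = n := by
    rw [h0, h1, h.eq, hn]
  have hindex := GlobalClassField.card_HZero_eq_index hL hσ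
  refine ⟨⟨Nat.finite_of_card_ne_zero hn0, Nat.finite_of_card_ne_zero hn1, heq⟩, hindex, ?_⟩
  -- Clearing the denominator gives #H⁰ = n · #H⁻¹ with #H⁻¹ ≥ 1, which is the inequality.
  rw [div_eq_iff (by exact_mod_cast hn1)] at heq
  have hmul : Nat.card (GlobalClassField.HZero (L ≃ₐ[K] L)
      (GlobalClassField.IdeleClassGroup L)) =
      n * Nat.card (GlobalClassField.HNegOne (GlobalClassField.IdeleClassGroup L) σ) := by
    exact_mod_cast heq
  rw [← hindex, hmul]
  exact Nat.le_mul_of_pos_right n (Nat.pos_of_ne_zero hn1)
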